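/- Let $n\ge 1$ be an integer, let $d,\delta\in\mathbb{R}$ with $\delta>0$, and let $Q$ be a nonzero polynomial on $\mathbb{R}^n$ (with complex coefficients) of total degree $m$. Let $f\in L^2(\mathbb{R}^n)$ be complex-valued, and let $\widehat f\in L^2(\mathbb{R}^n)$ be its Fourier transform, normalized by $\widehat f(y)=\int_{\mathbb{R}^n} f(x)e^{-i x\cdot y}\,dx$ for $f\in L^1\cap L^2$ and extended to $L^2(\mathbb{R}^n)$ by continuity. Write $|\cdot|$ for the Euclidean norm on $\mathbb{R}^n$ and the modulus on $\mathbb{C}$. Suppose that $$\int_{\mathbb{R}^n}\int_{\mathbb{R}^n}\frac{|f(x)|\,|\widehat f(y)|\,e^{|x||y|}\,|Q(y)|^{\delta}}{(1+|x|+|y|)^{d}}\,dx\,dy<\infty .$$ Then there are a real number $a>0$ and a polynomial $P$ on $\mathbb{R}^n$ (with complex coefficients) such that $f(x)=P(x)e^{-a|x|^2}$ for almost every $x\in\mathbb{R}^n$ and $$\deg P<\frac{d-n-m\delta}{2},$$ where $\deg P$ is the total degree and the zero polynomial has degree $-\infty$ (so $f=0$ almost everywhere if $d\le n+m\delta$).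 -/

import Mathlib

open MeasureTheory FourierTransform

noncomputable section

/-- The Fourier transform of an `L²` function on `ℝⁿ`, in the normalization
`f̂(y) = ∫ f(x) e^{-i x·y} dx`, extended to `L²` by Plancherel. Mathlib's `L²` transform `𝓕` uses
the kernel `e^{-2πi x·ξ}`, so `f̂(y) = (𝓕 f)(y / 2π)`. The result is a representative, determined
up to a null set. -/
def l2Fourier {n : ℕ} (f : EuclideanSpace ℝ (Fin n) → ℂ) (hf : MemLp f 2 volume)
    (y : EuclideanSpace ℝ (Fin n)) : ℂ :=
  (𝓕 (hf.toLp f : Lp ℂ 2 (volume : Measure (EuclideanSpace ℝ (Fin n)))) :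
    Lp ℂ 2 (volume : Measure (EuclideanSpace ℝ (Fin n)))) ((2 * Real.pi)⁻¹ • y)

/-- The value at a point of `ℝⁿ` of a polynomial in `n` variables with complex coefficients. -/
def polyValue {n : ℕ} (P : MvPolynomial (Fin n) ℂ) (x : EuclideanSpace ℝ (Fin n)) : ℂ :=
  MvPolynomial.eval (fun i => (x i : ℂ)) P

end

/-!
Because `f̂` is not almost everywhere zero, the hypothesis forces all exponential moments of `f` to
be finite, so `f̂` is entire. In polar coordinates in `y` the restriction of `f̂` to almost every
line through the origin satisfies the one-dimensional Beurling condition for the phase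
`t(x) = ⟪x, v⟫`. After regularization by a Gaussian the transform `G` on such a line is of order
two, and Phragmén–Lindelöf in the quadrants shows that the primitive of `G(z) G(iz)` grows
polynomially; hence `G` has finitely many zeros, and by Hadamard factorization it is a polynomial
times `e^{az²}`. Removing the regularization keeps this form. Comparing two lines shows that the
Gaussian factor is the same on all of them, and a smooth function that is a polynomial of bounded
degree on almost every line is a polynomial. So `f̂(y) = H(y) e^{-a|y|²}`, and `f` has the same
shape with Gaussian `e^{-|x|²/(4a)}`. The exponent `|x||y| - |x|²/(4a) - a|y|²` is bounded near
`x = 2ay`, and convergence of the integral there bounds `deg P + deg H`.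
-/

namespace Beurling

open Complex Set Filter Topology Metric
open scoped Real ENNReal RealInnerProductSpace

/-! ### Entire functions of order two -/

section Growth

theorem iteratedDeriv_zero_eq_zero_of_growth {H : ℂ → ℂ} (hH : Differentiable ℂ H) {C : ℝ}
    {N k : ℕ} (hC : ∀ z, ‖H z‖ ≤ C * (1 + ‖z‖) ^ N) (hk : N < k) : iteratedDeriv k H 0 = 0 := by
  have hC0 : 0 ≤ C := by simpa using (norm_nonneg _).trans (hC 0)
  have hbound : ∀ᶠ R : ℝ in atTop, ‖iteratedDeriv k H 0‖ ≤ k.factorial * (C * 2 ^ N) * R⁻¹ := by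
    filter_upwards [eventually_ge_atTop (1 : ℝ)] with R hR
    have hR0 : 0 < R := by linarith
    have hcauchy := norm_iteratedDeriv_le_of_forall_mem_sphere_norm_le (C := C * (2 * R) ^ N) k hR0
      hH.diffContOnCl (c := 0) fun z hz ↦ (hC z).trans <| by
        rw [mem_sphere_zero_iff_norm.1 hz]
        gcongr
        linarith
    have hpow : R ^ N * (R ^ k)⁻¹ ≤ R⁻¹ := by
      rw [← div_eq_mul_inv, div_le_iff₀ (by positivity), inv_mul_eq_div, le_div_iff₀ hR0,
        ← pow_succ]
      exact pow_le_pow_right₀ hR hk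
    calc ‖iteratedDeriv k H 0‖ ≤ k.factorial * (C * (2 * R) ^ N) / R ^ k := hcauchy
      _ = k.factorial * (C * 2 ^ N) * (R ^ N * (R ^ k)⁻¹) := by ring
      _ ≤ k.factorial * (C * 2 ^ N) * R⁻¹ := by gcongr
  have hlim : Tendsto (fun R : ℝ ↦ k.factorial * (C * 2 ^ N) * R⁻¹) atTop (𝓝 0) := by
    simpa using tendsto_inv_atTop_zero.const_mul ((k.factorial : ℝ) * (C * 2 ^ N))
  exact norm_le_zero_iff.1 (ge_of_tendsto hlim hbound)

theorem exists_polynomial_of_growth {H : ℂ → ℂ} (hH : Differentiable ℂ H) {C : ℝ} {N : ℕ}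
    (hC : ∀ z, ‖H z‖ ≤ C * (1 + ‖z‖) ^ N) :
    ∃ p : Polynomial ℂ, p.natDegree ≤ N ∧ ∀ z, H z = p.eval z := by
  refine ⟨∑ k ∈ Finset.range (N + 1),
    Polynomial.monomial k ((k.factorial : ℂ)⁻¹ * iteratedDeriv k H 0), ?_, fun z ↦ ?_⟩
  · refine Polynomial.natDegree_sum_le_of_forall_le _ _ fun k hk ↦ ?_
    exact (Polynomial.natDegree_monomial_le _).trans (Finset.mem_range_succ_iff.1 hk)
  · rw [← (hasSum_taylorSeries_of_entire hH 0 z).tsum_eq, tsum_eq_sum (s := Finset.range (N + 1))]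
    · simp only [Polynomial.eval_finsetSum, Polynomial.eval_monomial, sub_zero, smul_eq_mul]
      exact Finset.sum_congr rfl fun k _ ↦ by ring
    · intro k hk
      rw [iteratedDeriv_zero_eq_zero_of_growth hH hC (by simpa using hk), smul_zero, smul_zero]

theorem one_add_norm_le_two_mul_norm_one_add {z : ℂ} (hz : 0 ≤ z.re) :
    1 + ‖z‖ ≤ 2 * ‖1 + z‖ := by
  have hone : 1 ≤ ‖1 + z‖ := le_trans (by simpa using hz) (re_le_norm (1 + z))
  have hnorm : ‖z‖ ≤ ‖1 + z‖ := by
    rw [← sq_le_sq₀ (norm_nonneg _) (norm_nonneg _), ← normSq_eq_norm_sq, ← normSq_eq_norm_sq,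
      normSq_apply, normSq_apply, add_re, add_im, one_re, one_im]
    nlinarith
  linarith

theorem norm_div_one_add_pow_le {w z : ℂ} {M : ℝ} {N : ℕ} (hz : 0 ≤ z.re) (hM : 0 ≤ M)
    (hw : ‖w‖ ≤ M * (1 + ‖z‖) ^ N) : ‖w / (1 + z) ^ N‖ ≤ M * 2 ^ N := by
  have hge := one_add_norm_le_two_mul_norm_one_add hz
  have hpos : 0 < ‖1 + z‖ := by linarith [norm_nonneg z]
  rw [norm_div, norm_pow, div_le_iff₀ (pow_pos hpos _), mul_assoc, ← mul_pow]
  exact hw.trans (by gcongr)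

theorem exp_re_nonneg_of_abs_im_le {ζ : ℂ} (h : |ζ.im| ≤ π / 2) : 0 ≤ (exp ζ).re := by
  rw [exp_re]
  exact mul_nonneg (Real.exp_pos _).le (Real.cos_nonneg_of_mem_Icc (abs_le.1 h))

theorem norm_comp_exp_le {K : ℂ → ℂ} {B C : ℝ} (hK : ∀ z, ‖K z‖ ≤ C * Real.exp (B * ‖z‖ ^ 2))
    (ζ : ℂ) : ‖K (exp ζ)‖ ≤ C * Real.exp (|B| * Real.exp (2 * |ζ.re|)) := by
  have hC : 0 ≤ C := by simpa using (norm_nonneg _).trans (hK 0)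
  have hsq : ‖exp ζ‖ ^ 2 ≤ Real.exp (2 * |ζ.re|) := by
    rw [norm_exp, ← Real.exp_nat_mul, Nat.cast_ofNat]
    gcongr
    exact le_abs_self _
  refine (hK _).trans ?_
  gcongr
  exact le_abs_self B

/-- Phragmén–Lindelöf in the sector `α ≤ arg z ≤ π / 2`: since its opening is less than `π / 2`,
order two is admissible, and dividing by `(1 + z) ^ N` allows polynomial growth on the two rays. -/
theorem norm_le_of_sector {K : ℂ → ℂ} (hK : Differentiable ℂ K) {B C M : ℝ} {N : ℕ}
    (hgrowth : ∀ z, ‖K z‖ ≤ C * Real.exp (B * ‖z‖ ^ 2)) {α : ℝ} (hα : 0 < α) (hα' : α < π / 2)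
    (hlower : ∀ s : ℝ, 0 ≤ s → ‖K (s * exp (α * I))‖ ≤ M * (1 + s) ^ N)
    (hupper : ∀ s : ℝ, 0 ≤ s → ‖K (s * I)‖ ≤ M * (1 + s) ^ N)
    {z : ℂ} (hz : z ≠ 0) (hαz : α ≤ arg z) (hzπ : arg z ≤ π / 2) :
    ‖K z‖ ≤ M * 2 ^ N * (1 + ‖z‖) ^ N := by
  have hM : 0 ≤ M := by simpa using (norm_nonneg _).trans (hlower 0 le_rfl)
  have hre {ζ : ℂ} (hζ : ζ.im ∈ Icc α (π / 2)) : 0 ≤ (exp ζ).re :=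
    exp_re_nonneg_of_abs_im_le (abs_le.2 ⟨by linarith [hζ.1], hζ.2⟩)
  have hone {ζ : ℂ} (hζ : ζ.im ∈ Icc α (π / 2)) : 1 ≤ ‖1 + exp ζ‖ :=
    le_trans (by simpa using hre hζ) (re_le_norm (1 + exp ζ))
  have hclosure : closure (im ⁻¹' Ioo α (π / 2)) ⊆ im ⁻¹' Icc α (π / 2) :=
    closure_minimal (preimage_mono Ioo_subset_Icc_self) (isClosed_Icc.preimage continuous_im)
  have hstrip : ‖K (exp (log z)) / (1 + exp (log z)) ^ N‖ ≤ M * 2 ^ N := by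
    refine PhragmenLindelof.horizontal_strip (f := fun ζ ↦ K (exp ζ) / (1 + exp ζ) ^ N)
      (a := α) (b := π / 2) ?_ ⟨2, ?_, |B|, ?_⟩ ?_ ?_ (by rwa [log_im]) (by rwa [log_im])
    · refine DifferentiableOn.diffContOnCl fun ζ hζ ↦ DifferentiableAt.differentiableWithinAt ?_
      exact ((hK _).comp ζ differentiable_exp.differentiableAt).div (by fun_prop)
        (pow_ne_zero _ (norm_pos_iff.1 (by linarith [hone (hclosure hζ)])))
    · rw [lt_div_iff₀ (by linarith)]
      linarith
    · refine Asymptotics.IsBigO.of_bound C ?_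
      filter_upwards [mem_inf_of_right (mem_principal_self _)] with ζ hζ
      rw [norm_div, norm_pow, Real.norm_of_nonneg (Real.exp_pos _).le]
      exact (div_le_self (norm_nonneg _) (one_le_pow₀ (hone (Ioo_subset_Icc_self hζ)))).trans
        (norm_comp_exp_le hgrowth ζ)
    · intro ζ hζ
      refine norm_div_one_add_pow_le (hre (by simp [hζ, hα'.le])) hM ?_
      have hray := hlower (Real.exp ζ.re) (Real.exp_pos _).le
      rwa [ofReal_exp, ← exp_add, ← hζ, re_add_im, ← norm_exp] at hray
    · intro ζ hζ
      refine norm_div_one_add_pow_le (hre (by simp [hζ, hα'.le])) hM ?_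
      have hray := hupper (Real.exp ζ.re) (Real.exp_pos _).le
      rwa [← exp_pi_div_two_mul_I, ofReal_exp, ← exp_add, ← ofReal_ofNat, ← ofReal_div, ← hζ,
        re_add_im, ← norm_exp] at hray
  rw [exp_log hz, norm_div, norm_pow, div_le_iff₀] at hstrip
  · refine hstrip.trans ?_
    gcongr
    exact (norm_add_le _ _).trans_eq (by rw [norm_one])
  · have h := hone (ζ := log z) (by rw [log_im]; exact ⟨hαz, hzπ⟩)
    rw [exp_log hz] at h
    positivity

end Growth

section Primitive

/-- The primitive vanishing at the origin of an entire function. -/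
noncomputable def primitive (H : ℂ → ℂ) (z : ℂ) : ℂ := ∫ t in (0 : ℝ)..1, z * H (t * z)

theorem hasDerivAt_primitive {H : ℂ → ℂ} (hH : Differentiable ℂ H) (z : ℂ) :
    HasDerivAt (primitive H) (H z) z := by
  obtain ⟨Φ, hΦ⟩ := hH.isExactOn_univ
  have hprim : primitive H = fun z ↦ Φ z - Φ 0 := by
    ext w
    have hd : ∀ t ∈ uIcc (0 : ℝ) 1, HasDerivAt (fun t : ℝ ↦ Φ (t * w)) (w * H (t * w)) t := by
      intro t _
      have hline : HasDerivAt (fun t : ℝ ↦ (t : ℂ) * w) w t := by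
        simpa using (ofRealCLM.hasDerivAt (x := t)).mul_const w
      rw [mul_comm w]
      exact (hΦ (t * w) (mem_univ _)).comp t hline
    have hc : Continuous H := hH.continuous
    simpa [primitive] using intervalIntegral.integral_eq_sub_of_hasDerivAt hd
      (Continuous.intervalIntegrable (by fun_prop) _ _)
  rw [hprim]
  exact (hΦ z (mem_univ _)).sub_const _

theorem differentiable_primitive {H : ℂ → ℂ} (hH : Differentiable ℂ H) :
    Differentiable ℂ (primitive H) :=
  fun z ↦ (hasDerivAt_primitive hH z).differentiableAt

theorem primitive_mul_left (H : ℂ → ℂ) (c w : ℂ) :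
    primitive H (c * w) = c * primitive (fun u ↦ H (c * u)) w := by
  simp only [primitive, mul_assoc, mul_left_comm _ c, intervalIntegral.integral_const_mul]

theorem norm_primitive_le_of_monotone {H : ℂ → ℂ} {g : ℝ → ℝ} (hg : Monotone g)
    (hle : ∀ z, ‖H z‖ ≤ g ‖z‖) (z : ℂ) : ‖primitive H z‖ ≤ ‖z‖ * g ‖z‖ := by
  have hbound : ∀ t ∈ uIoc (0 : ℝ) 1, ‖z * H (t * z)‖ ≤ ‖z‖ * g ‖z‖ := by
    intro t ht
    rw [uIoc_of_le zero_le_one] at ht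
    rw [norm_mul]
    gcongr
    refine (hle _).trans (hg ?_)
    rw [norm_mul, norm_real, Real.norm_of_nonneg ht.1.le]
    exact mul_le_of_le_one_left (norm_nonneg _) ht.2
  simpa [primitive] using intervalIntegral.norm_integral_le_of_norm_le_const hbound

theorem norm_primitive_ray_le {H : ℂ → ℂ} (hH : Continuous H) {u : ℂ} (hu : ‖u‖ = 1) {s : ℝ}
    (hs : 0 ≤ s) {g : ℝ → ℝ} (hg : IntervalIntegrable g volume 0 s)
    (hle : ∀ x : ℝ, 0 ≤ x → ‖H (x * u)‖ ≤ g x) :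
    ‖primitive H (s * u)‖ ≤ ∫ x in (0 : ℝ)..s, g x := by
  calc ‖primitive H (s * u)‖
      ≤ ∫ t in (0 : ℝ)..1, ‖s * u * H (t * (s * u))‖ :=
        intervalIntegral.norm_integral_le_integral_norm zero_le_one
    _ = s * ∫ t in (0 : ℝ)..1, ‖H ((t * s : ℝ) * u)‖ := by
        simp only [← intervalIntegral.integral_const_mul, norm_mul, hu, norm_real,
          Real.norm_of_nonneg hs, one_mul, ofReal_mul, mul_assoc]
    _ = ∫ x in (0 : ℝ)..s, ‖H (x * u)‖ := by
        simpa using intervalIntegral.smul_integral_comp_mul_right (a := 0) (b := 1)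
          (fun x : ℝ ↦ ‖H (x * u)‖) s
    _ ≤ ∫ x in (0 : ℝ)..s, g x :=
        intervalIntegral.integral_mono_on hs (Continuous.intervalIntegrable (by fun_prop) _ _) hg
          fun x hx ↦ hle x hx.1

end Primitive

section Product

/-- The hypothesis of Beurling's theorem for an entire function `G`: it has the radial majorant `m`,
and `∫ |G| m` grows polynomially along the positive half-line. The analogous bound on the negative
half-line is the same hypothesis for `z ↦ G (-z)`. -/
structure BeurlingGrowth (m : ℝ → ℝ) (M : ℝ) (N : ℕ) (G : ℂ → ℂ) : Prop where
  differentiable : Differentiable ℂ G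
  norm_le : ∀ z, ‖G z‖ ≤ m ‖z‖
  integral_le : ∀ R : ℝ, 0 ≤ R → ∫ s in (0 : ℝ)..R, ‖G s‖ * m s ≤ M * (1 + R) ^ N

/-- The product `A(u) B(iu)`, with the argument of `A` rotated by `-α`. On the rays `arg u = α` and
`arg u = π / 2` one of the two factors is evaluated at a real point. -/
noncomputable def rotatedProduct (A B : ℂ → ℂ) (α : ℝ) (u : ℂ) : ℂ :=
  A (exp (-α * I) * u) * B (I * u)

variable {A B G : ℂ → ℂ} {m : ℝ → ℝ} {C b M : ℝ} {N : ℕ}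

theorem differentiable_rotatedProduct (hA : Differentiable ℂ A) (hB : Differentiable ℂ B) (α : ℝ) :
    Differentiable ℂ (rotatedProduct A B α) :=
  (hA.comp (by fun_prop)).mul (hB.comp (by fun_prop))

theorem norm_exp_neg_ofReal_mul_I (α : ℝ) : ‖exp (-α * I)‖ = 1 := by
  simpa using norm_exp_ofReal_mul_I (-α)

theorem BeurlingGrowth.nonneg (hG : BeurlingGrowth m M N G) : 0 ≤ M := by
  simpa using hG.integral_le 0 le_rfl

theorem BeurlingGrowth.norm_le_of_comp_neg (hG : BeurlingGrowth m M N fun z ↦ G (-z)) (z : ℂ) :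
    ‖G z‖ ≤ m ‖z‖ := by
  simpa using hG.norm_le (-z)

theorem BeurlingGrowth.intervalIntegrable (hG : BeurlingGrowth m M N G) (hm : Monotone m) (R : ℝ) :
    IntervalIntegrable (fun s : ℝ ↦ ‖G s‖ * m s) volume 0 R := by
  have hc : Continuous G := hG.differentiable.continuous
  exact hm.intervalIntegrable.continuousOn_mul (by fun_prop)

theorem norm_primitive_rotatedProduct_le_of_mem_ray (hm : Monotone m) (hA : BeurlingGrowth m M N A)
    (hBd : Differentiable ℂ B) (hB : ∀ z, ‖B z‖ ≤ m ‖z‖) (α : ℝ) {s : ℝ} (hs : 0 ≤ s) :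
    ‖primitive (rotatedProduct A B α) (s * exp (α * I))‖ ≤ M * (1 + s) ^ N := by
  refine (norm_primitive_ray_le (differentiable_rotatedProduct hA.differentiable hBd α).continuous
    (norm_exp_ofReal_mul_I α) hs (hA.intervalIntegrable hm s) fun x hx ↦ ?_).trans
      (hA.integral_le s hs)
  have hreal : exp (-α * I) * (x * exp (α * I)) = x := by
    rw [mul_left_comm, ← exp_add, neg_mul, neg_add_cancel, exp_zero, mul_one]
  rw [rotatedProduct, hreal, norm_mul]
  gcongr
  refine (hB _).trans_eq ?_
  rw [norm_mul, norm_mul, norm_exp_ofReal_mul_I, norm_I, norm_real, Real.norm_of_nonneg hx,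
    one_mul, mul_one]

theorem norm_primitive_rotatedProduct_le_of_mem_imaginary_axis (hm : Monotone m)
    (hAd : Differentiable ℂ A) (hA : ∀ z, ‖A z‖ ≤ m ‖z‖)
    (hBd : Differentiable ℂ B) (hB : BeurlingGrowth m M N fun z ↦ B (-z)) (α : ℝ)
    {s : ℝ} (hs : 0 ≤ s) :
    ‖primitive (rotatedProduct A B α) (s * I)‖ ≤ M * (1 + s) ^ N := by
  refine (norm_primitive_ray_le (differentiable_rotatedProduct hAd hBd α).continuous norm_I hs
    (hB.intervalIntegrable hm s) fun x hx ↦ ?_).trans (hB.integral_le s hs)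
  have hreal : I * (x * I) = -x := by rw [mul_left_comm, I_mul_I, mul_neg_one]
  rw [rotatedProduct, hreal, norm_mul, mul_comm]
  gcongr
  refine (hA _).trans_eq ?_
  rw [norm_mul, norm_mul, norm_exp_neg_ofReal_mul_I, norm_I, norm_real, Real.norm_of_nonneg hx,
    one_mul, mul_one]

theorem norm_primitive_rotatedProduct_le_exp (hm : Monotone m) (hA : ∀ z, ‖A z‖ ≤ m ‖z‖)
    (hB : ∀ z, ‖B z‖ ≤ m ‖z‖) (hgrowth : ∀ r, 0 ≤ r → m r ≤ C * Real.exp (b * r ^ 2))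
    (α : ℝ) (z : ℂ) :
    ‖primitive (rotatedProduct A B α) z‖ ≤ C ^ 2 * Real.exp ((2 * b + 1) * ‖z‖ ^ 2) := by
  have hprod (w : ℂ) : ‖rotatedProduct A B α w‖ ≤ m ‖w‖ ^ 2 := by
    have hAw : ‖A (exp (-α * I) * w)‖ ≤ m ‖w‖ := by
      simpa only [norm_mul, norm_exp_neg_ofReal_mul_I, one_mul] using hA (exp (-α * I) * w)
    have hBw : ‖B (I * w)‖ ≤ m ‖w‖ := by simpa using hB (I * w)
    rw [rotatedProduct, norm_mul, sq]
    exact mul_le_mul hAw hBw (norm_nonneg _) ((norm_nonneg _).trans hAw)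
  have hm0 (r : ℝ) (hr : 0 ≤ r) : 0 ≤ m r := by
    simpa [abs_of_nonneg hr] using (norm_nonneg _).trans (hA r)
  have hsq : Monotone fun r ↦ m (max r 0) ^ 2 := fun r s hrs ↦
    pow_le_pow_left₀ (hm0 _ (le_max_right _ _)) (hm (max_le_max_right 0 hrs)) 2
  have hbound := norm_primitive_le_of_monotone hsq
    (fun w ↦ by simpa only [max_eq_left (norm_nonneg w)] using hprod w) z
  rw [max_eq_left (norm_nonneg z)] at hbound
  have hnorm : ‖z‖ ≤ Real.exp (‖z‖ ^ 2) := by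
    nlinarith [Real.add_one_le_exp (‖z‖ ^ 2), sq_nonneg (‖z‖ - 1 / 2)]
  calc ‖primitive (rotatedProduct A B α) z‖ ≤ ‖z‖ * m ‖z‖ ^ 2 := hbound
    _ ≤ Real.exp (‖z‖ ^ 2) * (C * Real.exp (b * ‖z‖ ^ 2)) ^ 2 := by
        gcongr
        · exact hm0 _ (norm_nonneg z)
        · exact hgrowth _ (norm_nonneg z)
    _ = C ^ 2 * Real.exp ((2 * b + 1) * ‖z‖ ^ 2) := by
        rw [mul_pow, ← Real.exp_nat_mul, mul_left_comm, ← Real.exp_add]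
        push_cast
        ring_nf

theorem continuous_primitive_rotatedProduct (hA : Continuous A) (hB : Continuous B) (z : ℂ) :
    Continuous fun α : ℝ ↦ primitive (rotatedProduct A B α) z := by
  simp only [primitive, rotatedProduct]
  exact intervalIntegral.continuous_parametric_intervalIntegral_of_continuous' (by fun_prop) _ _

/-- The quadrant itself has the critical opening for order two, so the estimate is first obtained in
the sectors `α ≤ arg z ≤ π / 2`, uniformly in `α`. -/
theorem norm_primitive_le_of_quadrant (hm : Monotone m)
    (hgrowth : ∀ r, 0 ≤ r → m r ≤ C * Real.exp (b * r ^ 2)) (hA : BeurlingGrowth m M N A)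
    (hB : BeurlingGrowth m M N fun z ↦ B (-z)) {z : ℂ} (hre : 0 ≤ z.re) (him : 0 ≤ z.im) :
    ‖primitive (fun u ↦ A u * B (I * u)) z‖ ≤ M * 2 ^ N * (1 + ‖z‖) ^ N := by
  have hBd : Differentiable ℂ B := by
    simpa [Function.comp_def] using hB.differentiable.comp differentiable_neg
  have hBm := hB.norm_le_of_comp_neg
  have hzero : rotatedProduct A B 0 = fun u ↦ A u * B (I * u) := by
    ext u
    simp [rotatedProduct]
  have hlower (α : ℝ) {s : ℝ} (hs : 0 ≤ s) :=
    norm_primitive_rotatedProduct_le_of_mem_ray hm hA hBd hBm α hs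
  have hupper (α : ℝ) {s : ℝ} (hs : 0 ≤ s) :=
    norm_primitive_rotatedProduct_le_of_mem_imaginary_axis hm hA.differentiable hA.norm_le hBd hB
      α hs
  rw [← hzero]
  rcases (arg_nonneg_iff.2 him).eq_or_lt with harg | harg
  · have hray := hlower 0 (norm_nonneg z)
    rw [harg, norm_mul_exp_arg_mul_I, ← harg] at hray
    refine hray.trans ?_
    gcongr
    exact le_mul_of_one_le_right hA.nonneg (one_le_pow₀ one_le_two)
  · have hcont := (continuous_primitive_rotatedProduct hA.differentiable.continuous
      hBd.continuous z).norm
    refine le_of_tendsto (hcont.continuousWithinAt (s := Ioi 0) (x := 0)).tendsto ?_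
    have hpos : 0 < min (arg z) (π / 4) := lt_min harg (by positivity)
    filter_upwards [Ioo_mem_nhdsGT hpos] with α ⟨hα, hαmin⟩
    obtain ⟨hαz, hαπ⟩ := lt_min_iff.1 hαmin
    exact norm_le_of_sector
      (differentiable_primitive (differentiable_rotatedProduct hA.differentiable hBd α))
      (norm_primitive_rotatedProduct_le_exp hm hA.norm_le hBm hgrowth α) hα
      (by linarith [Real.pi_pos]) (fun s ↦ hlower α) (fun s ↦ hupper α)
      (by rintro rfl; simp at harg) hαz.le (arg_le_pi_div_two_iff.2 (Or.inl hre))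

theorem norm_primitive_mul_rotate_le (hm : Monotone m)
    (hgrowth : ∀ r, 0 ≤ r → m r ≤ C * Real.exp (b * r ^ 2)) (hG : BeurlingGrowth m M N G)
    (hGneg : BeurlingGrowth m M N fun z ↦ G (-z)) (z : ℂ) :
    ‖primitive (fun u ↦ G u * G (I * u)) z‖ ≤ M * 2 ^ N * (1 + ‖z‖) ^ N := by
  have hGnegneg : BeurlingGrowth m M N fun z ↦ G (- -z) := by simpa using hG
  have hrotate {c : ℂ} (hc : ‖c‖ = 1) (w : ℂ)
      (h : ‖primitive (fun u ↦ G (c * u) * G (I * (c * u))) w‖ ≤ M * 2 ^ N * (1 + ‖w‖) ^ N)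
      (hz : c * w = z) :
      ‖primitive (fun u ↦ G u * G (I * u)) z‖ ≤ M * 2 ^ N * (1 + ‖z‖) ^ N := by
    rwa [← hz, primitive_mul_left, norm_mul, norm_mul, hc, one_mul, one_mul]
  have hI (w : ℂ) : I * (I * w) = -w := by rw [← mul_assoc, I_mul_I, neg_one_mul]
  rcases le_total 0 z.re with hre | hre <;> rcases le_total 0 z.im with him | him
  · exact norm_primitive_le_of_quadrant hm hgrowth hG hGneg hre him
  · refine hrotate (c := -I) (by simp) (I * z) ?_ (by simp [hI])
    simpa only [neg_mul, mul_neg, hI, neg_neg, mul_comm (G (-_))] using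
      norm_primitive_le_of_quadrant (B := fun z ↦ G (-z)) hm hgrowth
      hG hGnegneg (z := I * z) (by simpa using him) (by simpa using hre)
  · refine hrotate (c := I) (by simp) (-I * z) ?_ (by simp [hI])
    simpa only [hI, mul_comm (G (-_))] using norm_primitive_le_of_quadrant hm hgrowth
      hGneg hGneg (z := -I * z) (by simpa using him) (by simpa using hre)
  · refine hrotate (c := -1) (by simp) (-z) ?_ (by simp)
    simpa using norm_primitive_le_of_quadrant (B := fun z ↦ G (-z)) hm hgrowth
      hGneg hGnegneg (z := -z) (by simpa using hre) (by simpa using him)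

theorem exists_polynomial_mul_rotate (hm : Monotone m)
    (hgrowth : ∀ r, 0 ≤ r → m r ≤ C * Real.exp (b * r ^ 2)) (hG : BeurlingGrowth m M N G)
    (hGneg : BeurlingGrowth m M N fun z ↦ G (-z)) :
    ∃ p : Polynomial ℂ, p.natDegree ≤ N ∧ ∀ z, G z * G (I * z) = p.eval z := by
  have hd : Differentiable ℂ fun u ↦ G u * G (I * u) :=
    hG.differentiable.mul (hG.differentiable.comp (by fun_prop))
  obtain ⟨p, hpN, hp⟩ := exists_polynomial_of_growth (differentiable_primitive hd)
    (norm_primitive_mul_rotate_le hm hgrowth hG hGneg)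
  refine ⟨p.derivative, (Polynomial.natDegree_derivative_le p).trans (by lia), fun z ↦ ?_⟩
  have hderiv := hasDerivAt_primitive hd z
  rw [funext hp] at hderiv
  exact hderiv.unique (p.hasDerivAt z)

end Product

section ZeroFree

theorem exists_norm_eval_le (p : Polynomial ℂ) :
    ∃ K : ℝ, 0 ≤ K ∧ ∀ z, ‖p.eval z‖ ≤ K * (1 + ‖z‖) ^ p.natDegree := by
  refine ⟨∑ k ∈ Finset.range (p.natDegree + 1), ‖p.coeff k‖, by positivity, fun z ↦ ?_⟩
  rw [Polynomial.eval_eq_sum_range, Finset.sum_mul]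
  refine norm_sum_le_of_le _ fun k hk ↦ ?_
  rw [norm_mul, norm_pow]
  gcongr
  calc ‖z‖ ^ k ≤ (1 + ‖z‖) ^ k := by gcongr; linarith
    _ ≤ (1 + ‖z‖) ^ p.natDegree :=
        pow_le_pow_right₀ (by linarith [norm_nonneg z]) (Finset.mem_range_succ_iff.1 hk)

theorem exists_le_norm_eval {p : Polynomial ℂ} (hp : p ≠ 0) :
    ∃ c R : ℝ, 0 < c ∧ ∀ z : ℂ, R ≤ ‖z‖ → c ≤ ‖p.eval z‖ := by
  rcases Nat.eq_zero_or_pos p.natDegree with hdeg | hdeg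
  · obtain ⟨a, rfl⟩ := Polynomial.natDegree_eq_zero.1 hdeg
    exact ⟨‖a‖, 0, by simpa using hp, fun z _ ↦ by simp⟩
  · have hlim := p.tendsto_norm_atTop (Polynomial.natDegree_pos_iff_degree_pos.1 hdeg)
      (tendsto_norm_cobounded_atTop (E := ℂ))
    have hev := hlim.eventually_ge_atTop 1
    rw [← comap_norm_atTop, eventually_comap] at hev
    obtain ⟨R, hR⟩ := eventually_atTop.1 hev
    exact ⟨1, R, one_pos, fun z hz ↦ hR _ hz z rfl⟩

theorem eventually_mul_one_add_pow_lt_mul_exp {c κ : ℝ} (hc : 0 < c) (hκ : 0 < κ) (K : ℝ) (N : ℕ) :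
    ∀ᶠ r : ℝ in atTop, K * (1 + r) ^ N < c * Real.exp (κ * r) := by
  have hlittle := (isLittleO_pow_exp_pos_mul_atTop N hκ).comp_tendsto
    (tendsto_atTop_add_const_left atTop (1 : ℝ) tendsto_id)
  have hε : 0 < c / ((|K| + 1) * Real.exp κ) := by positivity
  filter_upwards [hlittle.bound hε, eventually_ge_atTop 0] with r hr hr0
  simp only [Function.comp_apply, id_eq] at hr
  rw [Real.norm_of_nonneg (by positivity), Real.norm_of_nonneg (by positivity)] at hr
  calc K * (1 + r) ^ N < (|K| + 1) * (1 + r) ^ N := by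
        gcongr
        linarith [le_abs_self K]
    _ ≤ (|K| + 1) * (c / ((|K| + 1) * Real.exp κ) * Real.exp (κ * (1 + r))) := by gcongr
    _ = c * Real.exp (κ * r) := by
        rw [mul_add, mul_one, Real.exp_add]
        field_simp

theorem eq_zero_of_polynomial_eq_mul_exp {p q : Polynomial ℂ} (hq : q ≠ 0) {β : ℂ}
    (h : ∀ z, p.eval z = q.eval z * exp (β * z)) : β = 0 := by
  by_contra hβ
  have hβpos : 0 < ‖β‖ := norm_pos_iff.2 hβ
  obtain ⟨c, R, hc, hcR⟩ := exists_le_norm_eval hq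
  obtain ⟨K, -, hKp⟩ := exists_norm_eval_le p
  obtain ⟨r, hr, hr0, hrR⟩ := ((eventually_mul_one_add_pow_lt_mul_exp hc hβpos K p.natDegree).and
    ((eventually_ge_atTop 0).and (eventually_ge_atTop R))).exists
  set z : ℂ := (r / ‖β‖ : ℝ) * (starRingEnd ℂ) β with hz
  have hznorm : ‖z‖ = r := by
    rw [hz, norm_mul, norm_real, RCLike.norm_conj, Real.norm_of_nonneg (by positivity),
      div_mul_cancel₀ _ hβpos.ne']
  have hexp : ‖exp (β * z)‖ = Real.exp (‖β‖ * r) := by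
    rw [norm_exp, hz, mul_left_comm, mul_conj, normSq_eq_norm_sq, ← ofReal_mul, ofReal_re]
    field_simp
  refine absurd hr (not_lt.2 ?_)
  calc c * Real.exp (‖β‖ * r) ≤ ‖q.eval z‖ * ‖exp (β * z)‖ := by
        rw [hexp]
        gcongr
        exact hcR z (hrR.trans hznorm.ge)
    _ = ‖p.eval z‖ := by rw [h, norm_mul]
    _ ≤ K * (1 + r) ^ p.natDegree := hznorm ▸ hKp z

theorem exists_eq_sub_mul_of_eq_zero {G : ℂ → ℂ} (hG : Differentiable ℂ G) {z₀ : ℂ}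
    (h0 : G z₀ = 0) : ∃ G₁ : ℂ → ℂ, Differentiable ℂ G₁ ∧ ∀ z, G z = (z - z₀) * G₁ z := by
  refine ⟨dslope G z₀, ?_, fun z ↦ ?_⟩
  · rw [← differentiableOn_univ, differentiableOn_dslope univ_mem]
    exact hG.differentiableOn
  · simpa only [smul_eq_mul, h0, sub_zero] using (sub_smul_dslope G z₀ z).symm

theorem exists_polynomial_mul_ne_zero {G B : ℂ → ℂ} (hG : Differentiable ℂ G)
    (hB : Continuous B) {p : Polynomial ℂ} (hp : p ≠ 0) (h : ∀ z, G z * B z = p.eval z) :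
    ∃ (P : Polynomial ℂ) (G₁ : ℂ → ℂ), P ≠ 0 ∧ P.natDegree ≤ p.natDegree ∧ Differentiable ℂ G₁ ∧
      (∀ z, G₁ z ≠ 0) ∧ ∀ z, G z = P.eval z * G₁ z := by
  induction hn : p.natDegree generalizing G p with
  | zero =>
    refine ⟨1, G, one_ne_zero, by simp, hG, fun z hz ↦ hp ?_, by simp⟩
    obtain ⟨a, rfl⟩ := Polynomial.natDegree_eq_zero.1 hn
    have hpz := h z
    rw [hz, zero_mul, Polynomial.eval_C] at hpz
    rw [← hpz, Polynomial.C_0]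
  | succ n ih =>
    by_cases hzero : ∀ z, G z ≠ 0
    · exact ⟨1, G, one_ne_zero, by simp, hG, hzero, by simp⟩
    push Not at hzero
    obtain ⟨z₀, hz₀⟩ := hzero
    obtain ⟨q, rfl⟩ : Polynomial.X - Polynomial.C z₀ ∣ p :=
      Polynomial.dvd_iff_isRoot.2 (by rw [Polynomial.IsRoot, ← h z₀, hz₀, zero_mul])
    have hq : q ≠ 0 := right_ne_zero_of_mul hp
    have hdeg : q.natDegree = n := by
      rw [Polynomial.natDegree_mul (Polynomial.X_sub_C_ne_zero _) hq,
        Polynomial.natDegree_X_sub_C] at hn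
      lia
    obtain ⟨D, hD, hGD⟩ := exists_eq_sub_mul_of_eq_zero hG hz₀
    have hDB : (fun z ↦ D z * B z) = fun z ↦ q.eval z := by
      refine Continuous.ext_on (dense_compl_singleton z₀) (hD.continuous.mul hB)
        q.continuous fun z hz ↦ mul_left_cancel₀ (sub_ne_zero.2 hz) ?_
      simpa [hGD, mul_assoc] using h z
    obtain ⟨P, G₁, hP, hPd, hG₁, hne, heq⟩ := ih hD hq (congrFun hDB) hdeg
    refine ⟨(Polynomial.X - Polynomial.C z₀) * P, G₁,
      mul_ne_zero (Polynomial.X_sub_C_ne_zero _) hP, ?_, hG₁, hne, fun z ↦ ?_⟩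
    · rw [Polynomial.natDegree_mul (Polynomial.X_sub_C_ne_zero _) hP,
        Polynomial.natDegree_X_sub_C]
      lia
    · simp [hGD z, heq z, mul_assoc]

theorem exists_eq_exp_of_ne_zero {G : ℂ → ℂ} (hG : Differentiable ℂ G) (h0 : ∀ z, G z ≠ 0) :
    ∃ φ : ℂ → ℂ, Differentiable ℂ φ ∧ ∀ z, G z = exp (φ z) := by
  have hdG : Differentiable ℂ (deriv G) :=
    differentiableOn_univ.1 (hG.differentiableOn.deriv isOpen_univ)
  obtain ⟨φ, hφ⟩ := (hdG.div hG h0).isExactOn_univ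
  have hquot (z : ℂ) : HasDerivAt (fun z ↦ G z * exp (-φ z)) 0 z := by
    convert! (hG z).hasDerivAt.mul ((hφ z (mem_univ _)).neg.cexp) using 1
    rw [Pi.div_apply]
    field_simp [h0 z]
    ring
  have hconst (z : ℂ) : G z * exp (-φ z) = G 0 * exp (-φ 0) :=
    is_const_of_deriv_eq_zero (fun z ↦ (hquot z).differentiableAt) (fun z ↦ (hquot z).deriv) z 0
  refine ⟨fun z ↦ φ z + log (G 0 * exp (-φ 0)),
    fun z ↦ ((hφ z (mem_univ _)).add_const _).differentiableAt, fun z ↦ ?_⟩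
  rw [exp_add, exp_log (mul_ne_zero (h0 0) (exp_ne_zero _)), ← hconst z, mul_left_comm, ← exp_add,
    add_neg_cancel, exp_zero, mul_one]

theorem exists_polynomial_of_re_le {φ : ℂ → ℂ} (hφ : Differentiable ℂ φ) {A : ℝ} (hA : 0 < A)
    {N : ℕ} (hre : ∀ z, (φ z).re ≤ A * (1 + ‖z‖) ^ N) :
    ∃ q : Polynomial ℂ, q.natDegree ≤ N ∧ ∀ z, φ z = q.eval z := by
  refine exists_polynomial_of_growth hφ (C := 2 * (A * 3 ^ N) + 3 * ‖φ 0‖) fun z ↦ ?_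
  have hz := norm_nonneg z
  set R := 2 * (1 + ‖z‖) with hR
  have hM : 0 < A * 3 ^ N * (1 + ‖z‖) ^ N := by positivity
  have hmaps : MapsTo φ (ball 0 R) {w | w.re ≤ A * 3 ^ N * (1 + ‖z‖) ^ N} := fun w hw ↦ by
    rw [mem_ball_zero_iff] at hw
    refine (hre w).trans ?_
    rw [mul_assoc, ← mul_pow]
    gcongr
    linarith
  have hbc := borelCaratheodory hM hφ.differentiableOn hmaps (by positivity) (z := z)
    (by rw [mem_ball_zero_iff]; linarith)
  have hden : 0 < R - ‖z‖ := by linarith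
  have hmain : 2 * (A * 3 ^ N * (1 + ‖z‖) ^ N) * ‖z‖ / (R - ‖z‖) ≤
      2 * (A * 3 ^ N * (1 + ‖z‖) ^ N) := by
    rw [div_le_iff₀ hden]
    gcongr
    linarith
  have hinit : ‖φ 0‖ * (R + ‖z‖) / (R - ‖z‖) ≤ 3 * ‖φ 0‖ := by
    rw [div_le_iff₀ hden]
    nlinarith [norm_nonneg (φ 0)]
  have hone : 3 * ‖φ 0‖ ≤ 3 * ‖φ 0‖ * (1 + ‖z‖) ^ N :=
    le_mul_of_one_le_right (by positivity) (one_le_pow₀ (by linarith))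
  linarith

theorem exists_eq_exp_quadratic {G : ℂ → ℂ} (hG : Differentiable ℂ G) (h0 : ∀ z, G z ≠ 0) {C b : ℝ}
    (hgrowth : ∀ z, ‖G z‖ ≤ C * Real.exp (b * ‖z‖ ^ 2)) :
    ∃ q : Polynomial ℂ, q.natDegree ≤ 2 ∧ ∀ z, G z = exp (q.eval z) := by
  have hC : 0 < C := by simpa using (norm_pos_iff.2 (h0 0)).trans_le (hgrowth 0)
  obtain ⟨φ, hφ, hGφ⟩ := exists_eq_exp_of_ne_zero hG h0
  have hre (z : ℂ) : (φ z).re ≤ (|Real.log C| + |b| + 1) * (1 + ‖z‖) ^ 2 := by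
    have hlog := hgrowth z
    rw [hGφ, norm_exp, ← Real.exp_log hC, ← Real.exp_add, Real.exp_le_exp] at hlog
    have hz := norm_nonneg z
    nlinarith [le_abs_self (Real.log C), abs_nonneg (Real.log C), abs_nonneg b,
      mul_le_mul_of_nonneg_right (le_abs_self b) (sq_nonneg ‖z‖)]
  obtain ⟨q, hq, hqφ⟩ := exists_polynomial_of_re_le hφ (by positivity) hre
  exact ⟨q, hq, fun z ↦ by rw [hGφ, hqφ]⟩

theorem exists_growth_of_polynomial_mul {P : Polynomial ℂ} (hP : P ≠ 0) {G : ℂ → ℂ}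
    (hG : Continuous G) {C b : ℝ}
    (h : ∀ z, ‖P.eval z * G z‖ ≤ C * Real.exp (b * ‖z‖ ^ 2)) :
    ∃ C', ∀ z, ‖G z‖ ≤ C' * Real.exp (b * ‖z‖ ^ 2) := by
  obtain ⟨c, R, hc, hcR⟩ := exists_le_norm_eval hP
  obtain ⟨D, hD⟩ := (isCompact_closedBall (0 : ℂ) R).exists_bound_of_continuousOn
    (f := fun z ↦ ‖G z‖ / Real.exp (b * ‖z‖ ^ 2))
    (Continuous.continuousOn (by fun_prop (disch := simp)))
  refine ⟨max (C / c) D, fun z ↦ ?_⟩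
  rcases le_total R ‖z‖ with hz | hz
  · calc ‖G z‖ ≤ C / c * Real.exp (b * ‖z‖ ^ 2) := by
          rw [div_mul_eq_mul_div, le_div_iff₀' hc]
          refine le_trans ?_ (h z)
          rw [norm_mul]
          gcongr
          exact hcR z hz
      _ ≤ max (C / c) D * Real.exp (b * ‖z‖ ^ 2) := by
          gcongr
          exact le_max_left _ _
  · have hDz := hD z (by simpa using hz)
    rw [Real.norm_of_nonneg (by positivity), div_le_iff₀ (Real.exp_pos _)] at hDz
    refine hDz.trans ?_
    gcongr
    exact le_max_right _ _

end ZeroFree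

section PolynomialMulGaussian

/-- `F` has the form `P(z) exp(a z²)` with `P` a polynomial of degree at most `N`. -/
def IsPolynomialMulGaussian (N : ℕ) (F : ℂ → ℂ) : Prop :=
  ∃ (P : Polynomial ℂ) (a : ℂ), P.natDegree ≤ N ∧ ∀ z, F z = P.eval z * exp (a * z ^ 2)

theorem isPolynomialMulGaussian_zero (N : ℕ) : IsPolynomialMulGaussian N fun _ ↦ 0 :=
  ⟨0, 0, by simp, by simp⟩

theorem eq_zero_of_mul_rotate_eq_zero {G : ℂ → ℂ} (hG : Differentiable ℂ G)
    (h : ∀ z, G z * G (I * z) = 0) (z : ℂ) : G z = 0 := by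
  have hana {f : ℂ → ℂ} (hf : Differentiable ℂ f) : AnalyticOnNhd ℂ f univ :=
    hf.differentiableOn.analyticOnNhd isOpen_univ
  rcases (hana hG).eq_zero_or_eq_zero_of_mul_eq_zero
    (hana (hG.comp (g := G) (f := fun z ↦ I * z) (by fun_prop)))
    (fun z _ ↦ h z) isPreconnected_univ with h0 | h0
  · exact h0 z (mem_univ z)
  · simpa [← mul_assoc] using h0 (-I * z) (mem_univ _)

/-- The exponent of the zero-free factor of `G` has no linear term `q₁ z`, since
`exp (q₁ (1 + i) z)` is a ratio of polynomials. -/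
theorem isPolynomialMulGaussian_of_mul_rotate {G : ℂ → ℂ} (hG : Differentiable ℂ G) {C b : ℝ}
    (hgrowth : ∀ z, ‖G z‖ ≤ C * Real.exp (b * ‖z‖ ^ 2)) {p : Polynomial ℂ} (hp0 : p ≠ 0)
    (hp : ∀ z, G z * G (I * z) = p.eval z) : IsPolynomialMulGaussian p.natDegree G := by
  obtain ⟨P, G₁, hP, hPdeg, hG₁, hne, hfac⟩ :=
    exists_polynomial_mul_ne_zero hG (hG.continuous.comp (continuous_const_mul I)) hp0 hp
  obtain ⟨C₁, hgrowth₁⟩ := exists_growth_of_polynomial_mul hP hG₁.continuous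
    fun z ↦ (congrArg norm (hfac z)).symm.trans_le (hgrowth z)
  obtain ⟨q, hq, hqexp⟩ := exists_eq_exp_quadratic hG₁ hne hgrowth₁
  have hqz (z : ℂ) : q.eval z = q.coeff 0 + q.coeff 1 * z + q.coeff 2 * z ^ 2 := by
    rw [Polynomial.eval_eq_sum_range' (show q.natDegree < 3 by lia)]
    simp [Finset.sum_range_succ]
  have hprod (z : ℂ) : p.eval z =
      (P * P.comp (Polynomial.C I * Polynomial.X) * Polynomial.C (exp (2 * q.coeff 0))).eval z *
        exp (q.coeff 1 * (1 + I) * z) := by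
    rw [← hp z, hfac, hfac, hqexp, hqexp, hqz, hqz, mul_mul_mul_comm, ← exp_add]
    simp only [Polynomial.eval_mul, Polynomial.eval_comp, Polynomial.eval_C, Polynomial.eval_X]
    rw [mul_assoc _ (exp _), ← exp_add, mul_pow, I_sq]
    ring_nf
  have hPI : P.comp (Polynomial.C I * Polynomial.X) ≠ 0 :=
    (Polynomial.comp_C_mul_X_eq_zero_iff (mem_nonZeroDivisors_of_ne_zero I_ne_zero)).not.2 hP
  have hlin : q.coeff 1 * (1 + I) = 0 := eq_zero_of_polynomial_eq_mul_exp
    (mul_ne_zero (mul_ne_zero hP hPI) (Polynomial.C_ne_zero.2 (exp_ne_zero _))) hprod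
  have hlin' : q.coeff 1 = 0 :=
    (mul_eq_zero.1 hlin).resolve_right fun h ↦ by simpa using congrArg re h
  refine ⟨P * Polynomial.C (exp (q.coeff 0)), q.coeff 2,
    (Polynomial.natDegree_mul_C_le _ _).trans hPdeg, fun z ↦ ?_⟩
  rw [hfac, hqexp, hqz, hlin', zero_mul, add_zero, exp_add, Polynomial.eval_mul, Polynomial.eval_C,
    mul_assoc]

theorem BeurlingGrowth.isPolynomialMulGaussian {G : ℂ → ℂ} {m : ℝ → ℝ} {C b M : ℝ} {N : ℕ}
    (hm : Monotone m) (hgrowth : ∀ r, 0 ≤ r → m r ≤ C * Real.exp (b * r ^ 2))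
    (hG : BeurlingGrowth m M N G) (hGneg : BeurlingGrowth m M N fun z ↦ G (-z)) :
    IsPolynomialMulGaussian N G := by
  obtain ⟨p, hpN, hp⟩ := exists_polynomial_mul_rotate hm hgrowth hG hGneg
  rcases eq_or_ne p 0 with rfl | hp0
  · have hG0 := eq_zero_of_mul_rotate_eq_zero hG.differentiable (by simpa using hp)
    exact (funext hG0 : G = fun _ ↦ 0) ▸ isPolynomialMulGaussian_zero N
  · obtain ⟨P, a, hP, hPa⟩ := isPolynomialMulGaussian_of_mul_rotate hG.differentiable
      (fun z ↦ (hG.norm_le z).trans (hgrowth _ (norm_nonneg z))) hp0 hp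
    exact ⟨P, a, hP.trans hpN, hPa⟩

end PolynomialMulGaussian

section PolynomialMulGaussianLimit

variable {N : ℕ}

theorem eval_eq_sum_lagrange {v : ℕ → ℂ} (hv : Function.Injective v) {P : Polynomial ℂ}
    (hP : P.natDegree ≤ N) (z : ℂ) :
    P.eval z = ∑ j ∈ Finset.range (N + 1),
      P.eval (v j) * (Lagrange.basis (Finset.range (N + 1)) v j).eval z := by
  have hdeg : P.degree < (Finset.range (N + 1)).card := by
    rw [Finset.card_range]
    exact (Polynomial.degree_le_of_natDegree_le hP).trans_lt (by exact_mod_cast N.lt_succ_self)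
  conv_lhs => rw [Lagrange.eq_interpolate hv.injOn hdeg, Lagrange.interpolate_apply,
    Polynomial.eval_finsetSum]
  simp only [Polynomial.eval_mul, Polynomial.eval_C]

theorem exists_norm_eval_le_of_nodes (N : ℕ) {v : ℕ → ℂ} (hv : Function.Injective v) (r : ℝ) :
    ∃ L : ℝ, 0 ≤ L ∧ ∀ (P : Polynomial ℂ) (B : ℝ), P.natDegree ≤ N →
      (∀ j ∈ Finset.range (N + 1), ‖P.eval (v j)‖ ≤ B) → ∀ z, ‖z‖ ≤ r → ‖P.eval z‖ ≤ L * B := by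
  have hbasis (j : ℕ) : ∃ L : ℝ, ∀ z ∈ closedBall (0 : ℂ) r,
      ‖(Lagrange.basis (Finset.range (N + 1)) v j).eval z‖ ≤ L :=
    (isCompact_closedBall _ _).exists_bound_of_continuousOn (Polynomial.continuous _).continuousOn
  choose L hL using hbasis
  refine ⟨∑ j ∈ Finset.range (N + 1), |L j|, by positivity, fun P B hP hB z hz ↦ ?_⟩
  rw [eval_eq_sum_lagrange hv hP, Finset.sum_mul]
  refine norm_sum_le_of_le _ fun j hj ↦ ?_
  rw [norm_mul, mul_comm]
  exact mul_le_mul ((hL j z (by simpa using hz)).trans (le_abs_self _)) (hB j hj) (norm_nonneg _)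
    (abs_nonneg _)

theorem exists_polynomial_of_tendsto {P : ℕ → Polynomial ℂ} (hP : ∀ k, (P k).natDegree ≤ N)
    {Q : ℂ → ℂ} (hlim : ∀ z, Tendsto (fun k ↦ (P k).eval z) atTop (𝓝 (Q z))) :
    ∃ p : Polynomial ℂ, p.natDegree ≤ N ∧ ∀ z, Q z = p.eval z := by
  have hv : Function.Injective (fun j : ℕ ↦ (j : ℂ)) := Nat.cast_injective
  refine ⟨∑ j ∈ Finset.range (N + 1),
    Polynomial.C (Q j) * Lagrange.basis (Finset.range (N + 1)) (fun j : ℕ ↦ (j : ℂ)) j,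
    Polynomial.natDegree_sum_le_of_forall_le _ _ fun j hj ↦ ?_, fun z ↦ ?_⟩
  · refine (Polynomial.natDegree_C_mul_le _ _).trans ?_
    rw [Polynomial.natDegree_eq_of_degree_eq_some
      (Lagrange.degree_basis (hv.injOn (s := Finset.range (N + 1))) hj), Finset.card_range]
    exact le_rfl
  · refine tendsto_nhds_unique (hlim z) ?_
    simp only [eval_eq_sum_lagrange hv (hP _) z, Polynomial.eval_finsetSum, Polynomial.eval_mul,
      Polynomial.eval_C]
    exact tendsto_finsetSum _ fun j _ ↦ (hlim j).mul_const _

theorem exists_norm_eq_one_mul_sq_eq_norm (a : ℂ) : ∃ u : ℂ, ‖u‖ = 1 ∧ a * u ^ 2 = ‖a‖ := by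
  refine ⟨exp ((-(arg a) / 2 : ℝ) * I), norm_exp_ofReal_mul_I _, ?_⟩
  nth_rewrite 1 [← norm_mul_exp_arg_mul_I a]
  rw [← exp_nat_mul, mul_assoc, ← exp_add]
  have hcancel : arg a * I + ((2 : ℕ) : ℂ) * ((-(arg a) / 2 : ℝ) * I) = 0 := by
    push_cast
    ring
  rw [hcancel, exp_zero, mul_one]

theorem norm_eval_le_exp_neg_of_mul_gaussian {P : Polynomial ℂ} {a u : ℂ} {C : ℝ}
    (hbound : ∀ z, ‖z‖ ≤ 2 → ‖P.eval z * exp (a * z ^ 2)‖ ≤ C) (hu : ‖u‖ = 1)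
    (hau : a * u ^ 2 = ‖a‖) {x : ℝ} (hx : x ∈ Icc (1 : ℝ) 2) :
    ‖P.eval (u * x)‖ ≤ C * Real.exp (-‖a‖) := by
  have hux := hbound (u * x) (by
    rw [norm_mul, hu, one_mul, norm_real, Real.norm_of_nonneg (by linarith [hx.1])]
    exact hx.2)
  rw [norm_mul, mul_pow, ← mul_assoc a, hau, ← ofReal_pow, ← ofReal_mul, norm_exp_ofReal] at hux
  rw [Real.exp_neg, ← div_eq_mul_inv, le_div_iff₀ (Real.exp_pos _)]
  refine le_trans ?_ hux
  gcongr
  exact le_mul_of_one_le_right (norm_nonneg a) (one_le_pow₀ hx.1)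

/-- On the line where `a z² ≥ 0` the bound makes `P` of size `e^{-|a|}` at nodes in `[1, 2]`, and
interpolation transports this to the small disc, where the Gaussian is at most `e^{|a| / 4}`. -/
theorem exists_norm_polynomial_mul_gaussian_le (N : ℕ) (C : ℝ) :
    ∃ K : ℝ, ∀ (P : Polynomial ℂ) (a : ℂ), P.natDegree ≤ N →
      (∀ z, ‖z‖ ≤ 2 → ‖P.eval z * exp (a * z ^ 2)‖ ≤ C) →
      ∀ z, ‖z‖ ≤ 1 / 2 → ‖P.eval z * exp (a * z ^ 2)‖ ≤ K * Real.exp (-(‖a‖ / 2)) := by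
  set x : ℕ → ℝ := fun j ↦ 1 + j / (N + 1) with hx
  have hxmem : ∀ j ∈ Finset.range (N + 1), x j ∈ Icc (1 : ℝ) 2 := fun j hj ↦ by
    have hj' : (j : ℝ) / (N + 1) ≤ 1 := by
      rw [div_le_one (by positivity)]
      exact_mod_cast (Finset.mem_range.1 hj).le
    exact ⟨le_add_of_nonneg_right (by positivity), by simp only [hx]; linarith⟩
  have hinj : Function.Injective fun j ↦ (x j : ℂ) := fun i j h ↦ by
    simpa [hx, div_left_inj' (Nat.cast_add_one_ne_zero (R := ℝ) N)] using ofReal_injective h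
  obtain ⟨L, hL0, hL⟩ := exists_norm_eval_le_of_nodes N hinj (1 / 2)
  refine ⟨L * C, fun P a hP hbound z hz ↦ ?_⟩
  have hC : 0 ≤ C := (norm_nonneg _).trans (hbound 0 (by simp))
  obtain ⟨u, hu, hau⟩ := exists_norm_eq_one_mul_sq_eq_norm a
  have hu0 : u ≠ 0 := norm_ne_zero_iff.1 (hu ▸ one_ne_zero)
  set p := P.comp (Polynomial.C u * Polynomial.X) with hp
  have hpeval (s : ℂ) : p.eval s = P.eval (u * s) := by simp [hp]
  have hpdeg : p.natDegree ≤ N := by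
    rwa [hp, Polynomial.natDegree_comp, Polynomial.natDegree_C_mul_X u hu0, mul_one]
  have hPz : ‖P.eval z‖ ≤ L * (C * Real.exp (-‖a‖)) := by
    have hz' := hL p _ hpdeg
      (fun j hj ↦ hpeval _ ▸ norm_eval_le_exp_neg_of_mul_gaussian hbound hu hau (hxmem j hj))
      (u⁻¹ * z) (by rwa [norm_mul, norm_inv, hu, inv_one, one_mul])
    rwa [hpeval, mul_inv_cancel_left₀ hu0] at hz'
  have hexp : ‖exp (a * z ^ 2)‖ ≤ Real.exp (‖a‖ / 4) := by
    refine (norm_exp_le_exp_norm _).trans (Real.exp_le_exp.2 ?_)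
    have hz2 : ‖z‖ ^ 2 ≤ (1 / 2) ^ 2 := by gcongr
    rw [norm_mul, norm_pow]
    nlinarith [norm_nonneg a]
  calc ‖P.eval z * exp (a * z ^ 2)‖ ≤ L * (C * Real.exp (-‖a‖)) * Real.exp (‖a‖ / 4) := by
        rw [norm_mul]
        gcongr
    _ = L * C * Real.exp (-‖a‖ + ‖a‖ / 4) := by rw [Real.exp_add]; ring
    _ ≤ L * C * Real.exp (-(‖a‖ / 2)) := by
        gcongr
        linarith [norm_nonneg a]

variable {F : ℂ → ℂ} {P : ℕ → Polynomial ℂ} {a : ℕ → ℂ}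

theorem isPolynomialMulGaussian_of_tendsto_of_frequently_bounded
    (hP : ∀ k, (P k).natDegree ≤ N) {B : ℝ} (ha : ∃ᶠ k in atTop, a k ∈ closedBall (0 : ℂ) B)
    (hlim : ∀ z, Tendsto (fun k ↦ (P k).eval z * exp (a k * z ^ 2)) atTop (𝓝 (F z))) :
    IsPolynomialMulGaussian N F := by
  obtain ⟨b, -, σ, hσ, hb⟩ := tendsto_subseq_of_frequently_bounded isBounded_closedBall ha
  have hPQ (z : ℂ) : Tendsto (fun k ↦ (P (σ k)).eval z) atTop (𝓝 (F z * exp (-(b * z ^ 2)))) := by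
    have hexp : Tendsto (fun k ↦ exp (-(a (σ k) * z ^ 2))) atTop (𝓝 (exp (-(b * z ^ 2)))) :=
      (continuous_exp.tendsto _).comp ((hb.mul_const (z ^ 2)).neg)
    refine (((hlim z).comp hσ.tendsto_atTop).mul hexp).congr fun k ↦ ?_
    rw [Function.comp_apply, mul_assoc, ← exp_add, add_neg_cancel, exp_zero, mul_one]
  obtain ⟨p, hpN, hp⟩ := exists_polynomial_of_tendsto (fun k ↦ hP (σ k)) hPQ
  refine ⟨p, b, hpN, fun z ↦ ?_⟩
  rw [← hp, mul_assoc, ← exp_add, neg_add_cancel, exp_zero, mul_one]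

theorem eq_zero_of_tendsto_polynomial_mul_gaussian (hF : Differentiable ℂ F)
    (hP : ∀ k, (P k).natDegree ≤ N) (ha : Tendsto (fun k ↦ ‖a k‖) atTop atTop) {C : ℝ}
    (hbound : ∀ k z, ‖z‖ ≤ 2 → ‖(P k).eval z * exp (a k * z ^ 2)‖ ≤ C)
    (hlim : ∀ z, Tendsto (fun k ↦ (P k).eval z * exp (a k * z ^ 2)) atTop (𝓝 (F z))) :
    F = 0 := by
  obtain ⟨K, hK⟩ := exists_norm_polynomial_mul_gaussian_le N C
  have hdecay : Tendsto (fun k ↦ K * Real.exp (-(‖a k‖ / 2))) atTop (𝓝 0) := by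
    simpa using (Real.tendsto_exp_neg_atTop_nhds_zero.comp
      (ha.atTop_div_const two_pos)).const_mul K
  have hdisc (z : ℂ) (hz : ‖z‖ ≤ 1 / 2) : F z = 0 := tendsto_nhds_unique (hlim z)
    (squeeze_zero_norm (fun k ↦ hK _ _ (hP k) (hbound k) z hz) hdecay)
  refine AnalyticOnNhd.eq_of_eventuallyEq (z₀ := 0)
    (fun z _ ↦ hF.analyticAt z) (fun z _ ↦ analyticAt_const) ?_
  filter_upwards [closedBall_mem_nhds (0 : ℂ) one_half_pos] with z hz
  exact hdisc z (mem_closedBall_zero_iff.1 hz)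

theorem isPolynomialMulGaussian_of_tendsto (hF : Differentiable ℂ F) {Fk : ℕ → ℂ → ℂ}
    (hFk : ∀ k, IsPolynomialMulGaussian N (Fk k)) {C : ℝ}
    (hbound : ∀ k z, ‖z‖ ≤ 2 → ‖Fk k z‖ ≤ C)
    (hlim : ∀ z, Tendsto (fun k ↦ Fk k z) atTop (𝓝 (F z))) : IsPolynomialMulGaussian N F := by
  choose P a hP hPa using hFk
  simp only [hPa] at hbound hlim
  by_cases hfreq : ∃ B : ℝ, ∃ᶠ k in atTop, a k ∈ closedBall (0 : ℂ) B
  · obtain ⟨B, hB⟩ := hfreq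
    exact isPolynomialMulGaussian_of_tendsto_of_frequently_bounded hP hB hlim
  · push Not at hfreq
    have ha : Tendsto (fun k ↦ ‖a k‖) atTop atTop := tendsto_atTop.2 fun B ↦
      (hfreq B).mono fun k hk ↦ by
        rw [mem_closedBall_zero_iff, not_le] at hk
        exact hk.le
    rw [eq_zero_of_tendsto_polynomial_mul_gaussian hF hP ha hbound hlim]
    exact isPolynomialMulGaussian_zero N

end PolynomialMulGaussianLimit

/-! ### Transforms of functions with exponential moments -/

section ExpMoment

variable {X : Type*} [MeasurableSpace X] {μ : Measure X} {f : X → ℂ} {t : X → ℝ}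

/-- The function `f` has exponential moments of all orders with respect to the phase `t`: this is
what makes `∫ f e^{-i z t} dμ` an entire function of `z`. -/
structure HasExpMoments (μ : Measure X) (f : X → ℂ) (t : X → ℝ) : Prop where
  measurable : Measurable f
  measurable_phase : Measurable t
  integrable_mul_exp : ∀ c : ℝ, Integrable (fun x ↦ ‖f x‖ * Real.exp (c * |t x|)) μ

/-- The exponential moment of order `s` of `|f| μ` with respect to the phase `t`. -/
noncomputable def expMoment (μ : Measure X) (f : X → ℂ) (t : X → ℝ) (s : ℝ) : ℝ :=
  ∫ x, ‖f x‖ * Real.exp (s * |t x|) ∂μ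

theorem expMoment_nonneg (s : ℝ) : 0 ≤ expMoment μ f t s := by
  rw [expMoment]
  positivity

theorem expMoment_zero : expMoment μ f t 0 = ∫ x, ‖f x‖ ∂μ := by
  simp only [expMoment, zero_mul, Real.exp_zero, mul_one]

namespace HasExpMoments

theorem integrable (h : HasExpMoments μ f t) : Integrable f μ := by
  have h0 := h.integrable_mul_exp 0
  simp only [zero_mul, Real.exp_zero, mul_one] at h0
  exact (integrable_norm_iff h.measurable.aestronglyMeasurable).1 h0

theorem of_le {C : ℝ} {g : X → ℂ} {s : X → ℝ} (h : HasExpMoments μ f t) (hg : Measurable g)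
    (hs : Measurable s) (hgf : ∀ x, ‖g x‖ ≤ ‖f x‖) (hst : ∀ x, |s x| ≤ C * |t x|) :
    HasExpMoments μ g s := by
  refine ⟨hg, hs, fun c ↦ (h.integrable_mul_exp (|c| * C)).mono'
    (Measurable.aestronglyMeasurable (by fun_prop)) (Eventually.of_forall fun x ↦ ?_)⟩
  rw [Real.norm_of_nonneg (by positivity)]
  have hcs : c * |s x| ≤ |c| * C * |t x| := by
    rw [mul_assoc]
    exact mul_le_mul (le_abs_self c) (hst x) (abs_nonneg _) (abs_nonneg c)
  gcongr
  exact hgf x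

theorem expMoment_le_expMoment {g : X → ℂ} {r s : ℝ} (hg : HasExpMoments μ g t)
    (hf : HasExpMoments μ f t) (hgf : ∀ x, ‖g x‖ ≤ ‖f x‖) (hrs : r ≤ s) :
    expMoment μ g t r ≤ expMoment μ f t s := by
  refine integral_mono (hg.integrable_mul_exp r) (hf.integrable_mul_exp s) fun x ↦ ?_
  dsimp only
  gcongr
  exact hgf x

theorem monotone_expMoment (h : HasExpMoments μ f t) : Monotone (expMoment μ f t) :=
  fun _ _ hrs ↦ h.expMoment_le_expMoment h (fun _ ↦ le_rfl) hrs

theorem ofReal_expMoment (h : HasExpMoments μ f t) (s : ℝ) :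
    ENNReal.ofReal (expMoment μ f t s) =
      ∫⁻ x, ENNReal.ofReal (‖f x‖ * Real.exp (s * |t x|)) ∂μ :=
  ofReal_integral_eq_lintegral_ofReal (h.integrable_mul_exp s)
    (Eventually.of_forall fun _ ↦ by positivity)

end HasExpMoments

end ExpMoment

section Laplace

variable {X : Type*} [MeasurableSpace X] {μ : Measure X} {f : X → ℂ} {t : X → ℝ}

/-- The Fourier–Laplace transform `z ↦ ∫ f(x) e^{-i z t(x)} dμ(x)` of `f μ` with phase `t`. -/
noncomputable def laplace (μ : Measure X) (f : X → ℂ) (t : X → ℝ) (z : ℂ) : ℂ :=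
  ∫ x, f x * exp (-(I * z * t x)) ∂μ

theorem norm_exp_neg_I_mul (z : ℂ) (s : ℝ) : ‖exp (-(I * z * s))‖ = Real.exp (z.im * s) := by
  rw [norm_exp]
  congr 1
  simp

theorem norm_exp_neg_I_mul_le (z : ℂ) (s : ℝ) :
    ‖exp (-(I * z * s))‖ ≤ Real.exp (|z.im| * |s|) := by
  rw [norm_exp_neg_I_mul, ← abs_mul]
  exact Real.exp_le_exp.2 (le_abs_self _)

theorem aestronglyMeasurable_mul_exp (hf : AEStronglyMeasurable f μ) (ht : Measurable t) (z : ℂ) :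
    AEStronglyMeasurable (fun x ↦ f x * exp (-(I * z * t x))) μ :=
  hf.mul (Measurable.aestronglyMeasurable (by fun_prop))

theorem norm_laplace_le (h : HasExpMoments μ f t) (z : ℂ) :
    ‖laplace μ f t z‖ ≤ expMoment μ f t |z.im| := by
  refine norm_integral_le_of_norm_le (h.integrable_mul_exp _) (Eventually.of_forall fun x ↦ ?_)
  rw [norm_mul]
  gcongr
  exact norm_exp_neg_I_mul_le _ _

theorem hasDerivAt_mul_exp_neg_I_mul (w : ℂ) (s : ℝ) (z : ℂ) :
    HasDerivAt (fun z ↦ w * exp (-(I * z * s))) (w * (exp (-(I * z * s)) * -(I * s))) z := by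
  have hphase : HasDerivAt (fun z : ℂ ↦ -(I * z * s)) (-(I * s)) z := by
    simpa only [mul_one] using (((hasDerivAt_id' z).const_mul I).mul_const (s : ℂ)).fun_neg
  exact hphase.cexp.const_mul w

theorem abs_im_lt_of_mem_ball {z z₀ : ℂ} {η : ℝ} (hz : z ∈ ball z₀ η) :
    |z.im| < |z₀.im| + η := by
  have hdist : ‖z - z₀‖ < η := mem_ball_iff_norm.1 hz
  have him := abs_im_le_norm (z - z₀)
  rw [sub_im] at him
  linarith [abs_sub_abs_le_abs_sub z.im z₀.im]

theorem norm_deriv_mul_exp_le {w z : ℂ} {s η κ : ℝ} (hη : 0 < η) (hz : |z.im| ≤ κ) :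
    ‖w * (exp (-(I * z * s)) * -(I * s))‖ ≤ η⁻¹ * (‖w‖ * Real.exp ((κ + η) * |s|)) := by
  have hs : |s| ≤ η⁻¹ * Real.exp (η * |s|) := by
    rw [inv_mul_eq_div, le_div_iff₀ hη]
    linarith [Real.add_one_le_exp (η * |s|)]
  calc ‖w * (exp (-(I * z * s)) * -(I * s))‖ = ‖w‖ * (‖exp (-(I * z * s))‖ * |s|) := by
        rw [norm_mul, norm_mul, norm_neg, norm_mul, norm_I, one_mul, norm_real, Real.norm_eq_abs]
    _ ≤ ‖w‖ * (Real.exp (κ * |s|) * (η⁻¹ * Real.exp (η * |s|))) := by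
        have hexp := (norm_exp_neg_I_mul_le z s).trans
          (Real.exp_le_exp.2 (mul_le_mul_of_nonneg_right hz (abs_nonneg s)))
        gcongr
    _ = η⁻¹ * (‖w‖ * Real.exp ((κ + η) * |s|)) := by
        rw [add_mul, Real.exp_add]
        ring

theorem differentiableAt_laplace (hf : AEStronglyMeasurable f μ) (ht : Measurable t) {c : ℝ}
    (hexp : Integrable (fun x ↦ ‖f x‖ * Real.exp (c * |t x|)) μ) {z₀ : ℂ} (hz₀ : |z₀.im| < c) :
    DifferentiableAt ℂ (laplace μ f t) z₀ := by
  obtain ⟨η, hη, rfl⟩ : ∃ η > 0, |z₀.im| + η + η = c :=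
    ⟨(c - |z₀.im|) / 2, by linarith, by ring⟩
  refine (hasDerivAt_integral_of_dominated_loc_of_deriv_le (μ := μ)
    (F := fun z x ↦ f x * exp (-(I * z * t x)))
    (F' := fun z x ↦ f x * (exp (-(I * z * t x)) * -(I * t x)))
    (bound := fun x ↦ η⁻¹ * (‖f x‖ * Real.exp ((|z₀.im| + η + η) * |t x|)))
    (ball_mem_nhds z₀ hη) (Eventually.of_forall (aestronglyMeasurable_mul_exp hf ht)) ?_
    (hf.mul (Measurable.aestronglyMeasurable (by fun_prop)))
    (Eventually.of_forall fun x z hz ↦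
      norm_deriv_mul_exp_le hη (abs_im_lt_of_mem_ball hz).le)
    (hexp.const_mul _)
    (Eventually.of_forall fun x z _ ↦
      hasDerivAt_mul_exp_neg_I_mul (f x) (t x) z)).2.differentiableAt
  refine hexp.mono' (aestronglyMeasurable_mul_exp hf ht z₀) (Eventually.of_forall fun x ↦ ?_)
  rw [norm_mul]
  gcongr
  refine (norm_exp_neg_I_mul_le _ _).trans (Real.exp_le_exp.2 ?_)
  gcongr

theorem differentiable_laplace (h : HasExpMoments μ f t) : Differentiable ℂ (laplace μ f t) :=
  fun z ↦ differentiableAt_laplace h.measurable.aestronglyMeasurable h.measurable_phase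
    (h.integrable_mul_exp (|z.im| + 1)) (lt_add_one _)

end Laplace

section Damp

variable {X : Type*} {f : X → ℂ} {t : X → ℝ} {ε b : ℝ}

/-- The regularization of `f` by the Gaussian `e^{-ε t²}` of the phase. -/
noncomputable def damp (ε : ℝ) (f : X → ℂ) (t : X → ℝ) (x : X) : ℂ :=
  f x * (Real.exp (-(ε * t x ^ 2)) : ℂ)

theorem norm_damp (ε : ℝ) (x : X) : ‖damp ε f t x‖ = ‖f x‖ * Real.exp (-(ε * t x ^ 2)) := by
  rw [damp, norm_mul, norm_real, Real.norm_of_nonneg (Real.exp_pos _).le]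

theorem norm_damp_le (hε : 0 ≤ ε) (x : X) : ‖damp ε f t x‖ ≤ ‖f x‖ := by
  rw [norm_damp]
  refine mul_le_of_le_one_right (norm_nonneg _) (Real.exp_le_one_iff.2 ?_)
  exact neg_nonpos.2 (mul_nonneg hε (sq_nonneg _))

theorem tendsto_damp {ε : ℕ → ℝ} (hlim : Tendsto ε atTop (𝓝 0)) (x : X) :
    Tendsto (fun k ↦ damp (ε k) f t x) atTop (𝓝 (f x)) := by
  have hcont : Continuous fun ε : ℝ ↦ damp ε f t x := by
    unfold damp
    fun_prop
  simpa [Function.comp_def, damp] using (hcont.tendsto 0).comp hlim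

variable [MeasurableSpace X] {μ : Measure X}

theorem HasExpMoments.damp (h : HasExpMoments μ f t) (hε : 0 ≤ ε) :
    HasExpMoments μ (damp ε f t) t := by
  have hf := h.measurable
  have ht := h.measurable_phase
  refine h.of_le (C := 1) ?_ ht (norm_damp_le hε) fun x ↦ by rw [one_mul]
  unfold Beurling.damp
  fun_prop

theorem tendsto_laplace_damp (h : HasExpMoments μ f t) {ε : ℕ → ℝ} (hε : ∀ k, 0 ≤ ε k)
    (hlim : Tendsto ε atTop (𝓝 0)) (z : ℂ) :
    Tendsto (fun k ↦ laplace μ (damp (ε k) f t) t z) atTop (𝓝 (laplace μ f t z)) := by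
  refine tendsto_integral_of_dominated_convergence _
    (fun k ↦ aestronglyMeasurable_mul_exp
      (h.damp (hε k)).measurable.aestronglyMeasurable h.measurable_phase z)
    (h.integrable_mul_exp |z.im|) (fun k ↦ Eventually.of_forall fun x ↦ ?_)
    (Eventually.of_forall fun x ↦ (tendsto_damp hlim x).mul_const _)
  rw [norm_mul]
  gcongr
  · exact norm_damp_le (hε k) x
  · exact norm_exp_neg_I_mul_le _ _

theorem integral_exp_mul_gaussian (hb : 0 < b) (hεb : 4 * ε * b = 1) (s : ℝ) :
    ∫ u : ℝ, exp (I * s * u) * exp (-b * u ^ 2) =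
      (π / b : ℂ) ^ (1 / 2 : ℂ) * (Real.exp (-(ε * s ^ 2)) : ℂ) := by
  have hε : (ε : ℂ) = 1 / (4 * b) := by
    have hb' : (b : ℂ) ≠ 0 := ofReal_ne_zero.2 hb.ne'
    have hεb' : (4 * ε * b : ℂ) = 1 := by exact_mod_cast hεb
    field_simp
    linear_combination hεb'
  rw [fourierIntegral_gaussian (b := (b : ℂ)) (by simpa) (s : ℂ)]
  push_cast
  rw [hε]
  ring_nf

theorem exp_sub_mul_eq (r u s : ℝ) :
    exp (-(I * ((r - u : ℝ) : ℂ) * s)) = exp (-(I * r * s)) * exp (I * s * u) := by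
  rw [← exp_add]
  congr 1
  push_cast
  ring

theorem integrable_gaussian_mul_exp_prod [SFinite μ] (hf : Integrable f μ) (ht : Measurable t)
    (hb : 0 < b) (r : ℝ) :
    Integrable (Function.uncurry fun (x : X) (u : ℝ) ↦
      exp (-b * u ^ 2) * (f x * exp (-(I * ((r - u : ℝ) : ℂ) * t x)))) (μ.prod volume) := by
  have hgauss : Integrable fun u : ℝ ↦ exp (-b * u ^ 2) := integrable_cexp_neg_mul_sq (by simpa)
  refine (hf.norm.mul_prod hgauss.norm).mono' ?_ (Eventually.of_forall fun p ↦ ?_)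
  · exact AEStronglyMeasurable.mul (Measurable.aestronglyMeasurable (by fun_prop))
      (hf.aestronglyMeasurable.comp_fst.mul (Measurable.aestronglyMeasurable (by fun_prop)))
  · simp only [Function.uncurry]
    rw [norm_mul, norm_mul, norm_exp_neg_I_mul, ofReal_im, zero_mul, Real.exp_zero, mul_one,
      mul_comm]

theorem laplace_damp_eq [SFinite μ] (hf : Integrable f μ) (ht : Measurable t) (hb : 0 < b)
    (hεb : 4 * ε * b = 1) (r : ℝ) :
    laplace μ (damp ε f t) t r = ((π / b : ℂ) ^ (1 / 2 : ℂ))⁻¹ *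
      ∫ u : ℝ, exp (-b * u ^ 2) * laplace μ f t ((r - u : ℝ) : ℂ) := by
  have hconst : (π / b : ℂ) ^ (1 / 2 : ℂ) ≠ 0 := by
    simp [cpow_eq_zero_iff, Real.pi_ne_zero, hb.ne']
  rw [eq_inv_mul_iff_mul_eq₀ hconst, laplace, ← integral_const_mul]
  calc ∫ x, (π / b : ℂ) ^ (1 / 2 : ℂ) * (damp ε f t x * exp (-(I * r * t x))) ∂μ
      = ∫ x, (∫ u : ℝ, exp (-b * u ^ 2) *
          (f x * exp (-(I * ((r - u : ℝ) : ℂ) * t x)))) ∂μ := by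
        refine integral_congr_ae (Eventually.of_forall fun x ↦ ?_)
        have hfactor : ∀ u : ℝ, exp (-b * u ^ 2) * (f x * exp (-(I * ((r - u : ℝ) : ℂ) * t x))) =
            f x * exp (-(I * r * t x)) * (exp (I * t x * u) * exp (-b * u ^ 2)) := fun u ↦ by
          rw [exp_sub_mul_eq]
          ring
        simp_rw [hfactor]
        rw [integral_const_mul, integral_exp_mul_gaussian hb hεb, damp]
        ring
    _ = ∫ u : ℝ, exp (-b * u ^ 2) * laplace μ f t ((r - u : ℝ) : ℂ) := by
        rw [integral_integral_swap (integrable_gaussian_mul_exp_prod hf ht hb r)]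
        simp_rw [integral_const_mul, laplace]

theorem enorm_laplace_damp_le [SFinite μ] (hf : Integrable f μ) (ht : Measurable t) (hb : 0 < b)
    (hεb : 4 * ε * b = 1) (r : ℝ) :
    ‖laplace μ (damp ε f t) t r‖ₑ ≤ ‖((π / b : ℂ) ^ (1 / 2 : ℂ))⁻¹‖ₑ *
      ∫⁻ u : ℝ, ENNReal.ofReal (Real.exp (-b * u ^ 2)) *
        ‖laplace μ f t ((r - u : ℝ) : ℂ)‖ₑ := by
  rw [laplace_damp_eq hf ht hb hεb, enorm_mul]
  gcongr
  refine (enorm_integral_le_lintegral_enorm _).trans_eq (lintegral_congr fun u ↦ ?_)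
  rw [enorm_mul, ← ofReal_norm, norm_exp, ← ofReal_pow, ← ofReal_neg, ← ofReal_mul, ofReal_re]

end Damp

section Weight

variable {D E : ℕ} {s r ε b : ℝ}

/-- The weight `e^{|s||r|} (1 + |s|)^{-D} (1 + |r|)^{-E}` of the one-dimensional uncertainty
condition. -/
noncomputable def weight (D E : ℕ) (s r : ℝ) : ℝ :=
  Real.exp (|s| * |r|) / ((1 + |s|) ^ D * (1 + |r|) ^ E)

theorem weight_nonneg (D E : ℕ) (s r : ℝ) : 0 ≤ weight D E s r := by
  rw [weight]
  positivity

theorem weight_neg_right (D E : ℕ) (s r : ℝ) : weight D E s (-r) = weight D E s r := by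
  rw [weight, weight, abs_neg]

theorem measurable_weight (D E : ℕ) : Measurable fun p : ℝ × ℝ ↦ weight D E p.1 p.2 := by
  simp only [weight, abs]
  fun_prop

theorem measurable_weight_right (D E : ℕ) (s : ℝ) : Measurable (weight D E s) :=
  (measurable_weight D E).comp measurable_prodMk_left

theorem weight_le_exp {R : ℝ} (hr : |r| ≤ R) : weight D E s r ≤ Real.exp (R * |s|) := by
  rw [weight]
  refine (div_le_self (Real.exp_pos _).le ?_).trans (Real.exp_le_exp.2 ?_)
  · exact one_le_mul_of_one_le_of_one_le (one_le_pow₀ (by linarith [abs_nonneg s]))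
      (one_le_pow₀ (by linarith [abs_nonneg r]))
  · rw [mul_comm]
    gcongr

theorem weight_le_weight {s' : ℝ} (hs : |s| ≤ |s'|) (hr : D ≤ |r|) :
    weight D E s r ≤ weight D E s' r := by
  have hbase : 1 + |s'| ≤ (1 + |s|) * Real.exp (|s'| - |s|) := by
    nlinarith [Real.add_one_le_exp (|s'| - |s|), abs_nonneg s]
  have hpow : (1 + |s'|) ^ D ≤ (1 + |s|) ^ D * Real.exp ((|s'| - |s|) * |r|) := by
    calc (1 + |s'|) ^ D ≤ ((1 + |s|) * Real.exp (|s'| - |s|)) ^ D := by gcongr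
      _ = (1 + |s|) ^ D * Real.exp (D * (|s'| - |s|)) := by rw [mul_pow, ← Real.exp_nat_mul]
      _ ≤ (1 + |s|) ^ D * Real.exp ((|s'| - |s|) * |r|) := by
          rw [mul_comm (D : ℝ)]
          gcongr
  rw [weight, weight, div_le_div_iff₀ (by positivity) (by positivity)]
  calc Real.exp (|s| * |r|) * ((1 + |s'|) ^ D * (1 + |r|) ^ E) ≤ Real.exp (|s| * |r|) *
        ((1 + |s|) ^ D * Real.exp ((|s'| - |s|) * |r|) * (1 + |r|) ^ E) := by gcongr
    _ = Real.exp (|s| * |r| + (|s'| - |s|) * |r|) * ((1 + |s|) ^ D * (1 + |r|) ^ E) := by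
        rw [Real.exp_add]
        ring
    _ = Real.exp (|s'| * |r|) * ((1 + |s|) ^ D * (1 + |r|) ^ E) := by ring_nf

theorem pow_mul_gaussian_le (hb : 0 < b) (D : ℕ) (v : ℝ) :
    (1 + |v|) ^ D * Real.exp (-b * v ^ 2) ≤
      D.factorial * Real.exp (1 + 1 / (2 * b)) * Real.exp (-(b / 2) * v ^ 2) := by
  have hpow : (1 + |v|) ^ D ≤ D.factorial * Real.exp (1 + |v|) := by
    have := Real.pow_div_factorial_le_exp (1 + |v|) (by positivity) D
    rwa [div_le_iff₀ (by positivity), mul_comm] at this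
  have habs : |v| ≤ b / 2 * v ^ 2 + 1 / (2 * b) := by
    have hsq : (b * |v| - 1) ^ 2 / (2 * b) = b / 2 * v ^ 2 - |v| + 1 / (2 * b) := by
      rw [← sq_abs v]
      field_simp
      ring
    linarith [show 0 ≤ (b * |v| - 1) ^ 2 / (2 * b) by positivity]
  calc (1 + |v|) ^ D * Real.exp (-b * v ^ 2)
      ≤ D.factorial * Real.exp (1 + |v|) * Real.exp (-b * v ^ 2) := by gcongr
    _ = D.factorial * Real.exp (1 + |v| + -b * v ^ 2) := by rw [mul_assoc, ← Real.exp_add]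
    _ ≤ D.factorial * Real.exp (1 + 1 / (2 * b) + -(b / 2) * v ^ 2) := by
        gcongr ?_ * Real.exp ?_
        linarith
    _ = D.factorial * Real.exp (1 + 1 / (2 * b)) * Real.exp (-(b / 2) * v ^ 2) := by
        rw [mul_assoc, ← Real.exp_add]

theorem integrable_pow_mul_gaussian (hb : 0 < b) (D : ℕ) :
    Integrable fun v : ℝ ↦ (1 + |v|) ^ D * Real.exp (-b * v ^ 2) := by
  refine ((integrable_exp_neg_mul_sq (half_pos hb)).const_mul
    (D.factorial * Real.exp (1 + 1 / (2 * b)))).mono'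
    (Measurable.aestronglyMeasurable (by simp only [abs]; fun_prop))
    (Eventually.of_forall fun v ↦ ?_)
  rw [Real.norm_of_nonneg (by positivity)]
  exact pow_mul_gaussian_le hb D v

theorem shifted_gaussian_mul_pow_le (hε : 0 ≤ ε) {u v : ℝ} (huv : |u| ≤ |v| + 2 * ε * |s|)
    (hsq : (|u| - 2 * ε * |s|) ^ 2 = v ^ 2) :
    Real.exp (-b * (|u| - 2 * ε * |s|) ^ 2) * (1 + |u|) ^ D / (1 + |s|) ^ D ≤
      (1 + 2 * ε) ^ D * ((1 + |v|) ^ D * Real.exp (-b * v ^ 2)) := by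
  have hbase : 1 + |u| ≤ (1 + 2 * ε) * (1 + |v|) * (1 + |s|) := by
    have hεv : 0 ≤ ε * |v| := by positivity
    have hεvs : 0 ≤ ε * |v| * |s| := by positivity
    have hvs : 0 ≤ |v| * |s| := by positivity
    nlinarith [abs_nonneg v, abs_nonneg s]
  rw [div_le_iff₀ (by positivity), hsq]
  calc Real.exp (-b * v ^ 2) * (1 + |u|) ^ D
      ≤ Real.exp (-b * v ^ 2) * ((1 + 2 * ε) * (1 + |v|) * (1 + |s|)) ^ D := by gcongr
    _ = (1 + 2 * ε) ^ D * ((1 + |v|) ^ D * Real.exp (-b * v ^ 2)) * (1 + |s|) ^ D := by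
        rw [mul_pow, mul_pow]
        ring

theorem shifted_gaussian_mul_pow_le_add (hε : 0 ≤ ε) (u : ℝ) :
    Real.exp (-b * (|u| - 2 * ε * |s|) ^ 2) * (1 + |u|) ^ D / (1 + |s|) ^ D ≤
      (1 + 2 * ε) ^ D *
        ((1 + abs (u - 2 * ε * |s|)) ^ D * Real.exp (-b * (u - 2 * ε * |s|) ^ 2) +
          (1 + abs (u + 2 * ε * |s|)) ^ D * Real.exp (-b * (u + 2 * ε * |s|) ^ 2)) := by
  have hτ : abs (2 * ε * |s|) = 2 * ε * |s| := abs_of_nonneg (by positivity)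
  rcases le_total 0 u with hu | hu
  · refine (shifted_gaussian_mul_pow_le hε (v := u - 2 * ε * |s|) ?_
      (by rw [abs_of_nonneg hu])).trans
      (mul_le_mul_of_nonneg_left (le_add_of_nonneg_right (by positivity)) (by positivity))
    linarith [abs_sub_abs_le_abs_sub u (2 * ε * |s|)]
  · refine (shifted_gaussian_mul_pow_le hε (v := u + 2 * ε * |s|) ?_
      (by rw [abs_of_nonpos hu]; ring)).trans
      (mul_le_mul_of_nonneg_left (le_add_of_nonneg_left (by positivity)) (by positivity))
    have habs := abs_sub_abs_le_abs_sub u (-(2 * ε * |s|))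
    rw [abs_neg, sub_neg_eq_add] at habs
    linarith

theorem exists_lintegral_shifted_gaussian_le (hb : 0 < b) (hε : 0 ≤ ε) (D : ℕ) :
    ∃ C : ℝ≥0∞, C ≠ ⊤ ∧ ∀ s : ℝ, ∫⁻ u : ℝ, ENNReal.ofReal
      (Real.exp (-b * (|u| - 2 * ε * |s|) ^ 2) * (1 + |u|) ^ D / (1 + |s|) ^ D) ≤ C := by
  have hint := integrable_pow_mul_gaussian hb D
  refine ⟨ENNReal.ofReal ((1 + 2 * ε) ^ D * ((∫ v : ℝ, (1 + |v|) ^ D * Real.exp (-b * v ^ 2)) +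
    ∫ v : ℝ, (1 + |v|) ^ D * Real.exp (-b * v ^ 2))), ENNReal.ofReal_ne_top, fun s ↦ ?_⟩
  have hsub := hint.comp_sub_right (2 * ε * |s|)
  have hadd := hint.comp_add_right (2 * ε * |s|)
  have hsum : Integrable fun u ↦ (1 + 2 * ε) ^ D *
      ((1 + abs (u - 2 * ε * |s|)) ^ D * Real.exp (-b * (u - 2 * ε * |s|) ^ 2) +
        (1 + abs (u + 2 * ε * |s|)) ^ D * Real.exp (-b * (u + 2 * ε * |s|) ^ 2)) :=
    (hsub.add hadd).const_mul _
  refine (lintegral_mono fun u ↦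
    ENNReal.ofReal_le_ofReal (shifted_gaussian_mul_pow_le_add hε u)).trans_eq ?_
  rw [← ofReal_integral_eq_lintegral_ofReal hsum
    (Eventually.of_forall fun u ↦ by positivity), integral_const_mul, integral_add hsub hadd,
    integral_sub_right_eq_self (fun v : ℝ ↦ (1 + |v|) ^ D * Real.exp (-b * v ^ 2)),
    integral_add_right_eq_self (fun v : ℝ ↦ (1 + |v|) ^ D * Real.exp (-b * v ^ 2))]

/-- Since `4 ε b = 1`, completing the square gives
`-ε s² - b u² + |s||u| = -b (|u| - 2 ε |s|)²`. -/
theorem gaussian_mul_weight_le (hεb : 4 * ε * b = 1) (D : ℕ) (s r u : ℝ) :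
    Real.exp (-(ε * s ^ 2)) * Real.exp (-b * u ^ 2) * weight (2 * D) D s (r + u) ≤
      Real.exp (-b * (|u| - 2 * ε * |s|) ^ 2) * (1 + |u|) ^ D / (1 + |s|) ^ D *
        weight D D s r := by
  have hmul : |s| * |r + u| ≤ |s| * |r| + |s| * |u| := by
    rw [← mul_add]
    gcongr
    exact abs_add_le r u
  have hbase : 1 + |r| ≤ (1 + |r + u|) * (1 + |u|) := by
    have habs : |r| ≤ |r + u| + |u| := by simpa using abs_sub (r + u) u
    nlinarith [mul_nonneg (abs_nonneg (r + u)) (abs_nonneg u)]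
  have hexp : Real.exp (-(ε * s ^ 2)) * Real.exp (-b * u ^ 2) * Real.exp (|s| * |r + u|) ≤
      Real.exp (-b * (|u| - 2 * ε * |s|) ^ 2) * Real.exp (|s| * |r|) := by
    rw [← Real.exp_add, ← Real.exp_add, ← Real.exp_add, Real.exp_le_exp]
    have hsquare : -b * (|u| - 2 * ε * |s|) ^ 2 = -(ε * s ^ 2) + -b * u ^ 2 + |s| * |u| := by
      rw [← sq_abs u, ← sq_abs s]
      linear_combination (|u| * |s| - ε * |s| ^ 2) * hεb
    linarith
  rw [weight, weight, ← mul_div_assoc, div_mul_div_comm,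
    div_le_div_iff₀ (by positivity) (by positivity)]
  calc Real.exp (-(ε * s ^ 2)) * Real.exp (-b * u ^ 2) * Real.exp (|s| * |r + u|) *
        ((1 + |s|) ^ D * ((1 + |s|) ^ D * (1 + |r|) ^ D))
      ≤ Real.exp (-b * (|u| - 2 * ε * |s|) ^ 2) * Real.exp (|s| * |r|) *
        ((1 + |s|) ^ D * ((1 + |s|) ^ D * ((1 + |r + u|) * (1 + |u|)) ^ D)) := by gcongr
    _ = Real.exp (-b * (|u| - 2 * ε * |s|) ^ 2) * (1 + |u|) ^ D * Real.exp (|s| * |r|) *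
        ((1 + |s|) ^ (2 * D) * (1 + |r + u|) ^ D) := by
        rw [mul_pow]
        ring

theorem lintegral_convolution_mul {g F w : ℝ → ℝ≥0∞} (hg : Measurable g) (hF : Measurable F)
    (hw : Measurable w) :
    ∫⁻ r, (∫⁻ u, g u * F (r - u)) * w r = ∫⁻ r, F r * ∫⁻ u, g u * w (r + u) := by
  calc ∫⁻ r, (∫⁻ u, g u * F (r - u)) * w r = ∫⁻ r, ∫⁻ u, g u * F (r - u) * w r :=
        lintegral_congr fun r ↦ (lintegral_mul_const _ (by fun_prop)).symm
    _ = ∫⁻ u, ∫⁻ r, g u * F (r - u) * w r :=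
        lintegral_lintegral_swap (Measurable.aemeasurable (by fun_prop))
    _ = ∫⁻ u, ∫⁻ r, F r * (g u * w (r + u)) := lintegral_congr fun u ↦ by
        rw [← lintegral_add_right_eq_self _ u]
        simp only [add_sub_cancel_right]
        exact lintegral_congr fun r ↦ by ring
    _ = ∫⁻ r, ∫⁻ u, F r * (g u * w (r + u)) :=
        lintegral_lintegral_swap (Measurable.aemeasurable (by fun_prop))
    _ = ∫⁻ r, F r * ∫⁻ u, g u * w (r + u) :=
        lintegral_congr fun r ↦ lintegral_const_mul _ (by fun_prop)

theorem exists_lintegral_gaussian_convolution_mul_weight_le (hε : 0 ≤ ε) (hb : 0 < b)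
    (hεb : 4 * ε * b = 1) (D : ℕ) :
    ∃ C : ℝ≥0∞, C ≠ ⊤ ∧ ∀ F : ℝ → ℝ≥0∞, Measurable F → ∀ s : ℝ,
      ENNReal.ofReal (Real.exp (-(ε * s ^ 2))) *
        ∫⁻ r, (∫⁻ u, ENNReal.ofReal (Real.exp (-b * u ^ 2)) * F (r - u)) *
          ENNReal.ofReal (weight (2 * D) D s r) ≤
      C * ∫⁻ r, F r * ENNReal.ofReal (weight D D s r) := by
  obtain ⟨C, hC, hCs⟩ := exists_lintegral_shifted_gaussian_le hb hε D
  refine ⟨C, hC, fun F hF s ↦ ?_⟩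
  have hw := measurable_weight_right (2 * D) D s
  rw [lintegral_convolution_mul (by fun_prop) hF (by fun_prop),
    ← lintegral_const_mul' _ _ ENNReal.ofReal_ne_top, ← lintegral_const_mul' _ _ hC]
  refine lintegral_mono fun r ↦ ?_
  have hinner : ENNReal.ofReal (Real.exp (-(ε * s ^ 2))) *
      (∫⁻ u, ENNReal.ofReal (Real.exp (-b * u ^ 2)) *
        ENNReal.ofReal (weight (2 * D) D s (r + u))) ≤ C * ENNReal.ofReal (weight D D s r) := by
    refine le_trans ?_ (mul_le_mul_left (hCs s) _)
    rw [← lintegral_const_mul' _ _ ENNReal.ofReal_ne_top,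
      ← lintegral_mul_const' _ _ ENNReal.ofReal_ne_top]
    refine lintegral_mono fun u ↦ ?_
    rw [← ENNReal.ofReal_mul (by positivity), ← ENNReal.ofReal_mul (by positivity), ← mul_assoc,
      ← ENNReal.ofReal_mul (by positivity)]
    exact ENNReal.ofReal_le_ofReal (gaussian_mul_weight_le hεb D s r u)
  calc _ = F r * (ENNReal.ofReal (Real.exp (-(ε * s ^ 2))) *
        ∫⁻ u, ENNReal.ofReal (Real.exp (-b * u ^ 2)) *
          ENNReal.ofReal (weight (2 * D) D s (r + u))) := mul_left_comm _ _ _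
    _ ≤ F r * (C * ENNReal.ofReal (weight D D s r)) := by gcongr
    _ = C * (F r * ENNReal.ofReal (weight D D s r)) := mul_left_comm _ _ _

end Weight

section DoubleIntegral

variable {X : Type*} [MeasurableSpace X] {μ : Measure X} {f : X → ℂ} {t τ : X → ℝ} {G : ℝ → ℂ}
  {D E : ℕ} {A : ℝ}

/-- The double integral of the one-dimensional uncertainty condition for `f μ` with phase `t` and
a function `F` on the line, which will be the transform of `f μ`. -/
noncomputable def doubleIntegral (μ : Measure X) (f : X → ℂ) (t : X → ℝ) (F : ℝ → ℂ) (D E : ℕ) :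
    ℝ≥0∞ :=
  ∫⁻ r, ∫⁻ x, ‖f x‖ₑ * ‖F r‖ₑ * ENNReal.ofReal (weight D E (t x) r) ∂μ

theorem doubleIntegral_comp_neg (G : ℝ → ℂ) (D E : ℕ) :
    doubleIntegral μ f t (fun r ↦ G (-r)) D E = doubleIntegral μ f t G D E := by
  rw [doubleIntegral, doubleIntegral, ← lintegral_neg_eq_self]
  simp only [neg_neg, weight_neg_right]

theorem doubleIntegral_eq_lintegral [SFinite μ] (hf : Measurable f) (ht : Measurable t)
    (hG : Measurable G) :
    doubleIntegral μ f t G D E =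
      ∫⁻ x, ‖f x‖ₑ * (∫⁻ r, ‖G r‖ₑ * ENNReal.ofReal (weight D E (t x) r)) ∂μ := by
  have hw : Measurable fun p : ℝ × X ↦ ENNReal.ofReal (weight D E (t p.2) p.1) :=
    ((measurable_weight D E).comp (ht.comp measurable_snd |>.prodMk measurable_fst)).ennreal_ofReal
  rw [doubleIntegral, lintegral_lintegral_swap (Measurable.aemeasurable (by fun_prop))]
  refine lintegral_congr fun x ↦ ?_
  rw [← lintegral_const_mul' _ _ enorm_ne_top]
  exact lintegral_congr fun r ↦ mul_assoc _ _ _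

theorem doubleIntegral_lt_top_of_tail (h : HasExpMoments μ f t) (hGA : ∀ r, ‖G r‖ ≤ A) (R : ℝ)
    (htail : ∫⁻ r in (Ioo (-R) R)ᶜ, ∫⁻ x, ‖f x‖ₑ * ‖G r‖ₑ *
      ENNReal.ofReal (weight D E (t x) r) ∂μ < ⊤) :
    doubleIntegral μ f t G D E < ⊤ := by
  rw [doubleIntegral, ← lintegral_add_compl _ (measurableSet_Ioo (a := -R) (b := R))]
  refine ENNReal.add_lt_top.2 ⟨?_, htail⟩
  have hmoment : ∀ r ∈ Ioo (-R) R, ∫⁻ x, ‖f x‖ₑ * ‖G r‖ₑ *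
      ENNReal.ofReal (weight D E (t x) r) ∂μ ≤
        ENNReal.ofReal A * ENNReal.ofReal (expMoment μ f t R) := fun r hr ↦ by
    rw [h.ofReal_expMoment, ← lintegral_const_mul' _ _ ENNReal.ofReal_ne_top]
    refine lintegral_mono fun x ↦ ?_
    rw [ENNReal.ofReal_mul (norm_nonneg _), ← ofReal_norm, ← ofReal_norm,
      mul_comm (ENNReal.ofReal _), mul_assoc]
    gcongr
    · exact hGA r
    · exact weight_le_exp (abs_le.2 ⟨hr.1.le, hr.2.le⟩)
  refine (setLIntegral_mono' measurableSet_Ioo hmoment).trans_lt ?_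
  rw [setLIntegral_const]
  exact ENNReal.mul_lt_top (ENNReal.mul_lt_top ENNReal.ofReal_lt_top ENNReal.ofReal_lt_top)
    measure_Ioo_lt_top

theorem doubleIntegral_lt_top_of_abs_le (h : HasExpMoments μ f t) (hGA : ∀ r, ‖G r‖ ≤ A)
    (hle : ∀ x, |t x| ≤ |τ x|) (hfin : doubleIntegral μ f τ G D E < ⊤) :
    doubleIntegral μ f t G D E < ⊤ := by
  refine doubleIntegral_lt_top_of_tail h hGA D (lt_of_le_of_lt ?_ hfin)
  refine (setLIntegral_mono' measurableSet_Ioo.compl fun r hr ↦ lintegral_mono fun x ↦ ?_).trans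
    (setLIntegral_le_lintegral _ _)
  gcongr
  exact weight_le_weight (hle x) (not_lt.1 fun hlt ↦ hr (abs_lt.1 hlt))

theorem continuous_laplace_ofReal (h : HasExpMoments μ f t) :
    Continuous fun r : ℝ ↦ laplace μ f t r :=
  (differentiable_laplace h).continuous.comp continuous_ofReal

theorem doubleIntegral_damp_lt_top [SFinite μ] (h : HasExpMoments μ f t)
    (hfin : doubleIntegral μ f t (fun r ↦ laplace μ f t r) D D < ⊤) {ε : ℝ} (hε : 0 < ε) :
    doubleIntegral μ (damp ε f t) t (fun r ↦ laplace μ (damp ε f t) t r) (2 * D) D < ⊤ := by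
  obtain ⟨b, hb, hεb⟩ : ∃ b > 0, 4 * ε * b = 1 := ⟨1 / (4 * ε), by positivity, by field_simp⟩
  obtain ⟨C, hC, hCF⟩ := exists_lintegral_gaussian_convolution_mul_weight_le hε.le hb hεb D
  have hdamp := h.damp hε.le
  set K : ℝ≥0∞ := ‖((π / b : ℂ) ^ (1 / 2 : ℂ))⁻¹‖ₑ
  set F : ℝ → ℝ≥0∞ := fun r ↦ ‖laplace μ f t r‖ₑ
  have hF : Measurable F := (continuous_laplace_ofReal h).measurable.enorm
  have hKC : K * C ≠ ⊤ := ENNReal.mul_ne_top enorm_ne_top hC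
  have hx : ∀ x, ‖damp ε f t x‖ₑ * ∫⁻ r : ℝ, ‖laplace μ (damp ε f t) t r‖ₑ *
        ENNReal.ofReal (weight (2 * D) D (t x) r) ≤
      K * C * (‖f x‖ₑ * ∫⁻ r, F r * ENNReal.ofReal (weight D D (t x) r)) := fun x ↦ by
    have hdampx : ‖damp ε f t x‖ₑ = ‖f x‖ₑ * ENNReal.ofReal (Real.exp (-(ε * t x ^ 2))) := by
      rw [← ofReal_norm, norm_damp, ENNReal.ofReal_mul (norm_nonneg _), ofReal_norm]
    calc _ ≤ ‖damp ε f t x‖ₑ * ∫⁻ r, K * ((∫⁻ u, ENNReal.ofReal (Real.exp (-b * u ^ 2)) *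
          F (r - u)) * ENNReal.ofReal (weight (2 * D) D (t x) r)) := by
          refine mul_le_mul_right (lintegral_mono fun r ↦ ?_) _
          exact (mul_le_mul_left (enorm_laplace_damp_le h.integrable h.measurable_phase hb hεb r)
            _).trans_eq (mul_assoc _ _ _)
      _ = K * ‖f x‖ₑ * (ENNReal.ofReal (Real.exp (-(ε * t x ^ 2))) *
          ∫⁻ r, (∫⁻ u, ENNReal.ofReal (Real.exp (-b * u ^ 2)) * F (r - u)) *
            ENNReal.ofReal (weight (2 * D) D (t x) r)) := by
          rw [lintegral_const_mul' _ _ enorm_ne_top, hdampx]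
          ring
      _ ≤ K * ‖f x‖ₑ * (C * ∫⁻ r, F r * ENNReal.ofReal (weight D D (t x) r)) := by
          exact mul_le_mul_right (hCF F hF (t x)) _
      _ = _ := by ring
  rw [doubleIntegral_eq_lintegral h.measurable h.measurable_phase
    (continuous_laplace_ofReal h).measurable] at hfin
  rw [doubleIntegral_eq_lintegral hdamp.measurable h.measurable_phase
    (continuous_laplace_ofReal hdamp).measurable]
  refine (lintegral_mono hx).trans_lt ?_
  rw [lintegral_const_mul' _ _ hKC]
  exact ENNReal.mul_lt_top hKC.lt_top hfin

end DoubleIntegral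

section DampedTransform

variable {X : Type*} {f : X → ℂ} {t : X → ℝ} {D : ℕ} {ε R s : ℝ}

/-- For `|t x| ≤ R / ε` the weight costs only a power of `R`; beyond, the Gaussian wins. -/
theorem norm_damp_mul_exp_le (hε : 0 < ε) (D : ℕ) (hs : 0 ≤ s) (hsR : s ≤ R) (x : X) :
    ‖damp ε f t x‖ * Real.exp (s * |t x|) ≤
      ‖f x‖ +
        (1 + R / ε) ^ (2 * D) * (1 + R) ^ D * (‖damp ε f t x‖ * weight (2 * D) D (t x) s) := by
  have hR : 0 ≤ R := hs.trans hsR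
  have hw := weight_nonneg (2 * D) D (t x) s
  rcases le_total (|t x|) (R / ε) with hx | hx
  · have hexp : Real.exp (s * |t x|) ≤
        (1 + R / ε) ^ (2 * D) * (1 + R) ^ D * weight (2 * D) D (t x) s := by
      rw [weight, ← mul_div_assoc, le_div_iff₀ (by positivity), abs_of_nonneg hs, mul_comm s,
        mul_comm]
      gcongr
    calc ‖damp ε f t x‖ * Real.exp (s * |t x|) ≤ ‖damp ε f t x‖ *
          ((1 + R / ε) ^ (2 * D) * (1 + R) ^ D * weight (2 * D) D (t x) s) := by gcongr
      _ = (1 + R / ε) ^ (2 * D) * (1 + R) ^ D * (‖damp ε f t x‖ * weight (2 * D) D (t x) s) :=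
          mul_left_comm _ _ _
      _ ≤ _ := le_add_of_nonneg_left (norm_nonneg _)
  · refine le_trans ?_ (le_add_of_nonneg_right (by positivity))
    rw [norm_damp, mul_assoc, ← Real.exp_add]
    refine mul_le_of_le_one_right (norm_nonneg _) (Real.exp_le_one_iff.2 ?_)
    have hst : s ≤ ε * |t x| := hsR.trans ((div_le_iff₀' hε).1 hx)
    rw [← sq_abs]
    nlinarith [abs_nonneg (t x)]

variable [MeasurableSpace X] {μ : Measure X} {g : ℝ → ℂ}

theorem ofReal_expMoment_damp_le (h : HasExpMoments μ f t) (hε : 0 < ε) (D : ℕ) (hs : 0 ≤ s)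
    (hsR : s ≤ R) :
    ENNReal.ofReal (expMoment μ (damp ε f t) t s) ≤ ENNReal.ofReal (expMoment μ f t 0) +
      ENNReal.ofReal ((1 + R / ε) ^ (2 * D) * (1 + R) ^ D) *
        ∫⁻ x, ‖damp ε f t x‖ₑ * ENNReal.ofReal (weight (2 * D) D (t x) s) ∂μ := by
  have hR : 0 ≤ R := hs.trans hsR
  have hf := h.measurable
  rw [(h.damp hε.le).ofReal_expMoment, expMoment_zero,
    ofReal_integral_eq_lintegral_ofReal h.integrable.norm
      (Eventually.of_forall fun x ↦ norm_nonneg _),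
    ← lintegral_const_mul' _ _ ENNReal.ofReal_ne_top, ← lintegral_add_left (by fun_prop)]
  refine lintegral_mono fun x ↦
    (ENNReal.ofReal_le_ofReal (norm_damp_mul_exp_le hε D hs hsR x)).trans_eq ?_
  have hw := weight_nonneg (2 * D) D (t x) s
  rw [ENNReal.ofReal_add (norm_nonneg _) (by positivity), ENNReal.ofReal_mul (by positivity),
    ENNReal.ofReal_mul (norm_nonneg _), ofReal_norm (damp ε f t x)]

theorem lintegral_norm_mul_expMoment_damp_le (h : HasExpMoments μ f t) (hε : 0 < ε)
    (hg : ∀ s, ‖g s‖ ≤ expMoment μ f t 0) :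
    ∫⁻ s in Ioc 0 R, ENNReal.ofReal (‖g s‖ * expMoment μ (damp ε f t) t s) ≤
      ENNReal.ofReal (expMoment μ f t 0 ^ 2 * R) +
        ENNReal.ofReal ((1 + R / ε) ^ (2 * D) * (1 + R) ^ D) *
          doubleIntegral μ (damp ε f t) t g (2 * D) D := by
  have hA := expMoment_nonneg (μ := μ) (f := f) (t := t) 0
  have hpoint : ∀ s ∈ Ioc 0 R, ENNReal.ofReal (‖g s‖ * expMoment μ (damp ε f t) t s) ≤
      ENNReal.ofReal (expMoment μ f t 0 ^ 2) +
        ENNReal.ofReal ((1 + R / ε) ^ (2 * D) * (1 + R) ^ D) *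
          ∫⁻ x, ‖damp ε f t x‖ₑ * ‖g s‖ₑ * ENNReal.ofReal (weight (2 * D) D (t x) s) ∂μ := by
    intro s hs
    have hpull : ∫⁻ x, ‖damp ε f t x‖ₑ * ‖g s‖ₑ * ENNReal.ofReal (weight (2 * D) D (t x) s) ∂μ =
        ‖g s‖ₑ * ∫⁻ x, ‖damp ε f t x‖ₑ * ENNReal.ofReal (weight (2 * D) D (t x) s) ∂μ := by
      rw [← lintegral_const_mul' _ _ enorm_ne_top]
      exact lintegral_congr fun x ↦ by ring
    rw [ENNReal.ofReal_mul (norm_nonneg _), hpull, sq, ENNReal.ofReal_mul hA]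
    refine (mul_le_mul_right (ofReal_expMoment_damp_le h hε D hs.1.le hs.2) _).trans ?_
    rw [mul_add, mul_left_comm, ofReal_norm]
    gcongr
    rw [← ofReal_norm]
    exact ENNReal.ofReal_le_ofReal (hg s)
  refine (setLIntegral_mono' measurableSet_Ioc hpoint).trans ?_
  rw [lintegral_add_left measurable_const, setLIntegral_const, Real.volume_Ioc, sub_zero,
    lintegral_const_mul' _ _ ENNReal.ofReal_ne_top, ← ENNReal.ofReal_mul (by positivity)]
  gcongr
  exact setLIntegral_le_lintegral _ _

theorem one_add_div_pow_mul_le (hε : 0 < ε) (hR : 0 ≤ R) (D : ℕ) :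
    (1 + R / ε) ^ (2 * D) * (1 + R) ^ D ≤ (1 + 1 / ε) ^ (2 * D) * (1 + R) ^ (3 * D + 1) := by
  have hbase : 1 + R / ε ≤ (1 + 1 / ε) * (1 + R) := by
    have hdiv : R / ε = 1 / ε * R := by ring
    rw [hdiv]
    nlinarith [show 0 < 1 / ε by positivity]
  calc (1 + R / ε) ^ (2 * D) * (1 + R) ^ D
      ≤ ((1 + 1 / ε) * (1 + R)) ^ (2 * D) * (1 + R) ^ D := by gcongr
    _ = (1 + 1 / ε) ^ (2 * D) * (1 + R) ^ (3 * D) := by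
        rw [mul_pow, mul_assoc, ← pow_add]
        congr 2
        ring
    _ ≤ (1 + 1 / ε) ^ (2 * D) * (1 + R) ^ (3 * D + 1) := by
        gcongr
        · linarith
        · omega

theorem integral_norm_mul_expMoment_damp_le (h : HasExpMoments μ f t) (hε : 0 < ε)
    (hgc : Continuous g) (hg : ∀ s, ‖g s‖ ≤ expMoment μ f t 0)
    (hfin : doubleIntegral μ (damp ε f t) t g (2 * D) D < ⊤) (hR : 0 ≤ R) :
    ∫ s in (0 : ℝ)..R, ‖g s‖ * expMoment μ (damp ε f t) t s ≤
      (expMoment μ f t 0 ^ 2 + (1 + 1 / ε) ^ (2 * D) *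
        (doubleIntegral μ (damp ε f t) t g (2 * D) D).toReal) * (1 + R) ^ (3 * D + 1) := by
  set K := doubleIntegral μ (damp ε f t) t g (2 * D) D
  have hle : ∫ s in (0 : ℝ)..R, ‖g s‖ * expMoment μ (damp ε f t) t s ≤
      expMoment μ f t 0 ^ 2 * R + (1 + R / ε) ^ (2 * D) * (1 + R) ^ D * K.toReal := by
    rw [intervalIntegral.integral_of_le hR, integral_eq_lintegral_of_nonneg_ae
      (Eventually.of_forall fun s ↦ mul_nonneg (norm_nonneg _) (expMoment_nonneg s))
      (hgc.norm.measurable.mul (h.damp hε.le).monotone_expMoment.measurable).aestronglyMeasurable]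
    refine ENNReal.toReal_le_of_le_ofReal (by positivity)
      ((lintegral_norm_mul_expMoment_damp_le (D := D) h hε hg).trans_eq ?_)
    rw [ENNReal.ofReal_add (by positivity) (by positivity),
      ENNReal.ofReal_mul (p := (1 + R / ε) ^ (2 * D) * (1 + R) ^ D) (by positivity),
      ENNReal.ofReal_toReal hfin.ne]
  have hRpow : R ≤ (1 + R) ^ (3 * D + 1) :=
    (le_add_of_nonneg_left zero_le_one).trans
      (le_self_pow₀ (le_add_of_nonneg_right hR) (Nat.succ_ne_zero _))
  calc _ ≤ expMoment μ f t 0 ^ 2 * R + (1 + R / ε) ^ (2 * D) * (1 + R) ^ D * K.toReal := hle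
    _ ≤ expMoment μ f t 0 ^ 2 * (1 + R) ^ (3 * D + 1) +
        (1 + 1 / ε) ^ (2 * D) * (1 + R) ^ (3 * D + 1) * K.toReal := by
        gcongr ?_ + ?_ * _
        · gcongr
        · exact one_add_div_pow_mul_le hε hR D
    _ = _ := by ring

theorem expMoment_damp_le (h : HasExpMoments μ f t) (hε : 0 < ε) (s : ℝ) :
    expMoment μ (damp ε f t) t s ≤
      expMoment μ f t 0 * Real.exp (1 / (4 * ε) * s ^ 2) := by
  rw [expMoment_zero, ← integral_mul_const]
  refine integral_mono ((h.damp hε.le).integrable_mul_exp s) (h.integrable.norm.mul_const _)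
    fun x ↦ ?_
  dsimp only
  rw [norm_damp, mul_assoc, ← Real.exp_add]
  gcongr
  have hsq : (2 * ε * |t x| - s) ^ 2 / (4 * ε) =
      ε * t x ^ 2 - s * |t x| + 1 / (4 * ε) * s ^ 2 := by
    rw [← sq_abs (t x)]
    field_simp
    ring
  linarith [show 0 ≤ (2 * ε * |t x| - s) ^ 2 / (4 * ε) by positivity]

theorem beurlingGrowth_of_eq_laplace_damp (h : HasExpMoments μ f t) (hε : 0 < ε) {G : ℂ → ℂ}
    (hG : Differentiable ℂ G) (hle : ∀ z, ‖G z‖ ≤ expMoment μ (damp ε f t) t |z.im|)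
    (hfin : doubleIntegral μ (damp ε f t) t (fun r ↦ G r) (2 * D) D < ⊤) :
    BeurlingGrowth (expMoment μ (damp ε f t) t)
      (expMoment μ f t 0 ^ 2 + (1 + 1 / ε) ^ (2 * D) *
        (doubleIntegral μ (damp ε f t) t (fun r ↦ G r) (2 * D) D).toReal) (3 * D + 1) G where
  differentiable := hG
  norm_le z := (hle z).trans ((h.damp hε.le).monotone_expMoment (abs_im_le_norm z))
  integral_le R hR := by
    refine integral_norm_mul_expMoment_damp_le h hε (hG.continuous.comp continuous_ofReal)
      (fun s ↦ (hle s).trans ?_) hfin hR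
    exact (h.damp hε.le).expMoment_le_expMoment h (norm_damp_le hε.le) (by simp)

theorem isPolynomialMulGaussian_laplace_damp [SFinite μ] (h : HasExpMoments μ f t)
    (hfin : doubleIntegral μ f t (fun r ↦ laplace μ f t r) D D < ⊤) (hε : 0 < ε) :
    IsPolynomialMulGaussian (3 * D + 1) (laplace μ (damp ε f t) t) := by
  have hdamp := h.damp hε.le
  have hfin_damp := doubleIntegral_damp_lt_top h hfin hε
  have hneg : doubleIntegral μ (damp ε f t) t
      (fun r : ℝ ↦ laplace μ (damp ε f t) t (-(r : ℂ))) (2 * D) D =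
      doubleIntegral μ (damp ε f t) t (fun r ↦ laplace μ (damp ε f t) t r) (2 * D) D := by
    rw [← doubleIntegral_comp_neg fun r : ℝ ↦ laplace μ (damp ε f t) t r]
    simp only [ofReal_neg]
  have hG := beurlingGrowth_of_eq_laplace_damp h hε (differentiable_laplace hdamp)
    (norm_laplace_le hdamp) hfin_damp
  have hGneg := beurlingGrowth_of_eq_laplace_damp (G := fun z ↦ laplace μ (damp ε f t) t (-z)) h hε
    ((differentiable_laplace hdamp).comp differentiable_neg)
    (fun z ↦ by simpa using norm_laplace_le hdamp (-z)) (hneg ▸ hfin_damp)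
  rw [hneg] at hGneg
  exact hG.isPolynomialMulGaussian hdamp.monotone_expMoment
    (fun r _ ↦ expMoment_damp_le h hε r) hGneg

/-- Beurling's theorem in dimension one, for the image of `f μ` under the phase. -/
theorem isPolynomialMulGaussian_laplace [SFinite μ] (h : HasExpMoments μ f t)
    (hfin : doubleIntegral μ f t (fun r ↦ laplace μ f t r) D D < ⊤) :
    IsPolynomialMulGaussian (3 * D + 1) (laplace μ f t) := by
  have hε : ∀ k : ℕ, (0 : ℝ) < 1 / (k + 1) := fun k ↦ by positivity
  refine isPolynomialMulGaussian_of_tendsto (C := expMoment μ f t 2) (differentiable_laplace h)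
    (fun k ↦ isPolynomialMulGaussian_laplace_damp h hfin (hε k)) (fun k z hz ↦ ?_)
    (tendsto_laplace_damp h (fun k ↦ (hε k).le) tendsto_one_div_add_atTop_nhds_zero_nat)
  exact (norm_laplace_le (h.damp (hε k).le) z).trans ((h.damp (hε k).le).expMoment_le_expMoment h
    (norm_damp_le (hε k).le) ((abs_im_le_norm z).trans hz))

end DampedTransform

/-! ### Restriction to lines -/

section Lines

/-- The polar Jacobian `|r| ^ k` times a weight of finite mass, which normalizes the directions. -/
noncomputable def lineDensity (k : ℕ) (r : ℝ) : ℝ≥0∞ := ENNReal.ofReal (|r| ^ k * (1 + r ^ 2)⁻¹)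

theorem measurable_lineDensity (k : ℕ) : Measurable (lineDensity k) := by
  unfold lineDensity abs
  fun_prop

variable {E : Type*} [NormedAddCommGroup E] [InnerProductSpace ℝ E] [FiniteDimensional ℝ E]
  [MeasurableSpace E] [BorelSpace E]

open Module in
theorem lintegral_lintegral_smul {g : E → ℝ≥0∞} (hg : Measurable g) :
    ∫⁻ v : E, ∫⁻ r : ℝ, g (r • v) * lineDensity (finrank ℝ E) r =
      (∫⁻ r : ℝ, ENNReal.ofReal (1 + r ^ 2)⁻¹) * ∫⁻ v, g v := by
  rw [lintegral_lintegral_swap (Measurable.aemeasurable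
    ((hg.comp (by fun_prop)).mul ((measurable_lineDensity _).comp measurable_snd))),
    ← lintegral_mul_const _ (by fun_prop)]
  refine lintegral_congr_ae ?_
  filter_upwards [compl_mem_ae_iff.2 (measure_singleton (0 : ℝ))] with r (hr : r ≠ 0)
  have hscale : ∫⁻ v, g (r • v) = ENNReal.ofReal |(r ^ finrank ℝ E)⁻¹| * ∫⁻ v, g v := by
    rw [← lintegral_map hg (measurable_const_smul r), Measure.map_addHaar_smul volume hr,
      lintegral_smul_measure, smul_eq_mul]
  rw [lintegral_mul_const _ (by fun_prop), hscale, mul_right_comm, lineDensity,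
    ← ENNReal.ofReal_mul (abs_nonneg _), abs_inv, abs_pow, ← mul_assoc,
    inv_mul_cancel₀ (by positivity), one_mul]

open Module in
theorem ae_lintegral_smul_lt_top {g : E → ℝ≥0∞} (hg : Measurable g) (hfin : ∫⁻ v, g v < ⊤) :
    ∀ᵐ v : E, ∫⁻ r : ℝ, g (r • v) * lineDensity (finrank ℝ E) r < ⊤ := by
  refine ae_lt_top (Measurable.lintegral_prod_right'
    (f := fun p : E × ℝ ↦ g (p.2 • p.1) * lineDensity (finrank ℝ E) p.2)
    ((hg.comp (by fun_prop)).mul ((measurable_lineDensity _).comp measurable_snd))) ?_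
  rw [lintegral_lintegral_smul hg]
  exact (ENNReal.mul_lt_top integrable_inv_one_add_sq.lintegral_lt_top hfin).ne

theorem volume_eq_zero_of_lines {N : Set E} (hN : MeasurableSet N) (p : E)
    (h : ∀ v : E, ∀ᵐ r : ℝ, p + r • v ∉ N) : volume N = 0 := by
  have hg : Measurable fun y ↦ N.indicator (1 : E → ℝ≥0∞) (p + y) :=
    (measurable_one.indicator hN).comp (by fun_prop)
  have hline : ∀ v : E, ∫⁻ r : ℝ, N.indicator (1 : E → ℝ≥0∞) (p + r • v) *
      lineDensity (Module.finrank ℝ E) r = 0 := fun v ↦ by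
    rw [← lintegral_zero (μ := (volume : Measure ℝ))]
    refine lintegral_congr_ae ?_
    filter_upwards [h v] with r hr
    rw [indicator_of_notMem hr, zero_mul]
  have hmass : (∫⁻ r : ℝ, ENNReal.ofReal (1 + r ^ 2)⁻¹) ≠ 0 := by
    rw [← ofReal_integral_eq_lintegral_ofReal integrable_inv_one_add_sq
      (Eventually.of_forall fun r ↦ by positivity), integral_univ_inv_one_add_sq]
    simpa using Real.pi_pos
  have hzero := lintegral_lintegral_smul hg
  simp_rw [hline, lintegral_zero] at hzero
  rw [← lintegral_indicator_one hN, ← lintegral_add_left_eq_self _ p]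
  exact (mul_eq_zero.1 hzero.symm).resolve_left hmass

theorem ae_ne_zero_of_analyticOnNhd {g : ℝ → ℂ} (hg : AnalyticOnNhd ℝ g univ) {r₀ : ℝ}
    (h : g r₀ ≠ 0) : ∀ᵐ r : ℝ, g r ≠ 0 := by
  have hae := ae_restrict_le_codiscreteWithin (μ := (volume : Measure ℝ)) MeasurableSet.univ
    (hg.preimage_zero_mem_codiscrete h)
  rwa [Measure.restrict_univ] at hae

theorem ae_ne_zero_of_analyticOnNhd_lines {g : E → ℂ} (hg : Measurable g) {p : E} (hp : g p ≠ 0)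
    (h : ∀ v, AnalyticOnNhd ℝ (fun r : ℝ ↦ g (p + r • v)) univ) : ∀ᵐ y, g y ≠ 0 :=
  measure_eq_zero_iff_ae_notMem.1 <|
    volume_eq_zero_of_lines (hg (measurableSet_singleton 0)) p fun v ↦
      ae_ne_zero_of_analyticOnNhd (h v) (r₀ := 0) (by simpa using hp)

end Lines

section Polynomials

variable {n : ℕ} {Q : MvPolynomial (Fin n) ℂ}

open MvPolynomial (homogeneousComponent)

theorem analyticOnNhd_polyValue (Q : MvPolynomial (Fin n) ℂ) :
    AnalyticOnNhd ℝ (polyValue Q) univ := by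
  unfold polyValue
  exact AnalyticOnNhd.eval_continuousLinearMap' (E := EuclideanSpace ℝ (Fin n))
    (fun i ↦ ofRealCLM.comp (EuclideanSpace.proj i)) Q

theorem continuous_polyValue (Q : MvPolynomial (Fin n) ℂ) : Continuous (polyValue Q) :=
  (analyticOnNhd_polyValue Q).continuous

theorem exists_polyValue_ne_zero (hQ : Q ≠ 0) : ∃ x, polyValue Q x ≠ 0 := by
  by_contra! h
  refine hQ (MvPolynomial.funext_set (fun _ ↦ range ((↑) : ℝ → ℂ))
    (fun _ ↦ infinite_range_of_injective ofReal_injective) fun y hy ↦ ?_)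
  choose x hx using fun i ↦ hy i (mem_univ i)
  rw [map_zero, ← h (WithLp.toLp 2 x), polyValue]
  congr
  exact (funext hx).symm

theorem ae_polyValue_ne_zero (hQ : Q ≠ 0) : ∀ᵐ y, polyValue Q y ≠ 0 := by
  obtain ⟨p, hp⟩ := exists_polyValue_ne_zero hQ
  exact ae_ne_zero_of_analyticOnNhd_lines (continuous_polyValue Q).measurable hp fun v r _ ↦
    (analyticOnNhd_polyValue Q _ (mem_univ _)).comp (f := fun r : ℝ ↦ p + r • v) (by fun_prop)

theorem polyValue_smul_of_isHomogeneous {j : ℕ} (hQ : Q.IsHomogeneous j) (s : ℝ)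
    (w : EuclideanSpace ℝ (Fin n)) : polyValue Q (s • w) = (s : ℂ) ^ j * polyValue Q w := by
  rw [polyValue, polyValue, MvPolynomial.eval_eq, MvPolynomial.eval_eq, Finset.mul_sum]
  refine Finset.sum_congr rfl fun d hd ↦ ?_
  simp only [PiLp.smul_apply, smul_eq_mul, ofReal_mul, mul_pow, Finset.prod_mul_distrib,
    Finset.prod_pow_eq_pow_sum, hQ.degree_eq_sum_deg_support hd]
  ring

theorem homogeneousComponent_totalDegree_ne_zero (hQ : Q ≠ 0) :
    homogeneousComponent Q.totalDegree Q ≠ 0 := by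
  obtain ⟨d, hd, hdeg⟩ := Finset.exists_mem_eq_sup Q.support (MvPolynomial.support_nonempty.2 hQ)
    fun s ↦ s.sum fun _ e ↦ e
  intro h
  have hcoeff := congrArg (MvPolynomial.coeff d) h
  rw [MvPolynomial.coeff_homogeneousComponent, MvPolynomial.coeff_zero,
    if_pos (by rw [MvPolynomial.totalDegree, hdeg]; rfl)] at hcoeff
  exact MvPolynomial.mem_support_iff.1 hd hcoeff

/-- The polynomial function `σ ^ m * Q (w / σ)`, with `m` the total degree of `Q`; at `σ = 0` it
is the leading form of `Q`. -/
noncomputable def rescaledValue (Q : MvPolynomial (Fin n) ℂ)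
    (p : ℝ × EuclideanSpace ℝ (Fin n)) : ℂ :=
  ∑ j ∈ Finset.range (Q.totalDegree + 1),
    (p.1 : ℂ) ^ (Q.totalDegree - j) * polyValue (homogeneousComponent j Q) p.2

theorem continuous_rescaledValue (Q : MvPolynomial (Fin n) ℂ) : Continuous (rescaledValue Q) :=
  continuous_finsetSum _ fun j _ ↦
    Continuous.mul (by fun_prop) ((continuous_polyValue _).comp continuous_snd)

theorem rescaledValue_zero_left (Q : MvPolynomial (Fin n) ℂ) (v : EuclideanSpace ℝ (Fin n)) :
    rescaledValue Q (0, v) = polyValue (homogeneousComponent Q.totalDegree Q) v := by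
  rw [rescaledValue, Finset.sum_range_succ, Finset.sum_eq_zero fun j hj ↦ ?_]
  · simp
  · have hj := Finset.mem_range.1 hj
    rw [ofReal_zero, zero_pow (by omega), zero_mul]

theorem polyValue_smul_eq_rescaledValue (Q : MvPolynomial (Fin n) ℂ) {s : ℝ} (hs : s ≠ 0)
    (w : EuclideanSpace ℝ (Fin n)) :
    polyValue Q (s • w) = (s : ℂ) ^ Q.totalDegree * rescaledValue Q (s⁻¹, w) := by
  have hs' : (s : ℂ) ≠ 0 := ofReal_ne_zero.2 hs
  have hsum : polyValue Q (s • w) = ∑ j ∈ Finset.range (Q.totalDegree + 1),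
      polyValue (homogeneousComponent j Q) (s • w) := by
    conv_lhs => rw [← MvPolynomial.sum_homogeneousComponent Q]
    simp only [polyValue, map_sum]
  rw [hsum, rescaledValue, Finset.mul_sum]
  refine Finset.sum_congr rfl fun j hj ↦ ?_
  rw [polyValue_smul_of_isHomogeneous (MvPolynomial.homogeneousComponent_isHomogeneous j Q),
    ← mul_assoc, ofReal_inv, inv_pow, ← pow_sub₀ _ hs' (Nat.sub_le _ j),
    Nat.sub_sub_self (Finset.mem_range_succ_iff.1 hj)]

theorem exists_mul_rpow_le_norm_polyValue_smul_rpow (δ : ℝ) {v : EuclideanSpace ℝ (Fin n)}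
    (hv : polyValue (homogeneousComponent Q.totalDegree Q) v ≠ 0) :
    ∃ c ρ S : ℝ, 0 < c ∧ 0 < ρ ∧ 0 < S ∧ ∀ s : ℝ, S ≤ |s| → ∀ w ∈ ball v ρ,
      c * |s| ^ (Q.totalDegree * δ) ≤ ‖polyValue Q (s • w)‖ ^ δ := by
  have hv0 : 0 < ‖rescaledValue Q (0, v)‖ := by rwa [rescaledValue_zero_left, norm_pos_iff]
  have hvδ : 0 < ‖rescaledValue Q (0, v)‖ ^ δ := Real.rpow_pos_of_pos hv0 δ
  have hcont : ContinuousAt (fun p ↦ ‖rescaledValue Q p‖ ^ δ) (0, v) :=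
    (continuous_rescaledValue Q).norm.continuousAt.rpow_const (.inl hv0.ne')
  obtain ⟨ρ, hρ, hball⟩ := Metric.eventually_nhds_iff_ball.1
    (hcont.eventually_const_lt (half_lt_self hvδ))
  refine ⟨_, ρ, 2 / ρ, half_pos hvδ, hρ, by positivity, fun s hs w hw ↦ ?_⟩
  have hs0 : 0 < |s| := lt_of_lt_of_le (by positivity) hs
  have hmem : (s⁻¹, w) ∈ ball ((0 : ℝ), v) ρ := by
    rw [← ball_prod_same]
    refine ⟨?_, hw⟩
    rw [mem_ball_zero_iff, Real.norm_eq_abs, abs_inv, inv_lt_comm₀ hs0 hρ, ← one_div]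
    exact lt_of_lt_of_le (by gcongr; exact one_lt_two) hs
  rw [polyValue_smul_eq_rescaledValue Q (abs_pos.1 hs0), norm_mul, norm_pow, norm_real,
    Real.norm_eq_abs, Real.mul_rpow (by positivity) (norm_nonneg _), ← Real.rpow_natCast,
    ← Real.rpow_mul hs0.le, mul_comm]
  gcongr
  exact (hball _ hmem).le

end Polynomials

section FourierIntegral

variable {E : Type*} [NormedAddCommGroup E] [InnerProductSpace ℝ E] [FiniteDimensional ℝ E]
  [MeasurableSpace E] [BorelSpace E] {f : E → ℂ}

/-- The Fourier integral `∫ f(x) e^{-i x·y} dx`, in the normalization of `l2Fourier`. -/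
noncomputable def fourierInt (f : E → ℂ) (y : E) : ℂ := ∫ x, f x * exp (-(I * (⟪y, x⟫ : ℝ)))

theorem fourierInt_eq_fourier (f : E → ℂ) (y : E) : fourierInt f y = 𝓕 f ((2 * π)⁻¹ • y) := by
  rw [fourierInt, Real.fourier_eq']
  refine integral_congr_ae (Eventually.of_forall fun x ↦ ?_)
  dsimp only
  rw [smul_eq_mul, mul_comm, real_inner_smul_right, real_inner_comm]
  congr 2
  push_cast
  field_simp [ofReal_ne_zero.2 Real.pi_ne_zero]

theorem fourier_eq_fourierInt (f : E → ℂ) (w : E) : 𝓕 f w = fourierInt f ((2 * π) • w) := by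
  rw [fourierInt_eq_fourier, smul_smul, inv_mul_cancel₀ (by positivity), one_smul]

theorem continuous_fourier_of_integrable (hf : Integrable f) : Continuous (𝓕 f) :=
  VectorFourier.fourierIntegral_continuous Real.continuous_fourierChar
    (innerSL ℝ (E := E)).continuous₂ hf

theorem continuous_fourierInt (hf : Integrable f) : Continuous (fourierInt f) := by
  rw [funext (fourierInt_eq_fourier f)]
  exact (continuous_fourier_of_integrable hf).comp (by fun_prop)

theorem norm_fourierInt_le (f : E → ℂ) (y : E) : ‖fourierInt f y‖ ≤ ∫ x, ‖f x‖ := by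
  refine (norm_integral_le_integral_norm _).trans_eq (congrArg _ (funext fun x ↦ ?_))
  simp [norm_exp]

theorem fourierInt_smul (f : E → ℂ) (v : E) (r : ℝ) :
    fourierInt f (r • v) = laplace volume f (fun x ↦ ⟪v, x⟫) r := by
  simp only [fourierInt, laplace, real_inner_smul_left, ofReal_mul, mul_assoc]

theorem HasExpMoments.inner_left (h : HasExpMoments volume f norm) (v : E) :
    HasExpMoments volume f fun x ↦ ⟪v, x⟫ :=
  h.of_le h.measurable (by fun_prop) (fun _ ↦ le_rfl) fun x ↦
    (abs_real_inner_le_norm v x).trans_eq (by rw [abs_norm])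

theorem integrable_mul_exp_inner (hf : AEStronglyMeasurable f) {c c' : ℝ}
    (hexp : Integrable fun x ↦ ‖f x‖ * Real.exp (c * ‖x‖)) {v : E} (hc' : 0 ≤ c')
    (hv : c' * ‖v‖ ≤ c) : Integrable fun x ↦ ‖f x‖ * Real.exp (c' * |⟪v, x⟫|) := by
  refine hexp.mono' (hf.norm.mul (Measurable.aestronglyMeasurable (by fun_prop)))
    (Eventually.of_forall fun x ↦ ?_)
  rw [Real.norm_of_nonneg (by positivity)]
  gcongr ‖f x‖ * Real.exp ?_
  calc c' * |⟪v, x⟫| ≤ c' * (‖v‖ * ‖x‖) := by gcongr; exact abs_real_inner_le_norm v x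
    _ = c' * ‖v‖ * ‖x‖ := (mul_assoc _ _ _).symm
    _ ≤ c * ‖x‖ := by gcongr

theorem fourierInt_add_smul (f : E → ℂ) (p v : E) (r : ℝ) : fourierInt f (p + r • v) =
    laplace volume (fun x ↦ f x * exp (-(I * (⟪p, x⟫ : ℝ)))) (fun x ↦ ⟪v, x⟫) r := by
  rw [← fourierInt_smul, fourierInt, fourierInt]
  congr 1 with x
  rw [mul_assoc, ← exp_add, inner_add_left, ofReal_add, mul_add, neg_add]

theorem analyticOnNhd_fourierInt_line (hf : AEStronglyMeasurable f) {c : ℝ} (hc : 0 < c)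
    (hexp : Integrable fun x ↦ ‖f x‖ * Real.exp (c * ‖x‖)) (p v : E) :
    AnalyticOnNhd ℝ (fun r : ℝ ↦ fourierInt f (p + r • v)) univ := by
  intro r _
  simp only [fourierInt_add_smul]
  set c' := c / (‖v‖ + 1)
  have hc' : 0 < c' := by positivity
  have hexp' : Integrable fun x ↦ ‖f x * exp (-(I * (⟪p, x⟫ : ℝ)))‖ *
      Real.exp (c' * |⟪v, x⟫|) := by
    have hnorm : ∀ x, ‖f x * exp (-(I * (⟪p, x⟫ : ℝ)))‖ = ‖f x‖ := by simp [norm_exp]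
    simp only [hnorm]
    refine integrable_mul_exp_inner hf hexp hc'.le ?_
    rw [div_mul_eq_mul_div, div_le_iff₀ (by positivity)]
    gcongr
    exact le_add_of_nonneg_right zero_le_one
  have hstrip : {z : ℂ | |z.im| < c'} ∈ 𝓝 (r : ℂ) :=
    (isOpen_lt (continuous_abs.comp continuous_im) continuous_const).mem_nhds (by simpa using hc')
  have hanalytic := DifferentiableOn.analyticAt (fun z hz ↦ (differentiableAt_laplace
    (hf.mul (Measurable.aestronglyMeasurable (by fun_prop))) (by fun_prop) hexp'
    hz).differentiableWithinAt) hstrip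
  exact hanalytic.restrictScalars.comp (ofRealCLM.analyticAt r)

theorem integrable_of_integrable_mul_exp (hf : AEStronglyMeasurable f) {c : ℝ} (hc : 0 ≤ c)
    (h : Integrable fun x ↦ ‖f x‖ * Real.exp (c * ‖x‖)) : Integrable f :=
  h.mono' hf (Eventually.of_forall fun x ↦
    le_mul_of_one_le_right (norm_nonneg _) (Real.one_le_exp (by positivity)))

theorem ae_fourierInt_ne_zero (hf : AEStronglyMeasurable f) {c : ℝ} (hc : 0 < c)
    (hexp : Integrable fun x ↦ ‖f x‖ * Real.exp (c * ‖x‖)) {p : E}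
    (hp : fourierInt f p ≠ 0) : ∀ᵐ y, fourierInt f y ≠ 0 :=
  ae_ne_zero_of_analyticOnNhd_lines
    (continuous_fourierInt (integrable_of_integrable_mul_exp hf hc.le hexp)).measurable hp
    (analyticOnNhd_fourierInt_line hf hc hexp p)

theorem coeFn_fourier_toLp (hf : MemLp f 2 volume) (hf1 : Integrable f) :
    ((𝓕 (hf.toLp f) : Lp ℂ 2 (volume : Measure E)) : E → ℂ) =ᵐ[volume] 𝓕 f := by
  refine ae_eq_of_integral_contDiff_smul_eq ((Lp.memLp _).locallyIntegrable one_le_two)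
    (continuous_fourier_of_integrable hf1).locallyIntegrable fun g hg hgc ↦ ?_
  have hφc : HasCompactSupport (ofRealCLM ∘ g) := hgc.comp_left rfl
  have hφs : ContDiff ℝ (⊤ : ℕ∞) (ofRealCLM ∘ g) := by fun_prop
  set φ : SchwartzMap E ℂ := hφc.toSchwartzMap hφs with hφ
  have hφg : ∀ x, φ x = (g x : ℂ) := fun x ↦ by simp [hφ]
  have hdistrib : ∫ x, φ x • (𝓕 (hf.toLp f) : Lp ℂ 2 (volume : Measure E)) x =
      ∫ x, (𝓕 φ) x • (hf.toLp f) x := by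
    have hT := congrArg (fun T : TemperedDistribution E ℂ ↦ T φ)
      (Lp.fourier_toTemperedDistribution_eq (hf.toLp f))
    simpa only [TemperedDistribution.fourier_apply, Lp.toTemperedDistribution_apply] using hT.symm
  have hrepr : ∫ x, (𝓕 φ) x • (hf.toLp f) x = ∫ x, (𝓕 φ) x • f x :=
    integral_congr_ae (by filter_upwards [hf.coeFn_toLp] with x hx; rw [hx])
  have hself : ∫ x, (𝓕 φ) x • f x = ∫ x, φ x • 𝓕 f x := by
    have hflip := VectorFourier.integral_fourierIntegral_smul_eq_flip (L := innerₗ E)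
      (μ := volume) (ν := volume) Real.continuous_fourierChar continuous_inner φ.integrable hf1
    rwa [flip_innerₗ] at hflip
  have heq := hdistrib.trans (hrepr.trans hself)
  simp only [hφg] at heq
  simpa using heq

end FourierIntegral

section L2Fourier

variable {n : ℕ} {f g : EuclideanSpace ℝ (Fin n) → ℂ}

theorem l2Fourier_ae_eq (hf : MemLp f 2 volume) (hf1 : Integrable f) :
    l2Fourier f hf =ᵐ[volume] fourierInt f := by
  have h := (Measure.quasiMeasurePreserving_smul (volume : Measure (EuclideanSpace ℝ (Fin n)))
    (r := (2 * π)⁻¹) (by positivity)).ae (coeFn_fourier_toLp hf hf1)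
  filter_upwards [h] with y hy
  rw [l2Fourier, hy, fourierInt_eq_fourier]

theorem measurable_l2Fourier (hf : MemLp f 2 volume) : Measurable (l2Fourier f hf) :=
  (Lp.stronglyMeasurable _).measurable.comp (measurable_const_smul _)

theorem l2Fourier_congr_ae (hf : MemLp f 2 volume) (hg : MemLp g 2 volume)
    (h : f =ᵐ[volume] g) : l2Fourier f hf = l2Fourier g hg := by
  ext y
  rw [l2Fourier, l2Fourier, (MemLp.toLp_eq_toLp_iff hf hg).2 h]

theorem ae_eq_of_l2Fourier_ae_eq (hf : MemLp f 2 volume) (hg : MemLp g 2 volume)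
    (h : l2Fourier f hf =ᵐ[volume] l2Fourier g hg) : f =ᵐ[volume] g := by
  have hscaled := (Measure.quasiMeasurePreserving_smul
    (volume : Measure (EuclideanSpace ℝ (Fin n))) (r := 2 * π) (by positivity)).ae h
  have hfourier : 𝓕 (hf.toLp f) = 𝓕 (hg.toLp g) := by
    refine Lp.ext ?_
    filter_upwards [hscaled] with y hy
    rwa [l2Fourier, l2Fourier, smul_smul, inv_mul_cancel₀ (by positivity), one_smul] at hy
  exact (MemLp.toLp_eq_toLp_iff hf hg).1 ((Lp.fourierTransformₗᵢ _ ℂ).injective hfourier)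

end L2Fourier

section Density

variable {n : ℕ} {f g : EuclideanSpace ℝ (Fin n) → ℂ} {Q : MvPolynomial (Fin n) ℂ} {d δ : ℝ}

/-- The integrand of the uncertainty condition, with a function `g` in place of the transform. -/
noncomputable def density (f g : EuclideanSpace ℝ (Fin n) → ℂ) (Q : MvPolynomial (Fin n) ℂ)
    (d δ : ℝ) (x y : EuclideanSpace ℝ (Fin n)) : ℝ≥0∞ :=
  ENNReal.ofReal (‖f x‖ * ‖g y‖ * Real.exp (‖x‖ * ‖y‖) * ‖polyValue Q y‖ ^ δ
    / (1 + ‖x‖ + ‖y‖) ^ d)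

theorem measurable_density (hf : Measurable f) (hg : Measurable g) :
    Measurable fun p : EuclideanSpace ℝ (Fin n) × EuclideanSpace ℝ (Fin n) ↦
      density f g Q d δ p.1 p.2 := by
  have hQ : Measurable (polyValue Q) := (continuous_polyValue Q).measurable
  unfold density
  fun_prop

theorem lintegral_density_comm (hf : Measurable f) (hg : Measurable g) :
    ∫⁻ x, ∫⁻ y, density f g Q d δ x y = ∫⁻ y, ∫⁻ x, density f g Q d δ x y :=
  lintegral_lintegral_swap (measurable_density hf hg).aemeasurable

theorem ae_lintegral_density_lt_top (hf : Measurable f) (hg : Measurable g)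
    (hfin : ∫⁻ x, ∫⁻ y, density f g Q d δ x y < ⊤) : ∀ᵐ y, ∫⁻ x, density f g Q d δ x y < ⊤ :=
  ae_lt_top (Measurable.lintegral_prod_left' (measurable_density hf hg))
    (lintegral_density_comm hf hg ▸ hfin.ne)

theorem rpow_le_pow_ceil {u : ℝ} (hu : 1 ≤ u) (d : ℝ) : u ^ d ≤ u ^ ⌈d⌉₊ := by
  rw [← Real.rpow_natCast]
  exact Real.rpow_le_rpow_of_exponent_le hu (Nat.le_ceil d)

theorem exists_exp_mul_rpow_le {b c : ℝ} (hb : 0 ≤ b) (hcb : c < b) (d : ℝ) :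
    ∃ K > 0, ∀ u, 0 ≤ u → Real.exp (c * u) * (1 + u + b) ^ d ≤ K * Real.exp (u * b) := by
  set D := ⌈d⌉₊
  refine ⟨D.factorial / (b - c) ^ D * Real.exp ((b - c) * (1 + b)), by positivity, fun u hu ↦ ?_⟩
  have hpow : (1 + u + b) ^ D ≤ D.factorial / (b - c) ^ D * Real.exp ((b - c) * (1 + u + b)) := by
    have htaylor := Real.pow_div_factorial_le_exp ((b - c) * (1 + u + b)) (by positivity) D
    rw [div_le_iff₀ (by positivity), mul_pow] at htaylor
    rw [div_mul_eq_mul_div, le_div_iff₀ (by positivity)]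
    linarith
  calc Real.exp (c * u) * (1 + u + b) ^ d
      ≤ Real.exp (c * u) *
        (D.factorial / (b - c) ^ D * Real.exp ((b - c) * (1 + u + b))) := by
        gcongr
        exact (rpow_le_pow_ceil (by linarith) d).trans hpow
    _ = _ := by
        rw [mul_left_comm, ← Real.exp_add, mul_assoc _ (Real.exp _), ← Real.exp_add]
        ring_nf

theorem integrable_mul_exp_of_lintegral_density_lt_top (hf : Measurable f)
    {y : EuclideanSpace ℝ (Fin n)} (hy : ∫⁻ x, density f g Q d δ x y < ⊤) (hgy : g y ≠ 0)
    (hQy : polyValue Q y ≠ 0) {c : ℝ} (hc : c < ‖y‖) :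
    Integrable fun x ↦ ‖f x‖ * Real.exp (c * ‖x‖) := by
  obtain ⟨K, hK, hKexp⟩ := exists_exp_mul_rpow_le (norm_nonneg y) hc d
  set A := ‖g y‖ * ‖polyValue Q y‖ ^ δ with hA
  have hA0 : 0 < A := mul_pos (norm_pos_iff.2 hgy) (Real.rpow_pos_of_pos (norm_pos_iff.2 hQy) _)
  rw [← lintegral_ofReal_ne_top_iff_integrable (Measurable.aestronglyMeasurable (by fun_prop))
    (Eventually.of_forall fun x ↦ by positivity)]
  refine ne_top_of_le_ne_top (ENNReal.mul_lt_top (ENNReal.ofReal_lt_top (r := K / A)) hy).ne ?_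
  rw [← lintegral_const_mul' _ _ ENNReal.ofReal_ne_top]
  refine lintegral_mono fun x ↦ ?_
  rw [density, ← ENNReal.ofReal_mul (by positivity)]
  refine ENNReal.ofReal_le_ofReal ?_
  have hpos : 0 < (1 + ‖x‖ + ‖y‖) ^ d := Real.rpow_pos_of_pos (by positivity) _
  calc ‖f x‖ * Real.exp (c * ‖x‖)
      ≤ ‖f x‖ * (K * Real.exp (‖x‖ * ‖y‖) / (1 + ‖x‖ + ‖y‖) ^ d) := by
        gcongr
        exact (le_div_iff₀ hpos).2 (hKexp _ (norm_nonneg x))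
    _ = K / A * (‖f x‖ * A * Real.exp (‖x‖ * ‖y‖) / (1 + ‖x‖ + ‖y‖) ^ d) := by field_simp
    _ = _ := by rw [hA]; ring

theorem hasExpMoments_of_lintegral_density_lt_top [NeZero n] (hf : Measurable f)
    (hg : Measurable g) (hQ : Q ≠ 0) (hfin : ∫⁻ x, ∫⁻ y, density f g Q d δ x y < ⊤)
    (hne : ∀ᵐ y, g y ≠ 0) : HasExpMoments volume f norm where
  measurable := hf
  measurable_phase := measurable_norm
  integrable_mul_exp c := by
    have hopen : IsOpen {y : EuclideanSpace ℝ (Fin n) | c < ‖y‖} :=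
      isOpen_lt continuous_const continuous_norm
    have hfar : ∃ᶠ y : EuclideanSpace ℝ (Fin n) in ae volume, c < ‖y‖ :=
      frequently_ae_mem_iff.2 (hopen.measure_pos _ (NormedSpace.exists_lt_norm ℝ _ c)).ne'
    obtain ⟨y, hcy, hy, hgy, hQy⟩ := (hfar.and_eventually
      ((ae_lintegral_density_lt_top hf hg hfin).and (hne.and (ae_polyValue_ne_zero hQ)))).exists
    simpa only [abs_norm] using
      integrable_mul_exp_of_lintegral_density_lt_top hf hy hgy hQy hcy

theorem frequently_l2Fourier_ne_zero (hf : MemLp f 2 volume) (hne : ¬ f =ᵐ[volume] 0) :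
    ∃ᶠ y in ae volume, l2Fourier f hf y ≠ 0 := by
  intro h
  refine hne (ae_eq_of_l2Fourier_ae_eq hf (MemLp.zero' (p := 2)) ?_)
  filter_upwards [h, l2Fourier_ae_eq (n := n) (MemLp.zero' (p := 2)) (integrable_zero _ _ _)]
    with y hy hy0
  rw [not_not.1 hy]
  exact (hy0.trans (by simp [fourierInt])).symm

/-- One frequency at which the inner integral is finite and `f̂` does not vanish already gives an
exponential moment of `f`; hence `f̂` is analytic and vanishes almost nowhere. -/
theorem integrable_and_ae_fourierInt_ne_zero [NeZero n] (hf : Measurable f)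
    (hf2 : MemLp f 2 volume) (hQ : Q ≠ 0)
    (hfin : ∫⁻ x, ∫⁻ y, density f (l2Fourier f hf2) Q d δ x y < ⊤) (hne : ¬ f =ᵐ[volume] 0) :
    Integrable f ∧ ∀ᵐ y, fourierInt f y ≠ 0 := by
  have hfm := hf.aestronglyMeasurable (μ := (volume : Measure (EuclideanSpace ℝ (Fin n))))
  have hfreq := frequently_l2Fourier_ne_zero hf2 hne
  obtain ⟨y, hgy, hy, hQy, hy0⟩ := (hfreq.and_eventually
    ((ae_lintegral_density_lt_top hf (measurable_l2Fourier hf2) hfin).and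
      ((ae_polyValue_ne_zero hQ).and (compl_mem_ae_iff.2 (measure_singleton 0))))).exists
  have hynorm : 0 < ‖y‖ := norm_pos_iff.2 hy0
  have hexp := integrable_mul_exp_of_lintegral_density_lt_top hf hy hgy hQy (half_lt_self hynorm)
  have hint := integrable_of_integrable_mul_exp hfm (half_pos hynorm).le hexp
  obtain ⟨p, hp, hp_eq⟩ := (hfreq.and_eventually (l2Fourier_ae_eq hf2 hint)).exists
  exact ⟨hint, ae_fourierInt_ne_zero hfm (half_pos hynorm) hexp (hp_eq ▸ hp)⟩

end Density

section LineIntegral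

theorem one_le_one_add_pow_mul_rpow {u : ℝ} (hu : 1 ≤ u) (e : ℝ) :
    1 ≤ (1 + u) ^ ⌈|e|⌉₊ * u ^ e := by
  have hu0 : 0 < u := zero_lt_one.trans_le hu
  calc (1 : ℝ) ≤ u ^ (|e| + e) :=
        Real.one_le_rpow hu (by linarith [neg_abs_le e])
    _ = u ^ |e| * u ^ e := Real.rpow_add hu0 _ _
    _ ≤ (1 + u) ^ ⌈|e|⌉₊ * u ^ e := by
        gcongr
        refine (rpow_le_pow_ceil hu |e|).trans ?_
        gcongr
        exact le_add_of_nonneg_left zero_le_one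

variable {E : Type*} [NormedAddCommGroup E] [NormedSpace ℝ E] {v : E} {c e q r : ℝ}

theorem one_add_norm_add_norm_smul_le (hv : v ≠ 0) (x : E) (r : ℝ) :
    1 + ‖x‖ + ‖r • v‖ ≤ (1 + 1 / ‖v‖ + ‖v‖) * ((1 + ‖v‖ * ‖x‖) * (1 + |r|)) := by
  rw [norm_smul, Real.norm_eq_abs, ← sub_nonneg]
  have hexpand : (1 + 1 / ‖v‖ + ‖v‖) * ((1 + ‖v‖ * ‖x‖) * (1 + |r|)) - (1 + ‖x‖ + |r| * ‖v‖) =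
      1 / ‖v‖ + ‖v‖ + ‖v‖ * ‖x‖ + ‖v‖ ^ 2 * ‖x‖ +
        |r| * (1 + 1 / ‖v‖ + ‖v‖ * ‖x‖ + ‖x‖ + ‖v‖ ^ 2 * ‖x‖) := by
    field_simp
    ring
  rw [hexpand]
  positivity

/-- Here `q` stands for `‖polyValue Q (r • v)‖ ^ δ`. -/
theorem weight_le_mul_of_one_le_abs (hv : v ≠ 0) (hc : 0 < c) (hr : 1 ≤ |r|)
    (hq : c * |r| ^ e ≤ q) (d : ℝ) (j : ℕ) (x : E) :
    weight (⌈d⌉₊ + ⌈|e|⌉₊ + 2) (⌈d⌉₊ + ⌈|e|⌉₊ + 2) (‖v‖ * ‖x‖) r ≤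
      (1 + 1 / ‖v‖ + ‖v‖) ^ ⌈d⌉₊ / c * (Real.exp (‖x‖ * ‖r • v‖) * q / (1 + ‖x‖ + ‖r • v‖) ^ d *
        (|r| ^ j * (1 + r ^ 2)⁻¹)) := by
  set D := ⌈d⌉₊ + ⌈|e|⌉₊ + 2 with hD
  set κ := 1 + 1 / ‖v‖ + ‖v‖
  set T := 1 + ‖v‖ * ‖x‖
  set S := 1 + ‖x‖ + ‖r • v‖
  have hT : 1 ≤ T := le_add_of_nonneg_right (by positivity)
  have hS : 1 ≤ S := le_add_of_le_of_nonneg (le_add_of_nonneg_right (norm_nonneg x))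
    (norm_nonneg _)
  have hSd : 0 < S ^ d := Real.rpow_pos_of_pos (by positivity) d
  have hpoly : 1 ≤ (1 + |r|) ^ ⌈|e|⌉₊ * (q / c) :=
    (one_le_one_add_pow_mul_rpow hr e).trans (by gcongr; exact (le_div_iff₀' hc).2 hq)
  have hspace : 1 ≤ κ ^ ⌈d⌉₊ * (T ^ ⌈d⌉₊ * (1 + |r|) ^ ⌈d⌉₊) / S ^ d := by
    rw [one_le_div hSd, ← mul_pow, ← mul_pow]
    refine (rpow_le_pow_ceil hS d).trans ?_
    gcongr
    exact one_add_norm_add_norm_smul_le hv x r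
  have hline : 1 ≤ (1 + |r|) ^ 2 * (|r| ^ j * (1 + r ^ 2)⁻¹) := by
    rw [← mul_assoc, ← div_eq_mul_inv, one_le_div (by positivity), ← sq_abs r]
    exact le_trans (by nlinarith) (le_mul_of_one_le_right (by positivity) (one_le_pow₀ hr))
  calc weight D D (‖v‖ * ‖x‖) r
      ≤ weight D D (‖v‖ * ‖x‖) r * ((1 + |r|) ^ ⌈|e|⌉₊ * (q / c) *
        (κ ^ ⌈d⌉₊ * (T ^ ⌈d⌉₊ * (1 + |r|) ^ ⌈d⌉₊) / S ^ d) *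
          ((1 + |r|) ^ 2 * (|r| ^ j * (1 + r ^ 2)⁻¹))) :=
        le_mul_of_one_le_right (weight_nonneg _ _ _ _)
          (one_le_mul_of_one_le_of_one_le (one_le_mul_of_one_le_of_one_le hpoly hspace) hline)
    _ = κ ^ ⌈d⌉₊ / c * (Real.exp (‖x‖ * ‖r • v‖) * q / S ^ d * (|r| ^ j * (1 + r ^ 2)⁻¹)) *
        (T ^ ⌈d⌉₊ / T ^ D) := by
        rw [weight, abs_of_nonneg (by positivity : 0 ≤ ‖v‖ * ‖x‖), norm_smul, Real.norm_eq_abs,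
          show ‖v‖ * ‖x‖ * |r| = ‖x‖ * (|r| * ‖v‖) by ring, hD]
        field_simp
        ring
    _ ≤ _ := by
        refine mul_le_of_le_one_right ?_ ((div_le_one (by positivity)).2
          (pow_le_pow_right₀ hT (by omega)))
        have hq0 : 0 ≤ q := le_trans (by positivity) hq
        positivity

variable {n : ℕ} {f g : EuclideanSpace ℝ (Fin n) → ℂ} {Q : MvPolynomial (Fin n) ℂ} {d δ : ℝ}

theorem doubleIntegral_line_lt_top (h : HasExpMoments volume f norm) {A : ℝ}
    (hg : ∀ y, ‖g y‖ ≤ A) {v : EuclideanSpace ℝ (Fin n)} (hv : v ≠ 0)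
    (hlead : polyValue (MvPolynomial.homogeneousComponent Q.totalDegree Q) v ≠ 0) {j : ℕ}
    (hfin : ∫⁻ r : ℝ, (∫⁻ x, density f g Q d δ x (r • v)) * lineDensity j r < ⊤) :
    doubleIntegral volume f (fun x ↦ ‖v‖ * ‖x‖) (fun r ↦ g (r • v))
      (⌈d⌉₊ + ⌈|Q.totalDegree * δ|⌉₊ + 2) (⌈d⌉₊ + ⌈|Q.totalDegree * δ|⌉₊ + 2) < ⊤ := by
  obtain ⟨c, ρ, S, hc, hρ, -, hcS⟩ := exists_mul_rpow_le_norm_polyValue_smul_rpow δ hlead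
  set K := (1 + 1 / ‖v‖ + ‖v‖) ^ ⌈d⌉₊ / c
  have hphase : HasExpMoments volume f fun x ↦ ‖v‖ * ‖x‖ :=
    h.of_le (C := ‖v‖) h.measurable (by fun_prop) (fun _ ↦ le_rfl) fun x ↦ by
      rw [abs_mul, abs_norm]
  refine doubleIntegral_lt_top_of_tail hphase (fun r ↦ hg _) (max S 1) ?_
  refine lt_of_le_of_lt ?_ (ENNReal.mul_lt_top (ENNReal.ofReal_lt_top (r := K)) hfin)
  rw [← lintegral_const_mul' _ _ ENNReal.ofReal_ne_top]
  refine (setLIntegral_mono' measurableSet_Ioo.compl fun r hr ↦ ?_).trans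
    (setLIntegral_le_lintegral _ _)
  have hr_max : max S 1 ≤ |r| := not_lt.1 fun hlt ↦ hr (abs_lt.1 hlt)
  rw [lineDensity, ← lintegral_mul_const' _ _ ENNReal.ofReal_ne_top,
    ← lintegral_const_mul' _ _ ENNReal.ofReal_ne_top]
  refine lintegral_mono fun x ↦ ?_
  rw [density, ← ofReal_norm, ← ofReal_norm, ← ENNReal.ofReal_mul (by positivity),
    ← ENNReal.ofReal_mul (by positivity), ← ENNReal.ofReal_mul (by positivity),
    ← ENNReal.ofReal_mul (by positivity)]
  refine ENNReal.ofReal_le_ofReal ?_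
  calc ‖f x‖ * ‖g (r • v)‖ * weight _ _ (‖v‖ * ‖x‖) r ≤ ‖f x‖ * ‖g (r • v)‖ *
        (K * (Real.exp (‖x‖ * ‖r • v‖) * ‖polyValue Q (r • v)‖ ^ δ / (1 + ‖x‖ + ‖r • v‖) ^ d *
          (|r| ^ j * (1 + r ^ 2)⁻¹))) := by
        gcongr
        exact weight_le_mul_of_one_le_abs hv hc ((le_max_right _ _).trans hr_max)
          (hcS r ((le_max_left _ _).trans hr_max) v (mem_ball_self hρ)) d j x
    _ = _ := by ring

theorem exists_ae_doubleIntegral_line_lt_top [NeZero n] (h : HasExpMoments volume f norm)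
    (hQ : Q ≠ 0) (hfin : ∫⁻ x, ∫⁻ y, density f (fourierInt f) Q d δ x y < ⊤) :
    ∃ D : ℕ, ∀ᵐ v, doubleIntegral volume f (fun x ↦ ‖v‖ * ‖x‖)
      (fun r ↦ fourierInt f (r • v)) D D < ⊤ := by
  have hF := (continuous_fourierInt h.integrable).measurable
  rw [lintegral_density_comm h.measurable hF] at hfin
  refine ⟨⌈d⌉₊ + ⌈|Q.totalDegree * δ|⌉₊ + 2, ?_⟩
  filter_upwards [ae_lintegral_smul_lt_top
      (Measurable.lintegral_prod_left' (measurable_density h.measurable hF)) hfin,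
    ae_polyValue_ne_zero (homogeneousComponent_totalDegree_ne_zero hQ),
    compl_mem_ae_iff.2 (measure_singleton 0)] with v hvfin hlead hv
  exact doubleIntegral_line_lt_top h (norm_fourierInt_le f) hv hlead hvfin

end LineIntegral

/-! ### The common Gaussian factor -/

section Moment

variable {X : Type*} [MeasurableSpace X] {μ : Measure X} {f : X → ℂ} {t τ : X → ℝ} {G : ℝ → ℂ}
  {P P' : Polynomial ℂ} {a b : ℂ} {D : ℕ} {r R β : ℝ}

theorem norm_exp_mul_ofReal_sq (a : ℂ) (r : ℝ) : ‖exp (a * r ^ 2)‖ = Real.exp (a.re * r ^ 2) := by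
  rw [norm_exp, ← ofReal_pow, re_mul_ofReal]

theorem exists_mul_exp_le_norm_eval_mul_gaussian (hP : P ≠ 0) (a : ℂ) :
    ∃ c C : ℝ, 0 < c ∧ ∀ᶠ R : ℝ in atTop, ∀ r ∈ Icc (R + 1) (R + 2),
      c * Real.exp (a.re * R ^ 2 - C * R) ≤ ‖P.eval (r : ℂ) * exp (a * r ^ 2)‖ := by
  obtain ⟨c, R₀, hc, hcP⟩ := exists_le_norm_eval hP
  refine ⟨c, 8 * |a.re|, hc, ?_⟩
  filter_upwards [eventually_ge_atTop 1, eventually_ge_atTop R₀] with R hR1 hR0 r ⟨hr1, hr2⟩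
  rw [norm_mul, norm_exp_mul_ofReal_sq]
  gcongr
  · refine hcP _ ?_
    rw [norm_real, Real.norm_of_nonneg (by linarith)]
    linarith
  · have hlow : 0 ≤ r ^ 2 - R ^ 2 := by nlinarith
    have hupp : r ^ 2 - R ^ 2 ≤ 8 * R := by nlinarith
    nlinarith [neg_abs_le a.re, abs_nonneg a.re]

theorem exp_mul_abs_le_mul_weight (hR : 0 ≤ R) (hr : r ∈ Icc (R + 1) (R + 2)) (D : ℕ) (s : ℝ) :
    Real.exp (R * |s|) ≤ D.factorial ^ 2 * Real.exp (4 + R) * weight D D s r := by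
  have hr0 : 0 ≤ r := by linarith [hr.1]
  have hpow {u : ℝ} (hu : 0 ≤ u) : u ^ D ≤ D.factorial * Real.exp u := by
    have htaylor := Real.pow_div_factorial_le_exp u hu D
    rwa [div_le_iff₀ (by positivity), mul_comm] at htaylor
  have hs : (1 + |s|) ^ D ≤ D.factorial * Real.exp (1 + |s|) := hpow (by positivity)
  have hr' : (1 + r) ^ D ≤ D.factorial * Real.exp (3 + R) := by
    refine (hpow (by positivity)).trans ?_
    gcongr ?_ * Real.exp ?_
    linarith [hr.2]
  have hexp : Real.exp (R * |s|) * Real.exp (1 + |s|) * Real.exp (3 + R) =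
      Real.exp (4 + R) * Real.exp (|s| * (R + 1)) := by
    simp only [← Real.exp_add]
    ring_nf
  rw [weight, abs_of_nonneg hr0, ← mul_div_assoc, le_div_iff₀ (by positivity)]
  calc Real.exp (R * |s|) * ((1 + |s|) ^ D * (1 + r) ^ D)
      ≤ Real.exp (R * |s|) *
        (D.factorial * Real.exp (1 + |s|) * (D.factorial * Real.exp (3 + R))) := by gcongr
    _ = D.factorial ^ 2 * Real.exp (4 + R) * Real.exp (|s| * (R + 1)) := by
        linear_combination (D.factorial : ℝ) ^ 2 * hexp
    _ ≤ _ := by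
        gcongr
        exact hr.1

theorem ofReal_mul_expMoment_le_doubleIntegral (h : HasExpMoments μ f t) (hβ : 0 ≤ β)
    (hG : ∀ r ∈ Icc (R + 1) (R + 2), ∀ s, β * Real.exp (R * |s|) ≤ ‖G r‖ * weight D D s r) :
    ENNReal.ofReal (β * expMoment μ f t R) ≤ doubleIntegral μ f t G D D := by
  calc ENNReal.ofReal (β * expMoment μ f t R)
      = ∫⁻ _ in Icc (R + 1) (R + 2), ENNReal.ofReal (β * expMoment μ f t R) := by
        rw [setLIntegral_const, Real.volume_Icc]
        norm_num
    _ ≤ ∫⁻ r in Icc (R + 1) (R + 2),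
        ∫⁻ x, ‖f x‖ₑ * ‖G r‖ₑ * ENNReal.ofReal (weight D D (t x) r) ∂μ := by
        refine setLIntegral_mono' measurableSet_Icc fun r hr ↦ ?_
        rw [ENNReal.ofReal_mul hβ, h.ofReal_expMoment,
          ← lintegral_const_mul' _ _ ENNReal.ofReal_ne_top]
        refine lintegral_mono fun x ↦ ?_
        rw [← ENNReal.ofReal_mul hβ, ← ofReal_norm, ← ofReal_norm,
          ← ENNReal.ofReal_mul (by positivity), ← ENNReal.ofReal_mul (by positivity),
          mul_left_comm, mul_assoc]
        exact ENNReal.ofReal_le_ofReal (mul_le_mul_of_nonneg_left (hG r hr _) (norm_nonneg _))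
    _ ≤ _ := setLIntegral_le_lintegral _ _

theorem exists_expMoment_le (h : HasExpMoments μ f t) (hP : P ≠ 0)
    (hfin : doubleIntegral μ f t (fun r ↦ P.eval (r : ℂ) * exp (a * r ^ 2)) D D < ⊤) :
    ∃ C : ℝ, ∀ᶠ R : ℝ in atTop, expMoment μ f t R ≤ Real.exp (-a.re * R ^ 2 + C * R) := by
  obtain ⟨c, C, hc, hcC⟩ := exists_mul_exp_le_norm_eval_mul_gaussian hP a
  set J := (doubleIntegral μ f t (fun r ↦ P.eval (r : ℂ) * exp (a * r ^ 2)) D D).toReal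
  set K := J * D.factorial ^ 2 * Real.exp 4 / c with hK
  have hK0 : 0 ≤ K := by positivity
  refine ⟨K + C + 1, ?_⟩
  filter_upwards [hcC, eventually_ge_atTop 1] with R hRC hR
  set β := c * Real.exp (a.re * R ^ 2 - C * R) / (D.factorial ^ 2 * Real.exp (4 + R)) with hβ
  have hβ0 : 0 < β := by positivity
  have hβm : β * expMoment μ f t R ≤ J := by
    refine (ENNReal.ofReal_le_iff_le_toReal hfin.ne).1
      (ofReal_mul_expMoment_le_doubleIntegral h hβ0.le fun r hr s ↦ ?_)
    calc β * Real.exp (R * |s|)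
        ≤ β * (D.factorial ^ 2 * Real.exp (4 + R) * weight D D s r) := by
          gcongr
          exact exp_mul_abs_le_mul_weight (by linarith) hr D s
      _ = c * Real.exp (a.re * R ^ 2 - C * R) * weight D D s r := by
          rw [hβ]
          field_simp
      _ ≤ _ := mul_le_mul_of_nonneg_right (hRC r hr) (weight_nonneg _ _ _ _)
  have hKR : K ≤ Real.exp (K * R) := by
    nlinarith [Real.add_one_le_exp (K * R)]
  calc expMoment μ f t R ≤ J / β := (le_div_iff₀' hβ0).2 hβm
    _ = K * Real.exp (-a.re * R ^ 2 + (C + 1) * R) := by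
        rw [hK, hβ, Real.exp_add 4,
          show -a.re * R ^ 2 + (C + 1) * R = R - (a.re * R ^ 2 - C * R) by ring, Real.exp_sub R]
        field_simp
    _ ≤ Real.exp (K * R) * Real.exp (-a.re * R ^ 2 + (C + 1) * R) := by gcongr
    _ = _ := by
        rw [← Real.exp_add]
        ring_nf

theorem le_of_eventually_mul_exp_sq_le {c A B C : ℝ} (hc : 0 < c)
    (h : ∀ᶠ R : ℝ in atTop, c * Real.exp (A * R ^ 2) ≤ Real.exp (B * R ^ 2 + C * R)) : A ≤ B := by
  by_contra! hAB
  have hlim : Tendsto (fun R : ℝ ↦ R * ((A - B) * R - C)) atTop atTop :=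
    tendsto_id.atTop_mul_atTop₀ (tendsto_atTop_add_const_right _ _
      (tendsto_id.const_mul_atTop (sub_pos.2 hAB)))
  obtain ⟨R, hR, hRlog⟩ := (h.and (hlim.eventually_gt_atTop (-Real.log c))).exists
  rw [← Real.exp_log hc, ← Real.exp_add, Real.exp_le_exp] at hR
  nlinarith

/-- The finite double integral for the phase `τ` limits the growth of the transform with any
smaller phase `t` along the ray through `u`. -/
theorem re_mul_sq_le_of_laplace_eq (ht : HasExpMoments μ f t) (hτ : HasExpMoments μ f τ) {k : ℝ}
    (hk : 0 < k) (htτ : ∀ x, |t x| ≤ k * |τ x|) (hP : P ≠ 0) (hP' : P' ≠ 0)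
    (hfin : doubleIntegral μ f τ (fun r ↦ P.eval (r : ℂ) * exp (a * r ^ 2)) D D < ⊤)
    (hb : ∀ z, laplace μ f t z = P'.eval z * exp (b * z ^ 2)) {u : ℂ} (hu : 0 < u.im) :
    (b * u ^ 2).re ≤ -a.re * (u.im * k) ^ 2 := by
  obtain ⟨C, hC⟩ := exists_expMoment_le hτ hP hfin
  obtain ⟨c, R₀, hc, hcP⟩ := exists_le_norm_eval hP'
  have hu0 : 0 < ‖u‖ := hu.trans_le (im_le_norm u)
  refine le_of_eventually_mul_exp_sq_le (C := C * (u.im * k)) hc ?_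
  filter_upwards [(tendsto_id.atTop_mul_const (mul_pos hu hk)).eventually hC,
    eventually_gt_atTop 0, (tendsto_id.atTop_mul_const hu0).eventually_ge_atTop R₀]
    with R hRC hR hR0
  have hre : (b * (R * u) ^ 2).re = (b * u ^ 2).re * R ^ 2 := by
    rw [← re_mul_ofReal]
    congr 1
    push_cast
    ring
  have him : |((R : ℂ) * u).im| = R * u.im := by rw [im_ofReal_mul, abs_of_pos (by positivity)]
  have hmoment : expMoment μ f t (R * u.im) ≤ expMoment μ f τ (R * (u.im * k)) :=
    integral_mono (ht.integrable_mul_exp _) (hτ.integrable_mul_exp _) fun x ↦ by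
      dsimp only
      gcongr ‖f x‖ * Real.exp ?_
      rw [← mul_assoc, mul_assoc _ k]
      gcongr
      exact htτ x
  calc c * Real.exp ((b * u ^ 2).re * R ^ 2)
      ≤ ‖P'.eval (R * u)‖ * Real.exp ((b * u ^ 2).re * R ^ 2) := by
        gcongr
        refine hcP _ ?_
        rwa [norm_mul, norm_real, Real.norm_of_nonneg hR.le]
    _ = ‖laplace μ f t (R * u)‖ := by rw [hb, norm_mul, norm_exp, hre]
    _ ≤ expMoment μ f t (R * u.im) := him ▸ norm_laplace_le ht (R * u)
    _ ≤ Real.exp (-a.re * (R * (u.im * k)) ^ 2 + C * (R * (u.im * k))) := hmoment.trans hRC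
    _ = _ := by ring_nf

theorem im_eq_zero_of_forall_re_le (h : ∀ x : ℝ, (a * (x + I) ^ 2).re ≤ -a.re) : a.im = 0 := by
  have hquad (x : ℝ) : x ^ 2 * a.re ≤ 2 * x * a.im := by
    have hx := h x
    simp only [pow_two, mul_re, add_re, ofReal_re, I_re, add_zero, add_im, ofReal_im, I_im,
      zero_add, mul_one, mul_im, one_mul] at hx
    nlinarith
  by_contra hne
  have hsmall : Tendsto (fun k : ℝ ↦ k * a.re) (𝓝[>] 0) (𝓝 (0 * a.re)) :=
    (tendsto_id.mul_const a.re).mono_left nhdsWithin_le_nhds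
  rw [zero_mul] at hsmall
  obtain ⟨k, hk, hk0⟩ :=
    ((hsmall.eventually_const_lt (show (-2 : ℝ) < 0 by norm_num)).and self_mem_nhdsWithin).exists
  have hsq : 0 < a.im ^ 2 := by positivity
  have hk' := hquad (-(k * a.im))
  have hk0' : 0 < k := hk0
  nlinarith [mul_pos hk0' hsq]

end Moment

section Lines

variable {n : ℕ} {f : EuclideanSpace ℝ (Fin n) → ℂ} {D : ℕ} {v w : EuclideanSpace ℝ (Fin n)}
  {P P' : Polynomial ℂ} {a b : ℂ}

/-- On the line through `v` the transform of `f` is `P(z) e^{a z²}`, in the coordinate `z` for which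
`z v` is the point of the line, and it satisfies the radial one-dimensional condition. -/
structure IsGaussianLine (f : EuclideanSpace ℝ (Fin n) → ℂ) (D : ℕ) (v : EuclideanSpace ℝ (Fin n))
    (P : Polynomial ℂ) (a : ℂ) : Prop where
  ne_zero : v ≠ 0
  polynomial_ne_zero : P ≠ 0
  laplace_eq : ∀ z, laplace volume f (fun x ↦ ⟪v, x⟫) z = P.eval z * exp (a * z ^ 2)
  doubleIntegral_lt_top : doubleIntegral volume f (fun x ↦ ‖v‖ * ‖x‖)
    (fun r ↦ P.eval (r : ℂ) * exp (a * r ^ 2)) D D < ⊤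

theorem ae_exists_isGaussianLine [NeZero n] (h : HasExpMoments volume f norm)
    (hne : ∀ᵐ y, fourierInt f y ≠ 0)
    (hfin : ∀ᵐ v, doubleIntegral volume f (fun x ↦ ‖v‖ * ‖x‖) (fun r ↦ fourierInt f (r • v))
      D D < ⊤) :
    ∀ᵐ v, ∃ P : Polynomial ℂ, P.natDegree ≤ 3 * D + 1 ∧ ∃ a, IsGaussianLine f D v P a := by
  filter_upwards [hfin, hne, compl_mem_ae_iff.2 (measure_singleton 0)] with v hvfin hvne hv0
  have hline : doubleIntegral volume f (fun x ↦ ⟪v, x⟫)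
      (fun r ↦ laplace volume f (fun x ↦ ⟪v, x⟫) r) D D < ⊤ := by
    simp_rw [← fourierInt_smul f v]
    refine doubleIntegral_lt_top_of_abs_le (h.inner_left v) (fun r ↦ norm_fourierInt_le f _)
      (fun x ↦ ?_) hvfin
    rw [abs_mul, abs_norm, abs_norm]
    exact abs_real_inner_le_norm v x
  obtain ⟨P, a, hdeg, hP⟩ := isPolynomialMulGaussian_laplace (h.inner_left v) hline
  refine ⟨P, hdeg, a, hv0, ?_, hP, by simpa only [fourierInt_smul, hP] using hvfin⟩
  rintro rfl
  refine hvne ?_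
  rw [← one_smul ℝ v, fourierInt_smul, hP, Polynomial.eval_zero, zero_mul]

theorem tendsto_fourierInt_smul (f : EuclideanSpace ℝ (Fin n) → ℂ) (hv : v ≠ 0) :
    Tendsto (fun r : ℝ ↦ fourierInt f (r • v)) atTop (𝓝 0) := by
  simp_rw [fourierInt_eq_fourier]
  refine (tendsto_integral_exp_inner_smul_cocompact f).comp ?_
  rw [← cobounded_eq_cocompact, ← tendsto_norm_atTop_iff_cobounded]
  simp_rw [norm_smul, ← mul_assoc]
  exact ((tendsto_norm_atTop_atTop.const_mul_atTop
    (norm_pos_iff.2 (by positivity))).atTop_mul_const (norm_pos_iff.2 hv))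

namespace IsGaussianLine

theorem re_mul_sq_le (hv : IsGaussianLine f D v P a) (hw : IsGaussianLine f D w P' b)
    (h : HasExpMoments volume f norm) {u : ℂ} (hu : 0 < u.im) :
    (b * u ^ 2).re ≤ -a.re * (u.im * (‖w‖ / ‖v‖)) ^ 2 := by
  have hv0 : 0 < ‖v‖ := norm_pos_iff.2 hv.ne_zero
  have hτ : HasExpMoments volume f fun x ↦ ‖v‖ * ‖x‖ :=
    h.of_le (C := ‖v‖) h.measurable (by fun_prop) (fun _ ↦ le_rfl) fun x ↦ by
      rw [abs_mul, abs_norm]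
  refine re_mul_sq_le_of_laplace_eq (h.inner_left w) hτ (div_pos (norm_pos_iff.2 hw.ne_zero) hv0)
    (fun x ↦ ?_) hv.polynomial_ne_zero hw.polynomial_ne_zero hv.doubleIntegral_lt_top
    hw.laplace_eq hu
  rw [abs_mul, abs_norm, abs_norm, ← mul_assoc, div_mul_cancel₀ _ hv0.ne']
  exact abs_real_inner_le_norm w x

theorem im_eq_zero (hv : IsGaussianLine f D v P a) (h : HasExpMoments volume f norm) :
    a.im = 0 :=
  im_eq_zero_of_forall_re_le fun x ↦ by
    simpa [norm_ne_zero_iff.2 hv.ne_zero] using hv.re_mul_sq_le hv h (u := x + I) (by simp)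

theorem re_div_sq_le (hv : IsGaussianLine f D v P a) (hw : IsGaussianLine f D w P' b)
    (h : HasExpMoments volume f norm) : a.re / ‖v‖ ^ 2 ≤ b.re / ‖w‖ ^ 2 := by
  have hw0 : 0 < ‖w‖ := norm_pos_iff.2 hw.ne_zero
  have hI := hv.re_mul_sq_le hw h (u := I) (by simp)
  rw [I_sq, mul_neg_one, neg_re, I_im, one_mul, neg_mul, neg_le_neg_iff, div_pow] at hI
  rw [le_div_iff₀ (by positivity)]
  exact le_of_eq_of_le (by ring) hI

theorem fourierInt_smul_eq (hv : IsGaussianLine f D v P a) (h : HasExpMoments volume f norm)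
    (r : ℝ) :
    fourierInt f (r • v) = P.eval (r : ℂ) * Real.exp (a.re / ‖v‖ ^ 2 * ‖r • v‖ ^ 2) := by
  have hv0 : ‖v‖ ≠ 0 := norm_ne_zero_iff.2 hv.ne_zero
  have ha : a = (a.re : ℂ) := Complex.ext rfl (by rw [hv.im_eq_zero h, ofReal_im])
  have hexp : a.re / ‖v‖ ^ 2 * ‖r • v‖ ^ 2 = a.re * r ^ 2 := by
    rw [norm_smul, mul_pow, Real.norm_eq_abs, sq_abs]
    field_simp
  rw [fourierInt_smul, hv.laplace_eq, hexp, ha]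
  push_cast
  rfl

/-- Otherwise the transform would not tend to zero along the line. -/
theorem re_neg (hv : IsGaussianLine f D v P a) (h : HasExpMoments volume f norm) : a.re < 0 := by
  by_contra! ha
  obtain ⟨c, R₀, hc, hcP⟩ := exists_le_norm_eval hv.polynomial_ne_zero
  have hlim := (tendsto_fourierInt_smul f hv.ne_zero).norm
  rw [norm_zero] at hlim
  obtain ⟨r, hrc, hr⟩ :=
    ((hlim.eventually_lt_const hc).and (eventually_ge_atTop (max R₀ 0))).exists
  have hP : c ≤ ‖P.eval (r : ℂ)‖ := hcP r <| by
    rw [norm_real, Real.norm_of_nonneg ((le_max_right _ _).trans hr)]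
    exact (le_max_left _ _).trans hr
  refine hrc.not_ge (hP.trans ?_)
  rw [hv.fourierInt_smul_eq h, norm_mul, norm_real, Real.norm_of_nonneg (Real.exp_pos _).le]
  exact le_mul_of_one_le_right (norm_nonneg _) (Real.one_le_exp (by positivity))

end IsGaussianLine

theorem exists_ae_fourierInt_smul_eq [NeZero n] (h : HasExpMoments volume f norm)
    (hne : ∀ᵐ y, fourierInt f y ≠ 0)
    (hfin : ∀ᵐ v, doubleIntegral volume f (fun x ↦ ‖v‖ * ‖x‖) (fun r ↦ fourierInt f (r • v))
      D D < ⊤) :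
    ∃ a : ℝ, 0 < a ∧ ∀ᵐ v, ∃ P : Polynomial ℂ, P.natDegree ≤ 3 * D + 1 ∧
      ∀ r : ℝ, fourierInt f (r • v) = P.eval (r : ℂ) * Real.exp (-a * ‖r • v‖ ^ 2) := by
  have hlines := ae_exists_isGaussianLine h hne hfin
  obtain ⟨v, P₀, -, a, hv⟩ := hlines.exists
  refine ⟨-(a.re / ‖v‖ ^ 2), neg_pos.2 (div_neg_of_neg_of_pos (hv.re_neg h)
    (pow_pos (norm_pos_iff.2 hv.ne_zero) 2)), ?_⟩
  filter_upwards [hlines] with w ⟨P, hdeg, b, hw⟩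
  refine ⟨P, hdeg, fun r ↦ ?_⟩
  rw [hw.fourierInt_smul_eq h, neg_neg, le_antisymm (hv.re_div_sq_le hw h) (hw.re_div_sq_le hv h)]

end Lines

/-! ### Functions that are polynomial on almost every line -/

section Taylor

theorem iteratedDeriv_eval_ofReal (p : Polynomial ℂ) (k : ℕ) :
    iteratedDeriv k (fun r : ℝ ↦ p.eval (r : ℂ)) =
      fun r : ℝ ↦ ((Polynomial.derivative^[k]) p).eval (r : ℂ) := by
  induction k with
  | zero => simp
  | succ k ih =>
    rw [iteratedDeriv_succ, ih, Function.iterate_succ_apply']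
    ext r
    exact (((Polynomial.derivative^[k]) p).hasDerivAt (r : ℂ)).comp_ofReal.deriv

theorem iteratedDeriv_eval_ofReal_zero (p : Polynomial ℂ) (k : ℕ) :
    iteratedDeriv k (fun r : ℝ ↦ p.eval (r : ℂ)) 0 = k.factorial * p.coeff k := by
  rw [iteratedDeriv_eval_ofReal]
  dsimp only
  rw [ofReal_zero, ← Polynomial.coeff_zero_eq_eval_zero, Polynomial.coeff_iterate_derivative,
    zero_add, Nat.descFactorial_self, nsmul_eq_mul]

theorem iteratedFDeriv_zero_diagonal_eq_iteratedDeriv {E F : Type*} [NormedAddCommGroup E]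
    [NormedSpace ℝ E] [NormedAddCommGroup F] [NormedSpace ℝ F] {h : E → F} {N : WithTop ℕ∞} {k : ℕ}
    (hh : ContDiff ℝ N h) (hk : k ≤ N) (v : E) :
    iteratedFDeriv ℝ k h 0 (fun _ ↦ v) = iteratedDeriv k (fun r : ℝ ↦ h (r • v)) 0 := by
  have hcomp := (ContinuousLinearMap.toSpanSingleton ℝ v).iteratedFDeriv_comp_right hh 0 hk
  have hline : h ∘ ContinuousLinearMap.toSpanSingleton ℝ v = fun r : ℝ ↦ h (r • v) := rfl
  rw [iteratedDeriv_eq_iteratedFDeriv, ← hline, hcomp,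
    ContinuousMultilinearMap.compContinuousLinearMap_apply, map_zero]
  simp only [ContinuousLinearMap.toSpanSingleton_apply, one_smul]

variable {n : ℕ}

theorem exists_polyValue_eq_diagonal {k : ℕ}
    (T : ContinuousMultilinearMap ℝ (fun _ : Fin k ↦ EuclideanSpace ℝ (Fin n)) ℂ) :
    ∃ H : MvPolynomial (Fin n) ℂ, ∀ v, T (fun _ ↦ v) = polyValue H v := by
  set e := EuclideanSpace.basisFun (Fin n) ℝ
  refine ⟨∑ s : Fin k → Fin n, MvPolynomial.C (T fun j ↦ e (s j)) * ∏ j, MvPolynomial.X (s j),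
    fun v ↦ ?_⟩
  have hv : (fun _ : Fin k ↦ v) = fun _ ↦ ∑ i, v i • e i :=
    funext fun _ ↦ (e.sum_repr v).symm
  conv_lhs => rw [hv]
  rw [T.map_sum, polyValue, map_sum]
  refine Finset.sum_congr rfl fun s _ ↦ ?_
  rw [T.map_smul_univ, map_mul, map_prod, MvPolynomial.eval_C, mul_comm, real_smul]
  simp

theorem exists_eq_polyValue_of_lines {h : EuclideanSpace ℝ (Fin n) → ℂ} {N : ℕ}
    (hh : ContDiff ℝ N h) (hlines : ∀ᵐ v, ∃ P : Polynomial ℂ, P.natDegree ≤ N ∧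
      ∀ r : ℝ, h (r • v) = P.eval (r : ℂ)) :
    ∃ H : MvPolynomial (Fin n) ℂ, ∀ v, h v = polyValue H v := by
  choose H hH using fun k : ℕ ↦ exists_polyValue_eq_diagonal (iteratedFDeriv ℝ k h 0)
  -- The Taylor polynomial at the origin agrees with `h` on each line on which `h` is polynomial.
  set G : MvPolynomial (Fin n) ℂ :=
    ∑ k ∈ Finset.range (N + 1), MvPolynomial.C ((k.factorial : ℂ)⁻¹) * H k with hG
  suffices hae : h =ᵐ[volume] polyValue G from
    ⟨G, congrFun (Measure.eq_of_ae_eq hae hh.continuous (continuous_polyValue G))⟩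
  filter_upwards [hlines] with v ⟨P, hPd, hP⟩
  have hcoeff : ∀ k ≤ N, polyValue (H k) v = k.factorial * P.coeff k := fun k hk ↦ by
    rw [← hH, iteratedFDeriv_zero_diagonal_eq_iteratedDeriv hh (by exact_mod_cast hk), funext hP,
      iteratedDeriv_eval_ofReal_zero]
  have hv := hP 1
  rw [one_smul, ofReal_one, Polynomial.eval_eq_sum_range' (Nat.lt_succ_of_le hPd)] at hv
  rw [hv, hG, polyValue, map_sum]
  refine Finset.sum_congr rfl fun k hk ↦ ?_
  have hHk := hcoeff k (Nat.lt_succ_iff.1 (Finset.mem_range.1 hk))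
  rw [polyValue] at hHk
  rw [map_mul, MvPolynomial.eval_C, hHk, one_pow, mul_one,
    inv_mul_cancel_left₀ (Nat.cast_ne_zero.2 k.factorial_ne_zero)]

end Taylor

section PolynomialGaussian

theorem HasExpMoments.integrable_abs_pow_mul {X : Type*} [MeasurableSpace X] {μ : Measure X}
    {f : X → ℂ} {t : X → ℝ} (h : HasExpMoments μ f t) (k : ℕ) :
    Integrable (fun x ↦ |t x| ^ k * ‖f x‖) μ := by
  have hf := h.measurable
  have ht := h.measurable_phase
  refine ((h.integrable_mul_exp 1).const_mul (k.factorial : ℝ)).mono'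
    (Measurable.aestronglyMeasurable (by fun_prop)) (Eventually.of_forall fun x ↦ ?_)
  have hpow := Real.pow_div_factorial_le_exp |t x| (abs_nonneg _) k
  rw [div_le_iff₀ (by positivity)] at hpow
  rw [Real.norm_of_nonneg (by positivity), one_mul]
  calc |t x| ^ k * ‖f x‖ ≤ Real.exp |t x| * k.factorial * ‖f x‖ := by gcongr
    _ = _ := by ring

theorem contDiff_fourierInt {E : Type*} [NormedAddCommGroup E] [InnerProductSpace ℝ E]
    [FiniteDimensional ℝ E] [MeasurableSpace E] [BorelSpace E] {f : E → ℂ}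
    (h : HasExpMoments volume f norm) (N : ℕ) : ContDiff ℝ N (fourierInt f) := by
  have hsmooth : ContDiff ℝ N (𝓕 f) := by
    have := Real.contDiff_fourier (N := N) fun k _ ↦ by
      simpa only [abs_norm] using h.integrable_abs_pow_mul k
    exact_mod_cast this
  rw [funext (fourierInt_eq_fourier f)]
  exact hsmooth.comp (contDiff_const_smul _)

variable {n : ℕ} {f : EuclideanSpace ℝ (Fin n) → ℂ}

theorem exists_fourierInt_eq_polyValue_mul [NeZero n] (h : HasExpMoments volume f norm)
    (hne : ∀ᵐ y, fourierInt f y ≠ 0) {D : ℕ}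
    (hfin : ∀ᵐ v, doubleIntegral volume f (fun x ↦ ‖v‖ * ‖x‖) (fun r ↦ fourierInt f (r • v))
      D D < ⊤) :
    ∃ (a : ℝ) (H : MvPolynomial (Fin n) ℂ), 0 < a ∧
      ∀ y, fourierInt f y = polyValue H y * Real.exp (-a * ‖y‖ ^ 2) := by
  obtain ⟨a, ha, hlines⟩ := exists_ae_fourierInt_smul_eq h hne hfin
  have hcancel : ∀ y : EuclideanSpace ℝ (Fin n),
      ((Real.exp (a * ‖y‖ ^ 2) : ℝ) : ℂ) * (Real.exp (-a * ‖y‖ ^ 2) : ℝ) = 1 := fun y ↦ by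
    rw [← ofReal_mul, ← Real.exp_add, neg_mul, add_neg_cancel, Real.exp_zero, ofReal_one]
  have hsmooth : ContDiff ℝ (3 * D + 1 : ℕ)
      fun y ↦ fourierInt f y * (Real.exp (a * ‖y‖ ^ 2) : ℝ) :=
    (contDiff_fourierInt h _).mul
      (ofRealCLM.contDiff.comp (Real.contDiff_exp.comp (contDiff_const.mul (contDiff_norm_sq ℝ))))
  obtain ⟨H, hH⟩ := exists_eq_polyValue_of_lines hsmooth <| hlines.mono fun v ⟨P, hPd, hP⟩ ↦
    ⟨P, hPd, fun r ↦ by rw [hP, mul_assoc, mul_comm (Complex.ofReal _), hcancel, mul_one]⟩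
  refine ⟨a, H, ha, fun y ↦ ?_⟩
  rw [← hH, mul_assoc, hcancel, mul_one]

end PolynomialGaussian

/-! ### Fourier integrals of polynomials times Gaussians -/

section Polynomial

theorem totalDegree_pderiv_le {σ R : Type*} [CommSemiring R] (i : σ) (P : MvPolynomial σ R) :
    (MvPolynomial.pderiv i P).totalDegree ≤ P.totalDegree := by
  conv_lhs => rw [P.as_sum, map_sum]
  refine MvPolynomial.totalDegree_finsetSum_le fun s hs ↦ ?_
  rw [MvPolynomial.pderiv_monomial]
  exact (MvPolynomial.totalDegree_monomial_le _ _).trans <|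
    (Finsupp.degree_mono tsub_le_self).trans (MvPolynomial.le_totalDegree hs)

variable {n : ℕ}

theorem exists_norm_polyValue_le (P : MvPolynomial (Fin n) ℂ) :
    ∃ (K : ℝ) (N : ℕ), 0 ≤ K ∧ ∀ x, ‖polyValue P x‖ ≤ K * (1 + ‖x‖) ^ N := by
  induction P using MvPolynomial.induction_on with
  | C c => exact ⟨‖c‖, 0, norm_nonneg _, fun x ↦ by simp [polyValue]⟩
  | add p q hp hq =>
    obtain ⟨K, N, hK, hpK⟩ := hp
    obtain ⟨L, M, hL, hqL⟩ := hq
    refine ⟨K + L, max N M, by positivity, fun x ↦ ?_⟩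
    have hx : 1 ≤ 1 + ‖x‖ := le_add_of_nonneg_right (norm_nonneg x)
    rw [polyValue, map_add]
    calc _ ≤ _ := norm_add_le _ _
      _ ≤ K * (1 + ‖x‖) ^ N + L * (1 + ‖x‖) ^ M := add_le_add (hpK x) (hqL x)
      _ ≤ K * (1 + ‖x‖) ^ max N M + L * (1 + ‖x‖) ^ max N M := by
          gcongr
          · exact le_max_left _ _
          · exact le_max_right _ _
      _ = _ := (add_mul _ _ _).symm
  | mul_X p i hp =>
    obtain ⟨K, N, hK, hpK⟩ := hp
    refine ⟨K, N + 1, hK, fun x ↦ ?_⟩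
    rw [polyValue, map_mul, MvPolynomial.eval_X, norm_mul, pow_succ, ← mul_assoc, norm_real]
    gcongr
    · exact hpK x
    · exact (PiLp.norm_apply_le x i).trans (le_add_of_nonneg_left zero_le_one)

theorem hasDerivAt_coord_line (i j : Fin n) (x : EuclideanSpace ℝ (Fin n)) :
    HasDerivAt (fun r : ℝ ↦ (((x + r • EuclideanSpace.single i (1 : ℝ)) j : ℝ) : ℂ))
      ((Pi.single i 1 : Fin n → ℂ) j) 0 := by
  set u : ℝ := (Pi.single i 1 : Fin n → ℝ) j with hu
  have hline : HasDerivAt (fun r : ℝ ↦ x j + r * u) u 0 := by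
    simpa using ((hasDerivAt_id (0 : ℝ)).mul_const u).const_add (x j)
  convert! hline.ofReal_comp using 1
  rcases eq_or_ne j i with rfl | hij
  · simp [hu]
  · simp [hu, hij]

theorem hasDerivAt_polyValue_line (P : MvPolynomial (Fin n) ℂ) (i : Fin n)
    (x : EuclideanSpace ℝ (Fin n)) :
    HasDerivAt (fun r : ℝ ↦ polyValue P (x + r • EuclideanSpace.single i 1))
      (polyValue (MvPolynomial.pderiv i P) x) 0 := by
  induction P using MvPolynomial.induction_on with
  | C c => simpa [polyValue] using hasDerivAt_const (0 : ℝ) c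
  | add p q hp hq =>
    simp only [polyValue, map_add] at hp hq ⊢
    exact hp.add hq
  | mul_X p j hp =>
    have hmul := hp.mul (hasDerivAt_coord_line i j x)
    simp only [polyValue, map_mul, MvPolynomial.eval_X, Derivation.leibniz, smul_eq_mul, map_add,
      MvPolynomial.pderiv_X] at hmul ⊢
    convert! hmul using 1
    rcases eq_or_ne j i with rfl | hij
    · simp [mul_comm, add_comm]
    · simp [hij, mul_comm]

theorem exists_polyValue_smul (P : MvPolynomial (Fin n) ℂ) (c : ℝ) :
    ∃ P' : MvPolynomial (Fin n) ℂ, P'.totalDegree ≤ P.totalDegree ∧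
      ∀ x, polyValue P' x = polyValue P (c • x) := by
  refine ⟨∑ k ∈ Finset.range (P.totalDegree + 1), MvPolynomial.C ((c : ℂ) ^ k) *
    MvPolynomial.homogeneousComponent k P, MvPolynomial.totalDegree_finsetSum_le fun k hk ↦ ?_,
    fun x ↦ ?_⟩
  · refine (MvPolynomial.totalDegree_mul _ _).trans ?_
    rw [MvPolynomial.totalDegree_C, zero_add]
    exact (MvPolynomial.homogeneousComponent_isHomogeneous k P).totalDegree_le.trans
      (Nat.lt_succ_iff.1 (Finset.mem_range.1 hk))
  · conv_rhs => rw [← P.sum_homogeneousComponent]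
    rw [polyValue, polyValue, map_sum, map_sum]
    refine Finset.sum_congr rfl fun k _ ↦ ?_
    rw [map_mul, MvPolynomial.eval_C]
    exact (polyValue_smul_of_isHomogeneous
      (MvPolynomial.homogeneousComponent_isHomogeneous k P) c x).symm

end Polynomial

section PolyGauss

variable {n : ℕ} {b : ℝ}

/-- A polynomial times the Gaussian `e^{-b|x|²}`. -/
noncomputable def polyGauss (b : ℝ) (P : MvPolynomial (Fin n) ℂ) (x : EuclideanSpace ℝ (Fin n)) :
    ℂ :=
  polyValue P x * (Real.exp (-b * ‖x‖ ^ 2) : ℂ)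

theorem polyGauss_sum (b : ℝ) {ι : Type*} (s : Finset ι) (P : ι → MvPolynomial (Fin n) ℂ)
    (x : EuclideanSpace ℝ (Fin n)) :
    polyGauss b (∑ k ∈ s, P k) x = ∑ k ∈ s, polyGauss b (P k) x := by
  simp only [polyGauss, polyValue, map_sum, Finset.sum_mul]

theorem polyGauss_C_mul (b : ℝ) (c : ℂ) (P : MvPolynomial (Fin n) ℂ)
    (x : EuclideanSpace ℝ (Fin n)) :
    polyGauss b (MvPolynomial.C c * P) x = c * polyGauss b P x := by
  rw [polyGauss, polyGauss, polyValue, map_mul, MvPolynomial.eval_C, polyValue, mul_assoc]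

theorem exists_polyGauss_smul (b c : ℝ) (P : MvPolynomial (Fin n) ℂ) :
    ∃ P' : MvPolynomial (Fin n) ℂ, P'.totalDegree ≤ P.totalDegree ∧
      ∀ x, polyGauss b P (c • x) = polyGauss (b * c ^ 2) P' x := by
  obtain ⟨P', hdeg, hP'⟩ := exists_polyValue_smul P c
  refine ⟨P', hdeg, fun x ↦ ?_⟩
  rw [polyGauss, polyGauss, hP', norm_smul, mul_pow, Real.norm_eq_abs, sq_abs, ← mul_assoc,
    ← neg_mul]

theorem continuous_polyGauss (b : ℝ) (P : MvPolynomial (Fin n) ℂ) : Continuous (polyGauss b P) := by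
  have := continuous_polyValue P
  unfold polyGauss
  fun_prop

theorem norm_polyGauss (b : ℝ) (P : MvPolynomial (Fin n) ℂ) (x : EuclideanSpace ℝ (Fin n)) :
    ‖polyGauss b P x‖ = ‖polyValue P x‖ * Real.exp (-b * ‖x‖ ^ 2) := by
  rw [polyGauss, norm_mul, norm_real, Real.norm_of_nonneg (Real.exp_pos _).le]

theorem integrable_exp_neg_mul_norm_sq {E : Type*} [NormedAddCommGroup E] [InnerProductSpace ℝ E]
    [FiniteDimensional ℝ E] [MeasurableSpace E] [BorelSpace E] (hb : 0 < b) :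
    Integrable fun x : E ↦ Real.exp (-b * ‖x‖ ^ 2) := by
  have h := (GaussianFourier.integrable_cexp_neg_mul_sq_norm_add (V := E)
    (b := (b : ℂ)) (by simpa) 0 0).norm
  refine h.congr (Eventually.of_forall fun x ↦ ?_)
  dsimp only
  rw [norm_exp, zero_mul, add_zero, ← ofReal_neg, ← ofReal_pow, ← ofReal_mul, ofReal_re]

theorem mul_le_sq_div_add_mul_sq (hb : 0 < b) (κ u : ℝ) :
    κ * u ≤ κ ^ 2 / (2 * b) + b / 2 * u ^ 2 := by
  have hsq : κ ^ 2 / (2 * b) + b / 2 * u ^ 2 - κ * u = (κ - b * u) ^ 2 / (2 * b) := by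
    field_simp
    ring
  have hnonneg : 0 ≤ (κ - b * u) ^ 2 / (2 * b) := by positivity
  linarith

theorem exists_norm_polyGauss_mul_exp_le (hb : 0 < b) (P : MvPolynomial (Fin n) ℂ) (c : ℝ) :
    ∃ A, ∀ x, ‖polyGauss b P x‖ * Real.exp (c * ‖x‖) ≤ A * Real.exp (-(b / 2) * ‖x‖ ^ 2) := by
  obtain ⟨K, N, hK, hP⟩ := exists_norm_polyValue_le P
  set κ := c + 1 with hκ
  refine ⟨K * N.factorial * Real.exp (1 + κ ^ 2 / (2 * b)), fun x ↦ ?_⟩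
  have hpow : (1 + ‖x‖) ^ N ≤ N.factorial * Real.exp (1 + ‖x‖) := by
    have := Real.pow_div_factorial_le_exp (1 + ‖x‖) (by positivity) N
    rwa [div_le_iff₀ (by positivity), mul_comm] at this
  have hamgm := mul_le_sq_div_add_mul_sq hb κ ‖x‖
  rw [norm_polyGauss]
  calc ‖polyValue P x‖ * Real.exp (-b * ‖x‖ ^ 2) * Real.exp (c * ‖x‖)
      ≤ K * (N.factorial * Real.exp (1 + ‖x‖)) * Real.exp (-b * ‖x‖ ^ 2) *
        Real.exp (c * ‖x‖) := by
        gcongr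
        exact (hP x).trans (by gcongr)
    _ = K * N.factorial * Real.exp (1 + κ * ‖x‖ - b * ‖x‖ ^ 2) := by
        have hexp : Real.exp (1 + κ * ‖x‖ - b * ‖x‖ ^ 2) =
            Real.exp (1 + ‖x‖) * Real.exp (-b * ‖x‖ ^ 2) * Real.exp (c * ‖x‖) := by
          rw [← Real.exp_add, ← Real.exp_add, hκ]
          ring_nf
        rw [hexp]
        ring
    _ ≤ K * N.factorial * Real.exp (1 + κ ^ 2 / (2 * b) + -(b / 2) * ‖x‖ ^ 2) := by
        gcongr
        linarith
    _ = _ := by rw [Real.exp_add (1 + κ ^ 2 / (2 * b)), ← mul_assoc]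

theorem hasExpMoments_polyGauss (hb : 0 < b) (P : MvPolynomial (Fin n) ℂ) :
    HasExpMoments volume (polyGauss b P) norm := by
  have hc := continuous_polyGauss b P
  refine ⟨hc.measurable, measurable_norm, fun c ↦ ?_⟩
  obtain ⟨A, hA⟩ := exists_norm_polyGauss_mul_exp_le hb P c
  refine ((integrable_exp_neg_mul_norm_sq (half_pos hb)).const_mul A).mono'
    (Continuous.aestronglyMeasurable (by fun_prop)) (Eventually.of_forall fun x ↦ ?_)
  rw [Real.norm_of_nonneg (by positivity), abs_norm]
  exact hA x

theorem memLp_polyGauss (hb : 0 < b) (P : MvPolynomial (Fin n) ℂ) :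
    MemLp (polyGauss b P) 2 volume := by
  rw [memLp_two_iff_integrable_sq_norm (continuous_polyGauss b P).aestronglyMeasurable]
  refine (hasExpMoments_polyGauss (mul_pos two_pos hb) (P * P)).integrable.norm.congr
    (Eventually.of_forall fun x ↦ ?_)
  dsimp only
  rw [norm_polyGauss, norm_polyGauss, polyValue, map_mul, norm_mul, mul_pow, ← Real.exp_nat_mul,
    polyValue]
  push_cast
  ring_nf

/-- The polynomial part of the `i`-th partial derivative of `P e^{-b|x|²}`. -/
noncomputable def gaussianPDeriv (b : ℝ) (i : Fin n) (P : MvPolynomial (Fin n) ℂ) :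
    MvPolynomial (Fin n) ℂ :=
  MvPolynomial.pderiv i P - MvPolynomial.C (2 * b : ℂ) * (MvPolynomial.X i * P)

theorem totalDegree_gaussianPDeriv_le (b : ℝ) (i : Fin n) (P : MvPolynomial (Fin n) ℂ) :
    (gaussianPDeriv b i P).totalDegree ≤ P.totalDegree + 1 := by
  refine (MvPolynomial.totalDegree_sub _ _).trans (max_le ?_ ?_)
  · exact (totalDegree_pderiv_le i P).trans (Nat.le_succ _)
  · have hCX := MvPolynomial.totalDegree_mul (MvPolynomial.C (2 * b : ℂ)) (MvPolynomial.X i * P)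
    have hX := MvPolynomial.totalDegree_mul (MvPolynomial.X i) P
    rw [MvPolynomial.totalDegree_C] at hCX
    rw [MvPolynomial.totalDegree_X] at hX
    omega

theorem hasDerivAt_polyGauss_line (b : ℝ) (P : MvPolynomial (Fin n) ℂ) (i : Fin n)
    (x : EuclideanSpace ℝ (Fin n)) :
    HasDerivAt (fun r : ℝ ↦ polyGauss b P (x + r • EuclideanSpace.single i 1))
      (polyGauss b (gaussianPDeriv b i P) x) 0 := by
  have hline : HasDerivAt (fun r : ℝ ↦ x + r • EuclideanSpace.single i (1 : ℝ))
      (EuclideanSpace.single i (1 : ℝ)) 0 := by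
    simpa using ((hasDerivAt_id (0 : ℝ)).smul_const (EuclideanSpace.single i (1 : ℝ))).const_add x
  have hphase : HasDerivAt (fun r : ℝ ↦ -b * ‖x + r • EuclideanSpace.single i (1 : ℝ)‖ ^ 2)
      (-b * (2 * x i)) 0 := by
    simpa [EuclideanSpace.inner_single_right] using hline.norm_sq.const_mul (-b)
  convert! (hasDerivAt_polyValue_line P i x).mul hphase.exp.ofReal_comp using 1
  simp only [polyGauss, polyValue, gaussianPDeriv, map_sub, map_mul, MvPolynomial.eval_C,
    MvPolynomial.eval_X, ofReal_exp, ofReal_neg, ofReal_mul, ofReal_pow, zero_smul, add_zero,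
    ofReal_ofNat]
  ring

end PolyGauss

section FourierPolyGauss

theorem integrable_mul_exp_neg_I_inner {E : Type*} [NormedAddCommGroup E] [InnerProductSpace ℝ E]
    [FiniteDimensional ℝ E] [MeasurableSpace E] [BorelSpace E] {g : E → ℂ} (hg : Integrable g)
    (y : E) : Integrable fun x ↦ g x * exp (-(I * (⟪y, x⟫ : ℝ))) :=
  hg.norm.mono' (hg.aestronglyMeasurable.mul (Measurable.aestronglyMeasurable (by fun_prop)))
    (Eventually.of_forall fun x ↦ by simp [norm_exp])

theorem hasDerivAt_fourierInt_line {E : Type*} [NormedAddCommGroup E] [InnerProductSpace ℝ E]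
    [FiniteDimensional ℝ E] [MeasurableSpace E] [BorelSpace E] {g : E → ℂ} (hg : Integrable g)
    (hg' : Integrable fun x ↦ ‖x‖ * ‖g x‖) (y v : E) :
    HasDerivAt (fun r : ℝ ↦ fourierInt g (y + r • v))
      (-I * fourierInt (fun x ↦ (⟪v, x⟫ : ℝ) * g x) y) 0 := by
  have hline : HasDerivAt (fun r : ℝ ↦ (2 * π)⁻¹ • (y + r • v)) ((2 * π)⁻¹ • v) 0 := by
    have hid : HasDerivAt (fun r : ℝ ↦ y + r • v) v 0 := by
      simpa using ((hasDerivAt_id (0 : ℝ)).smul_const v).const_add y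
    exact hid.const_smul (2 * π)⁻¹
  have hsmul : Integrable (VectorFourier.fourierSMulRight (innerSL ℝ (E := E)) g) :=
    (hg'.const_mul (2 * π * ‖innerSL ℝ (E := E)‖)).mono'
      hg.aestronglyMeasurable.fourierSMulRight (Eventually.of_forall fun x ↦ by
        simpa only [mul_assoc] using VectorFourier.norm_fourierSMulRight_le (innerSL ℝ) g x)
  have hderiv := (Real.hasFDerivAt_fourier hg hg' ((2 * π)⁻¹ • (y + (0 : ℝ) • v))).comp_hasDerivAt
    (0 : ℝ) hline
  rw [Real.fourier_continuousLinearMap_apply hsmul, zero_smul, add_zero,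
    ← fourierInt_eq_fourier] at hderiv
  simp only [Function.comp_def, ← fourierInt_eq_fourier] at hderiv
  convert! hderiv using 1
  rw [fourierInt, fourierInt, ← integral_const_mul]
  refine integral_congr_ae (Eventually.of_forall fun x ↦ ?_)
  dsimp only
  rw [VectorFourier.fourierSMulRight_apply, innerSL_apply_apply, real_inner_smul_right,
    real_inner_comm, smul_eq_mul, real_smul]
  have := ofReal_ne_zero.2 Real.pi_ne_zero
  push_cast
  field_simp

variable {n : ℕ} {b : ℝ}

theorem fourierInt_polyGauss_C (hb : 0 < b) (c : ℂ) (y : EuclideanSpace ℝ (Fin n)) :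
    fourierInt (polyGauss b (MvPolynomial.C c)) y =
      polyGauss (1 / (4 * b)) (MvPolynomial.C (c * (π / b : ℂ) ^ (n / 2 : ℂ))) y := by
  have hgauss := fourier_gaussian_innerProductSpace (V := EuclideanSpace ℝ (Fin n)) (b := (b : ℂ))
    (by simpa) ((2 * π)⁻¹ • y)
  rw [← fourierInt_eq_fourier, finrank_euclideanSpace_fin] at hgauss
  have hconst : fourierInt (polyGauss b (MvPolynomial.C c : MvPolynomial (Fin n) ℂ)) y =
      c * fourierInt (fun v : EuclideanSpace ℝ (Fin n) ↦ cexp (-b * ‖v‖ ^ 2)) y := by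
    rw [fourierInt, fourierInt, ← integral_const_mul]
    congr 1 with x
    rw [polyGauss, polyValue, MvPolynomial.eval_C, mul_assoc]
    push_cast
    rfl
  rw [hconst, hgauss, polyGauss, polyValue, MvPolynomial.eval_C, mul_assoc, ofReal_exp, norm_smul]
  congr 3
  have : (b : ℂ) ≠ 0 := ofReal_ne_zero.2 hb.ne'
  have : (π : ℂ) ≠ 0 := ofReal_ne_zero.2 Real.pi_ne_zero
  rw [Real.norm_of_nonneg (by positivity)]
  push_cast
  field_simp
  ring

theorem fourierInt_polyGauss_mul_X (hb : 0 < b) {b' : ℝ} {P P' : MvPolynomial (Fin n) ℂ}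
    (hP : ∀ y, fourierInt (polyGauss b P) y = polyGauss b' P' y) (i : Fin n)
    (y : EuclideanSpace ℝ (Fin n)) :
    fourierInt (polyGauss b (P * MvPolynomial.X i)) y =
      polyGauss b' (MvPolynomial.C I * gaussianPDeriv b' i P') y := by
  have hmom := hasExpMoments_polyGauss hb P
  have hfourier := hasDerivAt_fourierInt_line hmom.integrable
    (by simpa using hmom.integrable_abs_pow_mul 1) y (EuclideanSpace.single i 1)
  simp only [hP] at hfourier
  have hX : (fun x : EuclideanSpace ℝ (Fin n) ↦
      ((⟪EuclideanSpace.single i (1 : ℝ), x⟫ : ℝ) : ℂ) * polyGauss b P x) =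
      polyGauss b (P * MvPolynomial.X i) := by
    ext x
    simp only [polyGauss, polyValue, map_mul, MvPolynomial.eval_X,
      EuclideanSpace.inner_single_left, map_one, one_mul]
    ring
  rw [polyGauss_C_mul, ← hfourier.unique (hasDerivAt_polyGauss_line b' P' i y), hX, ← mul_assoc,
    mul_neg, I_mul_I, neg_neg, one_mul]

theorem exists_fourierInt_polyGauss_monomial (hb : 0 < b) (s : Fin n →₀ ℕ) (c : ℂ) :
    ∃ P' : MvPolynomial (Fin n) ℂ, P'.totalDegree ≤ (MvPolynomial.monomial s c).totalDegree ∧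
      ∀ y, fourierInt (polyGauss b (MvPolynomial.monomial s c)) y =
        polyGauss (1 / (4 * b)) P' y := by
  revert s c
  refine MvPolynomial.induction_on_monomial (fun c ↦ ?_) (fun p i ↦ ?_)
  · exact ⟨_, by simp only [MvPolynomial.totalDegree_C, le_refl], fourierInt_polyGauss_C hb c⟩
  · rintro ⟨P', hdeg, hP'⟩
    rcases eq_or_ne p 0 with rfl | hp0
    · exact ⟨0, by simp, fun y ↦ by simp [fourierInt, polyGauss, polyValue]⟩
    refine ⟨_, ?_, fourierInt_polyGauss_mul_X hb hP' i⟩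
    rw [MvPolynomial.totalDegree_mul_of_isDomain hp0 (MvPolynomial.X_ne_zero i),
      MvPolynomial.totalDegree_X]
    refine (MvPolynomial.totalDegree_mul _ _).trans ?_
    rw [MvPolynomial.totalDegree_C, zero_add]
    exact (totalDegree_gaussianPDeriv_le _ i P').trans (by gcongr)

theorem exists_fourierInt_polyGauss (hb : 0 < b) (P : MvPolynomial (Fin n) ℂ) :
    ∃ P' : MvPolynomial (Fin n) ℂ, P'.totalDegree ≤ P.totalDegree ∧
      ∀ y, fourierInt (polyGauss b P) y = polyGauss (1 / (4 * b)) P' y := by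
  choose R hdeg hR using exists_fourierInt_polyGauss_monomial (n := n) hb
  refine ⟨∑ s ∈ P.support, R s (P.coeff s), MvPolynomial.totalDegree_finsetSum_le fun s hs ↦
    (hdeg _ _).trans ((MvPolynomial.totalDegree_monomial_le _ _).trans
      (MvPolynomial.le_totalDegree hs)), fun y ↦ ?_⟩
  simp only [polyGauss_sum, ← hR, fourierInt]
  rw [← integral_finsetSum _ fun s _ ↦
    integrable_mul_exp_neg_I_inner (hasExpMoments_polyGauss hb _).integrable y]
  congr 1 with x
  conv_lhs => rw [P.as_sum, polyGauss_sum, Finset.sum_mul]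

theorem exists_fourier_polyGauss (hb : 0 < b) (P : MvPolynomial (Fin n) ℂ) :
    ∃ P' : MvPolynomial (Fin n) ℂ, P'.totalDegree ≤ P.totalDegree ∧
      𝓕 (polyGauss b P) = polyGauss (π ^ 2 / b) P' := by
  obtain ⟨P₀, hdeg₀, hP₀⟩ := exists_fourierInt_polyGauss hb P
  obtain ⟨P', hdeg, hP'⟩ := exists_polyGauss_smul (1 / (4 * b)) (2 * π) P₀
  refine ⟨P', hdeg.trans hdeg₀, funext fun w ↦ ?_⟩
  rw [fourier_eq_fourierInt, hP₀, hP']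
  congr 1
  field_simp
  norm_num

theorem exists_fourierInv_polyGauss (hb : 0 < b) (P : MvPolynomial (Fin n) ℂ) :
    ∃ P' : MvPolynomial (Fin n) ℂ, P'.totalDegree ≤ P.totalDegree ∧
      𝓕⁻ (polyGauss b P) = polyGauss (π ^ 2 / b) P' := by
  obtain ⟨P₀, hdeg₀, hP₀⟩ := exists_fourier_polyGauss hb P
  obtain ⟨P', hdeg, hP'⟩ := exists_polyGauss_smul (π ^ 2 / b) (-1) P₀
  refine ⟨P', hdeg.trans hdeg₀, funext fun x ↦ ?_⟩
  rw [Real.fourierInv_eq_fourier_neg, hP₀, ← neg_one_smul ℝ x, hP', neg_one_sq, mul_one]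

theorem ae_eq_of_fourierInt_eq {f g : EuclideanSpace ℝ (Fin n) → ℂ} (hf : Integrable f)
    (hf2 : MemLp f 2 volume) (hg : Integrable g) (hg2 : MemLp g 2 volume)
    (h : ∀ y, fourierInt f y = fourierInt g y) : f =ᵐ[volume] g := by
  refine ae_eq_of_l2Fourier_ae_eq hf2 hg2 ?_
  filter_upwards [l2Fourier_ae_eq hf2 hf, l2Fourier_ae_eq hg2 hg] with y hfy hgy
  rw [hfy, hgy, h]

theorem exists_ae_eq_polyGauss {f : EuclideanSpace ℝ (Fin n) → ℂ} (hf : Integrable f)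
    (hf2 : MemLp f 2 volume) {a : ℝ} (ha : 0 < a) {H : MvPolynomial (Fin n) ℂ}
    (hH : ∀ y, fourierInt f y = polyGauss a H y) :
    ∃ P : MvPolynomial (Fin n) ℂ, P.totalDegree ≤ H.totalDegree ∧
      f =ᵐ[volume] polyGauss (1 / (4 * a)) P := by
  obtain ⟨H', hdegH, hH'⟩ := exists_polyGauss_smul a (2 * π) H
  have ha' : 0 < a * (2 * π) ^ 2 := by positivity
  have hF : 𝓕 f = polyGauss (a * (2 * π) ^ 2) H' := by
    ext w
    rw [fourier_eq_fourierInt, hH, hH']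
  obtain ⟨P, hdegP, hinv⟩ := exists_fourierInv_polyGauss ha' H'
  obtain ⟨P₁, -, hfourier⟩ := exists_fourier_polyGauss ha' H'
  have hfactor : π ^ 2 / (a * (2 * π) ^ 2) = 1 / (4 * a) := by
    field_simp
    norm_num
  rw [hfactor] at hinv hfourier
  have ha4 : 0 < 1 / (4 * a) := by positivity
  have hinversion : 𝓕 (polyGauss (1 / (4 * a)) P) = 𝓕 f := by
    rw [hF, ← hinv]
    refine Continuous.fourier_fourierInv_eq (continuous_polyGauss _ H')
      (hasExpMoments_polyGauss ha' H').integrable ?_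
    rw [hfourier]
    exact (hasExpMoments_polyGauss ha4 P₁).integrable
  refine ⟨P, hdegP.trans hdegH, ae_eq_of_fourierInt_eq hf hf2
    (hasExpMoments_polyGauss ha4 P).integrable (memLp_polyGauss ha4 P) fun y ↦ ?_⟩
  rw [fourierInt_eq_fourier, fourierInt_eq_fourier, hinversion]

end FourierPolyGauss

/-! ### The degree bound -/

section NearRay

variable {E : Type*} [NormedAddCommGroup E]

/-- The triples `(s, w, u)` with `s` large, `w` near `θ` and `|u| < 1`; they parametrize the pairs
`y = s w`, `x = 2 a y + u` for which `|x||y| - |x|² / (4a) - a|y|²` stays bounded. -/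
def nearRay (θ : E) : Filter (ℝ × E × E) := atTop ×ˢ 𝓝 θ ×ˢ 𝓟 (ball 0 1)

theorem tendsto_fst_nearRay (θ : E) : Tendsto Prod.fst (nearRay θ) atTop := tendsto_fst

theorem tendsto_direction_nearRay (θ : E) : Tendsto (fun p ↦ p.2.1) (nearRay θ) (𝓝 θ) :=
  tendsto_fst.comp tendsto_snd

theorem eventually_norm_lt_one_nearRay (θ : E) : ∀ᶠ p in nearRay θ, ‖p.2.2‖ < 1 := by
  have h : Tendsto (fun p : ℝ × E × E ↦ p.2.2) (nearRay θ) (𝓟 (ball 0 1)) :=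
    tendsto_snd.comp tendsto_snd
  filter_upwards [h (mem_principal_self _)] with p hp
  simpa using hp

theorem tendsto_inv_fst_nearRay (θ : E) : Tendsto (fun p ↦ p.1⁻¹) (nearRay θ) (𝓝 0) :=
  tendsto_inv_atTop_zero.comp (tendsto_fst_nearRay θ)

variable [NormedSpace ℝ E]

/-- The rescaled point `x / s`, where `x = 2 a s w + u` and `p = (s, w, u)`. -/
noncomputable def rescaledPoint (a : ℝ) (p : ℝ × E × E) : E := (2 * a) • p.2.1 + p.1⁻¹ • p.2.2

theorem smul_rescaledPoint (a : ℝ) {p : ℝ × E × E} (hp : p.1 ≠ 0) :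
    p.1 • rescaledPoint a p = (2 * a) • p.1 • p.2.1 + p.2.2 := by
  rw [rescaledPoint, smul_add, smul_inv_smul₀ hp, smul_comm]

theorem tendsto_rescaledPoint_nearRay (a : ℝ) (θ : E) :
    Tendsto (rescaledPoint a) (nearRay θ) (𝓝 ((2 * a) • θ)) := by
  have hsmul : Tendsto (fun p ↦ p.1⁻¹ • p.2.2) (nearRay θ) (𝓝 0) :=
    (tendsto_inv_fst_nearRay θ).zero_smul_isBoundedUnder_le
      (isBoundedUnder_of_eventually_le ((eventually_norm_lt_one_nearRay θ).mono fun _ ↦ le_of_lt))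
  rw [← add_zero ((2 * a) • θ)]
  exact ((tendsto_direction_nearRay θ).const_smul (2 * a)).add hsmul

theorem exists_eventually_rpow_le_nearRay (a : ℝ) {θ : E} (hθ : θ ≠ 0) (d : ℝ) :
    ∃ M, 0 < M ∧ ∀ᶠ p in nearRay θ,
      (1 + ‖p.1 • rescaledPoint a p‖ + ‖p.1 • p.2.1‖) ^ d ≤ M * p.1 ^ d := by
  set R := 0 + ‖(2 * a) • θ‖ + ‖θ‖
  have hR : 0 < R := by positivity
  have hlim : Tendsto (fun p ↦ (p.1⁻¹ + ‖rescaledPoint a p‖ + ‖p.2.1‖) ^ d) (nearRay θ)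
      (𝓝 (R ^ d)) :=
    (((tendsto_inv_fst_nearRay θ).add (tendsto_rescaledPoint_nearRay a θ).norm).add
      (tendsto_direction_nearRay θ).norm).rpow_const (Or.inl hR.ne')
  refine ⟨R ^ d + 1, by positivity, ?_⟩
  filter_upwards [hlim.eventually_le_const (lt_add_one _),
    (tendsto_fst_nearRay θ).eventually_gt_atTop 0] with p hp hs
  have hscale : 1 + ‖p.1 • rescaledPoint a p‖ + ‖p.1 • p.2.1‖ =
      (p.1⁻¹ + ‖rescaledPoint a p‖ + ‖p.2.1‖) * p.1 := by
    rw [norm_smul, norm_smul, Real.norm_of_nonneg hs.le]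
    field_simp
  rw [hscale, Real.mul_rpow (by positivity) hs.le]
  gcongr

theorem exists_forall_mem_ball_of_eventually_nearRay {a R : ℝ} (hR : 0 < R) {θ : E}
    {p : ℝ → E → E → Prop} (h : ∀ᶠ q in nearRay θ, p q.1 (q.1 • rescaledPoint a q) (q.1 • q.2.1)) :
    ∃ ρ, 0 < ρ ∧ ρ < R ∧ ∀ᶠ s : ℝ in atTop, ∀ y ∈ ball (s • θ) (s * ρ),
      ∀ x ∈ ball ((2 * a) • y) 1, p s x y := by
  obtain ⟨large, hlarge, near, hnear, himp⟩ := eventually_prod_iff.1 h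
  obtain ⟨direction, hdirection, unit, hunit, hnear⟩ := eventually_prod_iff.1 hnear
  obtain ⟨ρ₀, hρ₀, hball⟩ := Metric.eventually_nhds_iff_ball.1 hdirection
  obtain ⟨ρ, hρ, hρlt⟩ := exists_between (lt_min hρ₀ hR)
  obtain ⟨hρρ₀, hρR⟩ := lt_min_iff.1 hρlt
  refine ⟨ρ, hρ, hρR, ?_⟩
  filter_upwards [hlarge, eventually_gt_atTop 0] with s hs hs0 y hy x hx
  have hw : s⁻¹ • y ∈ ball θ ρ₀ := by
    rw [mem_ball, dist_eq_norm] at hy ⊢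
    rw [← inv_smul_smul₀ hs0.ne' θ, ← smul_sub, norm_smul, norm_inv, Real.norm_of_nonneg hs0.le,
      inv_mul_lt_iff₀ hs0]
    exact hy.trans (by gcongr)
  have hu : x - (2 * a) • y ∈ ball 0 1 := by
    rwa [mem_ball_zero_iff, ← dist_eq_norm]
  have hq := himp hs (hnear (hball _ hw) (eventually_principal.1 hunit _ hu))
  rw [smul_rescaledPoint a (p := (s, s⁻¹ • y, x - (2 * a) • y)) hs0.ne'] at hq
  simpa only [smul_inv_smul₀ hs0.ne', add_sub_cancel] using hq

theorem exp_le_exp_mul_gaussians {a : ℝ} (ha : 0 < a) {x y : E} (h : ‖x - (2 * a) • y‖ ≤ 1) :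
    Real.exp (-(1 / (4 * a))) ≤ Real.exp (-(1 / (4 * a)) * ‖x‖ ^ 2) * Real.exp (-a * ‖y‖ ^ 2) *
      Real.exp (‖x‖ * ‖y‖) := by
  have habs : |‖x‖ - 2 * a * ‖y‖| ≤ 1 := by
    have := (abs_norm_sub_norm_le x ((2 * a) • y)).trans h
    rwa [norm_smul, Real.norm_of_nonneg (by positivity)] at this
  have hsq : (‖x‖ - 2 * a * ‖y‖) ^ 2 ≤ 1 := (sq_le_one_iff_abs_le_one _).2 habs
  have hcomplete : -(1 / (4 * a)) * ‖x‖ ^ 2 + -a * ‖y‖ ^ 2 + ‖x‖ * ‖y‖ =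
      -(1 / (4 * a)) * (‖x‖ - 2 * a * ‖y‖) ^ 2 := by
    field_simp
    ring
  rw [← Real.exp_add, ← Real.exp_add, hcomplete, neg_mul]
  gcongr
  exact mul_le_of_le_one_right (by positivity) hsq

theorem tendsto_setLIntegral_ball_smul [MeasurableSpace E] [OpensMeasurableSpace E] {μ : Measure E}
    {G : E → ℝ≥0∞} (hG : Measurable G) (hfin : ∫⁻ y, G y ∂μ ≠ ⊤) {θ : E} {ρ : ℝ} (hρ : ρ < ‖θ‖) :
    Tendsto (fun s : ℝ ↦ ∫⁻ y in ball (s • θ) (s * ρ), G y ∂μ) atTop (𝓝 0) := by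
  simp only [← lintegral_indicator measurableSet_ball]
  rw [← lintegral_zero (μ := μ)]
  refine tendsto_lintegral_filter_of_dominated_convergence G
    (Eventually.of_forall fun s ↦ hG.indicator measurableSet_ball)
    (Eventually.of_forall fun s ↦ Eventually.of_forall fun y ↦ indicator_le_self _ _ y) hfin
    (Eventually.of_forall fun y ↦ tendsto_const_nhds.congr' ?_)
  filter_upwards [eventually_ge_atTop (‖y‖ / (‖θ‖ - ρ)), eventually_ge_atTop 0] with s hs hs0
  rw [div_le_iff₀ (sub_pos.2 hρ)] at hs
  refine (indicator_of_notMem (fun hy ↦ ?_) G).symm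
  rw [mem_ball', dist_eq_norm] at hy
  have hnorm := (norm_sub_norm_le (s • θ) y).trans_lt hy
  rw [norm_smul, Real.norm_of_nonneg hs0] at hnorm
  linarith

end NearRay

section DegreeBound

variable {n : ℕ} {P H Q : MvPolynomial (Fin n) ℂ} {a : ℝ}

theorem exists_eventually_le_norm_polyValue_rpow (δ : ℝ) {θ : EuclideanSpace ℝ (Fin n)}
    (hθ : polyValue (MvPolynomial.homogeneousComponent Q.totalDegree Q) θ ≠ 0) :
    ∃ c, 0 < c ∧ ∀ᶠ p : ℝ × EuclideanSpace ℝ (Fin n) in atTop ×ˢ 𝓝 θ,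
      c * p.1 ^ (Q.totalDegree * δ) ≤ ‖polyValue Q (p.1 • p.2)‖ ^ δ := by
  obtain ⟨c, ρ, S, hc, hρ, hS, h⟩ := exists_mul_rpow_le_norm_polyValue_smul_rpow δ hθ
  refine ⟨c, hc, ?_⟩
  filter_upwards [prod_mem_prod (Ici_mem_atTop S) (ball_mem_nhds θ hρ)] with p hp
  have hs : |p.1| = p.1 := abs_of_nonneg (hS.le.trans hp.1)
  simpa only [hs] using h p.1 (hs.symm ▸ hp.1) p.2 hp.2

theorem exists_eventually_le_norm_polyValue {θ : EuclideanSpace ℝ (Fin n)}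
    (hθ : polyValue (MvPolynomial.homogeneousComponent Q.totalDegree Q) θ ≠ 0) :
    ∃ c, 0 < c ∧ ∀ᶠ p : ℝ × EuclideanSpace ℝ (Fin n) in atTop ×ˢ 𝓝 θ,
      c * p.1 ^ (Q.totalDegree : ℝ) ≤ ‖polyValue Q (p.1 • p.2)‖ := by
  simpa only [mul_one, Real.rpow_one] using exists_eventually_le_norm_polyValue_rpow 1 hθ

theorem le_density_polyGauss (ha : 0 < a) {d δ : ℝ} {x y : EuclideanSpace ℝ (Fin n)}
    (hxy : ‖x - (2 * a) • y‖ ≤ 1) {A B C M : ℝ} (hB : 0 ≤ B) (hC : 0 ≤ C)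
    (hPx : A ≤ ‖polyValue P x‖) (hHy : B ≤ ‖polyValue H y‖) (hQy : C ≤ ‖polyValue Q y‖ ^ δ)
    (hM : (1 + ‖x‖ + ‖y‖) ^ d ≤ M) :
    ENNReal.ofReal (A * B * C * Real.exp (-(1 / (4 * a))) / M) ≤
      density (polyGauss (1 / (4 * a)) P) (polyGauss a H) Q d δ x y := by
  have hexp := exp_le_exp_mul_gaussians ha hxy
  rw [density, norm_polyGauss, norm_polyGauss]
  refine ENNReal.ofReal_le_ofReal ?_
  calc A * B * C * Real.exp (-(1 / (4 * a))) / M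
      ≤ ‖polyValue P x‖ * ‖polyValue H y‖ * ‖polyValue Q y‖ ^ δ *
        (Real.exp (-(1 / (4 * a)) * ‖x‖ ^ 2) * Real.exp (-a * ‖y‖ ^ 2) * Real.exp (‖x‖ * ‖y‖)) /
        (1 + ‖x‖ + ‖y‖) ^ d := by gcongr
    _ = _ := by ring

theorem exists_eventually_le_density_polyGauss [NeZero n] (hP : P ≠ 0) (hH : H ≠ 0) (hQ : Q ≠ 0)
    (ha : 0 < a) (d δ : ℝ) :
    ∃ (θ : EuclideanSpace ℝ (Fin n)) (κ : ℝ), θ ≠ 0 ∧ 0 < κ ∧ ∀ᶠ p in nearRay θ,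
      ENNReal.ofReal (κ * p.1 ^ (P.totalDegree + H.totalDegree + Q.totalDegree * δ - d)) ≤
        density (polyGauss (1 / (4 * a)) P) (polyGauss a H) Q d δ (p.1 • rescaledPoint a p)
          (p.1 • p.2.1) := by
  obtain ⟨θ, hθP, hθH, hθQ, hθ⟩ := ((ae_polyValue_ne_zero
    (homogeneousComponent_totalDegree_ne_zero hP)).and ((ae_polyValue_ne_zero
    (homogeneousComponent_totalDegree_ne_zero hH)).and ((ae_polyValue_ne_zero
    (homogeneousComponent_totalDegree_ne_zero hQ)).and
    (compl_mem_ae_iff.2 (measure_singleton (0 : EuclideanSpace ℝ (Fin n))))))).exists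
  have hθP' : polyValue (MvPolynomial.homogeneousComponent P.totalDegree P) ((2 * a) • θ) ≠ 0 := by
    rw [polyValue_smul_of_isHomogeneous (MvPolynomial.homogeneousComponent_isHomogeneous _ P)]
    exact mul_ne_zero (pow_ne_zero _ (ofReal_ne_zero.2 (by positivity))) hθP
  obtain ⟨cP, hcP, hlowP⟩ := exists_eventually_le_norm_polyValue hθP'
  obtain ⟨cH, hcH, hlowH⟩ := exists_eventually_le_norm_polyValue hθH
  obtain ⟨cQ, hcQ, hlowQ⟩ := exists_eventually_le_norm_polyValue_rpow δ hθQ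
  obtain ⟨M, hM, hden⟩ := exists_eventually_rpow_le_nearRay a hθ d
  have hx := (tendsto_fst_nearRay θ).prodMk (tendsto_rescaledPoint_nearRay a θ)
  have hy := (tendsto_fst_nearRay θ).prodMk (tendsto_direction_nearRay θ)
  refine ⟨θ, cP * cH * cQ * Real.exp (-(1 / (4 * a))) / M, hθ, by positivity, ?_⟩
  filter_upwards [hx.eventually hlowP, hy.eventually hlowH, hy.eventually hlowQ, hden,
    (tendsto_fst_nearRay θ).eventually_gt_atTop 0, eventually_norm_lt_one_nearRay θ]
    with p hpP hpH hpQ hpM hs hu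
  have hxy : ‖p.1 • rescaledPoint a p - (2 * a) • p.1 • p.2.1‖ ≤ 1 := by
    rw [smul_rescaledPoint a hs.ne', add_sub_cancel_left]
    exact hu.le
  refine le_of_eq_of_le (congrArg _ ?_) (le_density_polyGauss ha hxy (by positivity)
    (by positivity) hpP hpH hpQ hpM)
  rw [Real.rpow_sub hs, Real.rpow_add hs, Real.rpow_add hs]
  ring

theorem mul_mul_le_setLIntegral_lintegral {F : EuclideanSpace ℝ (Fin n) →
    EuclideanSpace ℝ (Fin n) → ℝ≥0∞} {L : ℝ≥0∞} {s ρ : ℝ} (hs : 0 < s * ρ)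
    {θ : EuclideanSpace ℝ (Fin n)}
    (h : ∀ y ∈ ball (s • θ) (s * ρ), ∀ x ∈ ball ((2 * a) • y) 1, L ≤ F x y) :
    L * ENNReal.ofReal ((s * ρ) ^ n) * volume (ball (0 : EuclideanSpace ℝ (Fin n)) 1) ^ 2 ≤
      ∫⁻ y in ball (s • θ) (s * ρ), ∫⁻ x, F x y := by
  set V := volume (ball (0 : EuclideanSpace ℝ (Fin n)) 1) with hV
  have hinner : ∀ y ∈ ball (s • θ) (s * ρ), L * V ≤ ∫⁻ x, F x y := fun y hy ↦ by
    rw [hV, ← Measure.addHaar_ball_center volume ((2 * a) • y) 1, ← setLIntegral_const]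
    exact (setLIntegral_mono' measurableSet_ball (h y hy)).trans (setLIntegral_le_lintegral _ _)
  calc L * ENNReal.ofReal ((s * ρ) ^ n) * V ^ 2 = L * V * (ENNReal.ofReal ((s * ρ) ^ n) * V) := by
        ring
    _ = ∫⁻ _ in ball (s • θ) (s * ρ), L * V := by
        rw [setLIntegral_const, Measure.addHaar_ball_of_pos volume _ hs, finrank_euclideanSpace_fin]
    _ ≤ _ := setLIntegral_mono' measurableSet_ball hinner

theorem totalDegree_add_totalDegree_lt [NeZero n] (hP : P ≠ 0) (hH : H ≠ 0) (hQ : Q ≠ 0)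
    (ha : 0 < a) {d δ : ℝ}
    (hfin : ∫⁻ x, ∫⁻ y, density (polyGauss (1 / (4 * a)) P) (polyGauss a H) Q d δ x y < ⊤) :
    (P.totalDegree + H.totalDegree : ℝ) < d - n - Q.totalDegree * δ := by
  obtain ⟨θ, κ, hθ, hκ, hlow⟩ := exists_eventually_le_density_polyGauss hP hH hQ ha d δ
  obtain ⟨ρ, hρ, hρθ, hlow⟩ := exists_forall_mem_ball_of_eventually_nearRay
    (p := fun s x y ↦ ENNReal.ofReal
      (κ * s ^ (P.totalDegree + H.totalDegree + Q.totalDegree * δ - d)) ≤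
        density (polyGauss (1 / (4 * a)) P) (polyGauss a H) Q d δ x y) (norm_pos_iff.2 hθ) hlow
  set e : ℝ := P.totalDegree + H.totalDegree + Q.totalDegree * δ - d
  suffices hneg : e + n < 0 by linarith
  by_contra! hE
  have hmeas := measurable_density (Q := Q) (d := d) (δ := δ)
    (continuous_polyGauss (1 / (4 * a)) P).measurable (continuous_polyGauss a H).measurable
  have hlim := tendsto_setLIntegral_ball_smul (μ := volume) hmeas.lintegral_prod_left'
    ((lintegral_lintegral_swap hmeas.aemeasurable).symm.trans_lt hfin).ne hρθ
  set V := volume (ball (0 : EuclideanSpace ℝ (Fin n)) 1)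
  have hV : 0 < V := measure_ball_pos _ _ one_pos
  have hpos : 0 < ENNReal.ofReal (κ * ρ ^ n) * V ^ 2 :=
    ENNReal.mul_pos (ENNReal.ofReal_pos.2 (by positivity)).ne' (pow_ne_zero 2 hV.ne')
  obtain ⟨s, hsmall, hlow, hs⟩ :=
    ((hlim.eventually_lt_const hpos).and (hlow.and (eventually_ge_atTop 1))).exists
  have hs0 : 0 < s := one_pos.trans_le hs
  refine hsmall.not_ge (le_trans ?_ (mul_mul_le_setLIntegral_lintegral (by positivity) hlow))
  rw [← ENNReal.ofReal_mul (by positivity)]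
  gcongr ENNReal.ofReal ?_ * V ^ 2
  calc κ * ρ ^ n ≤ κ * ρ ^ n * s ^ (e + n) :=
        le_mul_of_one_le_right (by positivity) (Real.one_le_rpow hs hE)
    _ = κ * s ^ e * (s * ρ) ^ n := by
        rw [Real.rpow_add hs0, Real.rpow_natCast, mul_pow]
        ring

theorem exists_ae_eq_polyGauss_of_measurable [NeZero n] {f : EuclideanSpace ℝ (Fin n) → ℂ}
    (hf : Measurable f) (hf2 : MemLp f 2 volume) {d δ : ℝ} (hQ : Q ≠ 0)
    (hne : ¬ f =ᵐ[volume] 0)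
    (hfin : ∫⁻ x, ∫⁻ y, density f (l2Fourier f hf2) Q d δ x y < ⊤) :
    ∃ (b : ℝ) (P : MvPolynomial (Fin n) ℂ), 0 < b ∧
      (P.totalDegree : ℝ) < (d - n - Q.totalDegree * δ) / 2 ∧ f =ᵐ[volume] polyGauss b P := by
  obtain ⟨hfi, hFne⟩ := integrable_and_ae_fourierInt_ne_zero hf hf2 hQ hfin hne
  have hfin' : ∫⁻ x, ∫⁻ y, density f (fourierInt f) Q d δ x y < ⊤ := by
    refine lt_of_eq_of_lt (lintegral_congr fun x ↦ lintegral_congr_ae ?_) hfin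
    filter_upwards [l2Fourier_ae_eq hf2 hfi] with y hy
    rw [density, density, hy]
  have hexp := hasExpMoments_of_lintegral_density_lt_top hf
    (continuous_fourierInt hfi).measurable hQ hfin' hFne
  obtain ⟨D, hlines⟩ := exists_ae_doubleIntegral_line_lt_top hexp hQ hfin'
  obtain ⟨a, H, ha, hH⟩ := exists_fourierInt_eq_polyValue_mul hexp hFne hlines
  obtain ⟨P, hPdeg, hP⟩ := exists_ae_eq_polyGauss hfi hf2 ha hH
  have hP0 : P ≠ 0 := by
    rintro rfl
    exact hne (hP.trans (Eventually.of_forall fun x ↦ by simp [polyGauss, polyValue]))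
  have hH0 : H ≠ 0 := by
    rintro rfl
    obtain ⟨y, hy⟩ := hFne.exists
    exact hy (by simp [hH, polyValue])
  have hdeg := totalDegree_add_totalDegree_lt hP0 hH0 hQ ha (d := d) (δ := δ) (by
    refine lt_of_eq_of_lt (lintegral_congr_ae ?_) hfin'
    filter_upwards [hP] with x hx
    simp only [density, hx, hH, polyGauss])
  have hPH : (P.totalDegree : ℝ) ≤ H.totalDegree := by exact_mod_cast hPdeg
  exact ⟨1 / (4 * a), P, by positivity, by linarith, hP⟩

end DegreeBound

end Beurling

theorem theorem2p3_general (n : ℕ) (hn : 1 ≤ n)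
    (f : EuclideanSpace ℝ (Fin n) → ℂ) (hf : MemLp f 2 volume)
    (d δ : ℝ) (m : ℕ)
    (Q : MvPolynomial (Fin n) ℂ) (hQ : Q ≠ 0) (hm : Q.totalDegree = m)
    (hfin : (∫⁻ x : EuclideanSpace ℝ (Fin n), ∫⁻ y : EuclideanSpace ℝ (Fin n),
      ENNReal.ofReal
        (‖f x‖ * ‖l2Fourier f hf y‖ * Real.exp (‖x‖ * ‖y‖) * ‖polyValue Q y‖ ^ δ
          / (1 + ‖x‖ + ‖y‖) ^ d)) < ⊤) :
    ∃ (a : ℝ) (P : MvPolynomial (Fin n) ℂ), 0 < a ∧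
      (P = 0 ∨ (P.totalDegree : ℝ) < (d - n - m * δ) / 2) ∧
      f =ᵐ[volume] fun x => polyValue P x * (Real.exp (-a * ‖x‖ ^ 2) : ℂ) := by
  have : NeZero n := ⟨by omega⟩
  by_cases hne : f =ᵐ[volume] 0
  · exact ⟨1, 0, one_pos, Or.inl rfl,
      hne.trans (Filter.Eventually.of_forall fun x ↦ by simp [polyValue])⟩
  set g := hf.1.mk f
  have hfg : f =ᵐ[volume] g := hf.1.ae_eq_mk
  have hg2 : MemLp g 2 volume := hf.ae_eq hfg
  obtain ⟨a, P, ha, hP, hgP⟩ := Beurling.exists_ae_eq_polyGauss_of_measurable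
    hf.1.stronglyMeasurable_mk.measurable hg2 hQ (fun h ↦ hne (hfg.trans h)) (d := d) (δ := δ) (by
      refine lt_of_eq_of_lt (lintegral_congr_ae ?_) hfin
      filter_upwards [hfg] with x hx
      rw [hx, Beurling.l2Fourier_congr_ae hf hg2 hfg]
      rfl)
  exact ⟨a, P, ha, Or.inr (hm ▸ hP), hfg.trans hgP⟩

theorem theorem2p3 (n : ℕ) (hn : 1 ≤ n)
    (f : EuclideanSpace ℝ (Fin n) → ℂ) (hf : MemLp f 2 volume)
    (d δ : ℝ) (hδ : 0 < δ) (m : ℕ)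
    (Q : MvPolynomial (Fin n) ℂ) (hQ : Q ≠ 0) (hm : Q.totalDegree = m)
    (hfin : (∫⁻ x : EuclideanSpace ℝ (Fin n), ∫⁻ y : EuclideanSpace ℝ (Fin n),
      ENNReal.ofReal
        (‖f x‖ * ‖l2Fourier f hf y‖ * Real.exp (‖x‖ * ‖y‖) * ‖polyValue Q y‖ ^ δ
          / (1 + ‖x‖ + ‖y‖) ^ d)) < ⊤) :
    ∃ (a : ℝ) (P : MvPolynomial (Fin n) ℂ), 0 < a ∧
      (P = 0 ∨ (P.totalDegree : ℝ) < (d - n - m * δ) / 2) ∧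
      f =ᵐ[volume] fun x => polyValue P x * (Real.exp (-a * ‖x‖ ^ 2) : ℂ) :=
  theorem2p3_general n hn f hf d δ m Q hQ hm hfin
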